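/- **Setting.** Let $\mu>0$. Each particle lives an exponential time with parameter $\mu$ and at its death produces a random number of children with p.g.f. $f$, all life lengths and numbers of children being independent; $Z(t)$ is the number of particles alive at time $t$ when $Z(0)=1$, and $F(t;s)=\mathbf E[s^{Z(t)}]$. Let $\nu$ be a Poisson process on $[0,\infty)$ with local intensity $r(t)\ge 0$ and jump times $S_1<S_2<\cdots$, let $I_1,I_2,\dots$ be i.i.d. non-negative integer valued with p.g.f. $g$, let $Z^{(k,j)}$ be i.i.d. copies of $Z$, let these three collections be independent, and put $$Y(t)=\sum_{k=1}^{\nu(t)}\sum_{j=1}^{I_k}Z^{(k,j)}(t-S_k),\qquad t\ge 0 .$$ Assume that, with functions $L,l,L_R$ slowly varying at infinity, $\gamma,\alpha\in(0,1]$ and $\theta\ge 1$, $$f(s)=s+(1-s)^{\gamma+1}L\Big(\frac1{1-s}\Big),\quad g(s)=1-(1-s)^{\alpha}\,l\Big(\frac1{1-s}\Big)\quad(0\le s<1),\qquad r(t)=t^{-\theta}L_R(t)\quad(t>0).$$ Let $V(x)=\int_0^{1-1/x}\frac{du}{f(u)-u}$ for $x\ge1$, let $W$ be the inverse function of $V:[1,\infty)\to[0,\infty)$,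 and put $$q(t;s)=1-g(F(t;s)),\quad q(t)=q(t;0),\quad R=\int_0^\infty r(t)\,dt,\quad Q=\int_0^\infty q(t)\,dt,\quad \Delta(s)=\int_0^\infty q(u;s)\,du .$$ **Theorem 5.1.** Assume in addition that $\alpha/\gamma\ge1$, $R<\infty$ and $Q<\infty$. Then $\Delta(s)<\infty$ for $0\le s\le 1$, $\Delta(s)\to0$ as $s\uparrow1$, and $\mathbf P\{Y(t)>0\}>0$ for all large $t$. Moreover there is a probability distribution $D(\alpha,\gamma)$ on $(0,\infty)$, with distribution function $D(\alpha,\gamma;x)$, such that $$\int_0^\infty e^{-\lambda x}\,dD(\alpha,\gamma;x)=1-\frac{\lambda^\alpha}{(1+\lambda^\gamma)^{\alpha/\gamma}},\qquad\lambda>0,$$ and the following holds as $t\to\infty$. (i) If $q(t)=o(r(t))$, then $\mathbf E[s^{Y(t)}\mid Y(t)>0]\to 1-\Delta(s)/Q$ for every $s\in[0,1]$. (ii) If $r(t)=o(q(t))$, then $\mathbf P\{Y(t)/W(\mu t)\le x\mid Y(t)>0\}\to D(\alpha,\gamma;x)$ for every $x\ge0$. (iii) If $r(t)/q(t)\to d\in(0,\infty)$,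 then $$\mathbf E[s^{Y(t)}\mid Y(t)>0]\to\frac{dQ}{dQ+R}\Big(1-\frac{\Delta(s)}{Q}\Big)\quad\text{for every } s\in[0,1),$$ $$\mathbf P\{Y(t)/W(\mu t)\le x\mid Y(t)>0\}\to\frac{dQ+R\,D(\alpha,\gamma;x)}{dQ+R}\quad\text{for every } x>0 .$$ (The first limit tends to $dQ/(dQ+R)$ as $s\uparrow1$, so it has an atom of mass $R/(dQ+R)$ at infinity; the second is the distribution function of a law with an atom of mass $dQ/(dQ+R)$ at zero.) -/

import Mathlib

open MeasureTheory ProbabilityTheory Filter Topology Set Asymptotics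
open scoped NNReal

/-- `L` is slowly varying at infinity: from some point on it is positive and (Lebesgue) measurable,
and `L (c x) / L x → 1` as `x → ∞` for every `c > 0`. -/
def SlowlyVarying (L : ℝ → ℝ) : Prop :=
  (∃ a : ℝ, (∀ x, a ≤ x → 0 < L x) ∧ AEMeasurable L (volume.restrict (Ici a))) ∧
    ∀ c : ℝ, 0 < c → Tendsto (fun x => L (c * x) / L x) atTop (𝓝 1)

/-- Probability generating function of a distribution on `ℕ`. -/
noncomputable def pgf (p : PMF ℕ) (s : ℝ) : ℝ := ∑' k : ℕ, (p k).toReal * s ^ k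

namespace MarkovBranching

/-- The data of one family tree: to every potential particle (a finite word over `ℕ`; the word `[]`
is the ancestor, `j :: v` is the descendant `v` of the `j`-th child of the ancestor) a life length
and a number of children. -/
abbrev TreeData : Type := List ℕ → ℝ × ℕ

/-- The particle with the given label belongs to the tree of an ancestor born at time `0` and is
alive at time `t`. A particle is alive from its birth on, until (and excluding) its death; at its
death it is replaced by its children, which are numbered `0, 1, …`. -/
def Alive : TreeData → ℝ → List ℕ → Prop
  | x, t, [] => 0 ≤ t ∧ t < (x []).1
  | x, t, j :: v => j < (x []).2 ∧ Alive (fun w => x (j :: w)) (t - (x []).1) v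

/-- `Z(t)`: the number of particles alive at time `t`, in the tree of one ancestor born at time `0`.
(The trees below are critical, and then almost surely finitely many particles are alive.) -/
noncomputable def Z (t : ℝ) (x : TreeData) : ℕ := {u : List ℕ | Alive x t u}.ncard

/-- The law of the family tree: all life lengths and all numbers of children are independent,
the former exponential with parameter `μ`, the latter with distribution `p`. -/
noncomputable def treeLaw (μ : ℝ) (p : PMF ℕ) : Measure TreeData :=
  Measure.infinitePi fun _ : List ℕ => (expMeasure μ).prod p.toMeasure

/-- `F(t;s) = E[s ^ Z(t) | Z(0) = 1]`. -/
noncomputable def F (μ : ℝ) (p : PMF ℕ) (t s : ℝ) : ℝ := ∫ x, s ^ Z t x ∂(treeLaw μ p)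

/-- `U(s) = ∫₀ˢ du / (f(u) - u)`, `f` the offspring generating function. -/
noncomputable def U (p : PMF ℕ) (s : ℝ) : ℝ := ∫ u in (0 : ℝ)..s, 1 / (pgf p u - u)

/-- `V(x) = U(1 - 1/x)`, for `x ≥ 1`. -/
noncomputable def V (p : PMF ℕ) (x : ℝ) : ℝ := U p (1 - 1 / x)

/-- `W`, the inverse function of `V : [1, ∞) → [0, ∞)`. -/
noncomputable def W (p : PMF ℕ) (y : ℝ) : ℝ := Function.invFunOn (V p) (Ici 1) y

/-- `q(t;s) = 1 - g(F(t;s))`, `g` the generating function of the number of immigrants; one writes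
`q(t)` for `q(t;0)`. -/
noncomputable def q (μ : ℝ) (p im : PMF ℕ) (t s : ℝ) : ℝ := 1 - pgf im (F μ p t s)

/-- `Δ(s) = ∫₀^∞ q(u;s) du`. -/
noncomputable def Δ (μ : ℝ) (p im : PMF ℕ) (s : ℝ) : ℝ := ∫ u in Ioi (0 : ℝ), q μ p im u s

/-- `Q = ∫₀^∞ q(u) du = Δ(0)`. -/
noncomputable def Q (μ : ℝ) (p im : PMF ℕ) : ℝ := ∫ u in Ioi (0 : ℝ), q μ p im u 0

variable {Ω : Type*} [MeasurableSpace Ω]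

/-- `ν` is a Poisson process with local intensity `r`: it starts at `0`, its paths are
(almost surely) nondecreasing and right continuous, its increments are independent, and
`ν t - ν s` has the Poisson distribution with mean `∫ₛᵗ r(u) du`. -/
structure IsPoissonProcess (r : ℝ → ℝ) (ν : ℝ≥0 → Ω → ℕ) (P : Measure Ω) : Prop where
  measurable : ∀ t, Measurable (ν t)
  zero : ∀ᵐ ω ∂P, ν 0 ω = 0
  mono : ∀ᵐ ω ∂P, Monotone fun t => ν t ω
  rightCont : ∀ᵐ ω ∂P, ∀ t, ContinuousWithinAt (fun u => ν u ω) (Ici t) t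
  indepIncrements : HasIndepIncrements ν P
  law : ∀ s t : ℝ≥0, s ≤ t →
    HasLaw (fun ω => ν t ω - ν s ω) (poissonMeasure (∫ u in (s : ℝ)..t, r u).toNNReal) P

/-- The random objects from which a Markov branching process with non-homogeneous Poisson
immigration is built: the immigration times are the jump times of the Poisson process `ν` of
intensity `r`, the numbers `I k` of immigrants are independent with distribution `im`, the family
trees `T k j` of the immigrants are independent with law `treeLaw μ p`, and these three collections
are independent of each other. -/
structure IsMBPNPI (μ : ℝ) (p im : PMF ℕ) (r : ℝ → ℝ) (ν : ℝ≥0 → Ω → ℕ) (I : ℕ → Ω → ℕ)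
    (T : ℕ → ℕ → Ω → TreeData) (P : Measure Ω) : Prop where
  poisson : IsPoissonProcess r ν P
  measurable_I : ∀ k, Measurable (I k)
  law_I : ∀ k, HasLaw (I k) im.toMeasure P
  indep_I : iIndepFun I P
  measurable_T : ∀ k j, Measurable (T k j)
  law_T : ∀ k j, HasLaw (T k j) (treeLaw μ p) P
  indep_T : iIndepFun (fun kj : ℕ × ℕ => T kj.1 kj.2) P
  indep_I_T : IndepFun (fun ω k => I k ω) (fun ω k j => T k j ω) P
  indep_ν_I_T : IndepFun (fun ω t => ν t ω) (fun ω => (fun k => I k ω, fun k j => T k j ω)) P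

/-- `S_k`, the time of the `k`-th jump of `ν`, for `k ≥ 1` (used only if there is such a jump). -/
noncomputable def S (ν : ℝ≥0 → Ω → ℕ) (k : ℕ) (ω : Ω) : ℝ≥0 := sInf {t | k ≤ ν t ω}

/-- `Y(t) = ∑_{k=1}^{ν(t)} ∑_{j=1}^{I_k} Z^{(k,j)}(t - S_k)`. -/
noncomputable def Y (ν : ℝ≥0 → Ω → ℕ) (I : ℕ → Ω → ℕ) (T : ℕ → ℕ → Ω → TreeData)
    (t : ℝ≥0) (ω : Ω) : ℕ :=
  ∑ k ∈ Finset.Icc 1 (ν t ω), ∑ j ∈ Finset.Icc 1 (I k ω), Z ((t : ℝ) - S ν k ω) (T k j ω)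

end MarkovBranching

/-! ### Probability generating functions on the unit interval -/

section PGF

variable (p : PMF ℕ)

/-! Put $K(t;s)=\int_0^t r(u)\,q(t-u;s)\,du$ (`cumulant`). A group arriving at time $u$ contributes
the factor $g(F(t-u;s))$, so the generating functional of the Poisson process
(`integral_prod_jumpTime`) gives $\mathbf E[s^{Y(t)}]=e^{-K(t;s)}$ (`IsMBPNPI.integral_pow_Y`).
Hence $\mathbf E[s^{Y(t)}\mid Y(t)>0]=1-(1-e^{-K(t;s)})/(1-e^{-K(t;0)})$. Since $K(t;0)\to0$, only
the limit of $K(t;s)/K(t;0)$ matters, where $s$ may depend on $t$.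

Both $r$ and $q$ are integrable and vary regularly, so the convolution $K$ lives at its two ends:
cutting at $t/2$ gives $K(t;s)=r(t)A(t)+q(t)B(t)$ with $A\to\Delta(s)$ and $B\to R\varphi$, where
$\varphi=\lim q(t-u;s)/q(t)$ (`exists_convolution_asymptotics`). The first term comes from recent
immigrants, the second from old ones whose families have survived. The comparison of $r$ with $q$
decides which term wins. For fixed $s<1$ one has $\varphi=1$. For $s=\exp(-\lambda/W(\mu t))\to1$
the first term loses its weight, because $\Delta(1)=0$, and
$\varphi=\lambda^\alpha/(1+\lambda^\gamma)^{\alpha/\gamma}$.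

These values of $\varphi$ come from an explicit solution. The renewal equation `F_renewal` gives
$\partial_tF=\mu(f(F)-F)$, and separating variables gives $U(F(t;s))=U(s)+\mu t$ (`U_F`), i.e.
$1/(1-F(t;s))=W(\mu t+V(1/(1-s)))$. Here $V$, $W$ and $x\mapsto1-g(1-1/x)$ vary regularly with
indices $\gamma$, $1/\gamma$ and $-\alpha$; these combine in `tendsto_q_ratio`. The intensity $r$
need not be monotone, and is controlled by the uniform convergence theorem `SlowlyVarying.uniform`.

The law $D(\alpha,\gamma)$ is obtained as the limit law of one scaled group of immigrants given its
survival (`exists_measure_of_tendsto_laplace`). Its Laplace transform extends to a half-plane and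
decays at infinity, so its characteristic function vanishes at infinity and it has no atoms
(`measure_singleton_of_laplace`). The continuity theorem `tendsto_cdf_of_tendsto_laplace` therefore
gives convergence of distribution functions at every point; in (iii) the limit is a mixture of
$D(\alpha,\gamma)$ with a point mass at $0$. -/

lemma hasSum_pmf_toReal : HasSum (fun k => (p k).toReal) 1 := by
  have h := ENNReal.hasSum_toReal (f := fun k => p k) p.tsum_coe_ne_top
  rwa [← ENNReal.tsum_toReal_eq fun k => p.apply_ne_top k, p.tsum_coe, ENNReal.toReal_one] at h

lemma norm_pgf_term_le {s : ℝ} (hs : s ∈ Icc (-1 : ℝ) 1) (k : ℕ) :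
    ‖(p k).toReal * s ^ k‖ ≤ (p k).toReal := by
  rw [norm_mul, norm_pow, Real.norm_of_nonneg ENNReal.toReal_nonneg]
  exact mul_le_of_le_one_right ENNReal.toReal_nonneg (pow_le_one₀ (norm_nonneg _) (abs_le.2 hs))

lemma summable_pgf {s : ℝ} (hs : s ∈ Icc (-1 : ℝ) 1) :
    Summable fun k : ℕ => (p k).toReal * s ^ k :=
  (hasSum_pmf_toReal p).summable.of_norm_bounded (norm_pgf_term_le p hs)

lemma mem_Icc_neg_one {s : ℝ} (hs : s ∈ Icc (0 : ℝ) 1) : s ∈ Icc (-1 : ℝ) 1 :=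
  ⟨by linarith [hs.1], hs.2⟩

lemma continuousOn_pgf : ContinuousOn (pgf p) (Icc (-1) 1) :=
  continuousOn_tsum (fun _ => by fun_prop) (hasSum_pmf_toReal p).summable
    fun k _ hs => norm_pgf_term_le p hs k

lemma pgf_one : pgf p 1 = 1 := by
  simpa [pgf] using (hasSum_pmf_toReal p).tsum_eq

lemma pgf_monotoneOn : MonotoneOn (pgf p) (Icc 0 1) := by
  intro a ha b hb hab
  refine (summable_pgf p (mem_Icc_neg_one ha)).tsum_le_tsum (fun k => ?_)
    (summable_pgf p (mem_Icc_neg_one hb))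
  exact mul_le_mul_of_nonneg_left (pow_le_pow_left₀ ha.1 hab k) ENNReal.toReal_nonneg

lemma pgf_mem_Icc {s : ℝ} (hs : s ∈ Icc (0 : ℝ) 1) : pgf p s ∈ Icc (0 : ℝ) 1 :=
  ⟨tsum_nonneg fun k => mul_nonneg ENNReal.toReal_nonneg (pow_nonneg hs.1 k),
    (pgf_monotoneOn p hs (right_mem_Icc.2 zero_le_one) hs.2).trans (pgf_one p).le⟩

lemma pgf_eq_integral {s : ℝ} (hs : s ∈ Icc (0 : ℝ) 1) :
    pgf p s = ∫ k, s ^ k ∂p.toMeasure := by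
  rw [PMF.integral_eq_tsum]
  · simp [pgf]
  · refine Integrable.of_bound (C := 1) (by fun_prop) (ae_of_all _ fun k => ?_)
    rw [norm_pow, Real.norm_of_nonneg hs.1]
    exact pow_le_one₀ hs.1 hs.2

/-- The first moment is at most one as soon as `s ≤ pgf p s` for `s` close to `1`. -/
lemma summable_mul_pmf_of_le (h : ∀ᶠ s in 𝓝[<] (1 : ℝ), s ≤ pgf p s) :
    Summable (fun k : ℕ => (p k).toReal * k) ∧ ∑' k : ℕ, (p k).toReal * k ≤ 1 := by
  have key : ∀ N : ℕ, ∑ k ∈ Finset.range N, (p k).toReal * k ≤ 1 := by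
    intro N
    -- For $s$ near $1$, $(1-s)\sum_{k<N}p_k(1+\dots+s^{k-1})\le1-f(s)\le1-s$. Cancelling $1-s$ and
    -- letting $s\uparrow1$ in the finite sum bounds the truncated mean.
    have hlim : Tendsto (fun s : ℝ => ∑ k ∈ Finset.range N,
        (p k).toReal * ∑ i ∈ Finset.range k, s ^ i) (𝓝[<] 1)
        (𝓝 (∑ k ∈ Finset.range N, (p k).toReal * ∑ i ∈ Finset.range k, (1 : ℝ) ^ i)) := by
      refine Tendsto.mono_left (Continuous.tendsto ?_ 1) nhdsWithin_le_nhds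
      fun_prop
    simp only [one_pow, Finset.sum_const, Finset.card_range, nsmul_eq_mul, mul_one] at hlim
    refine le_of_tendsto hlim ?_
    filter_upwards [h, Ioo_mem_nhdsLT (show (0 : ℝ) < 1 by norm_num)] with s hs h01
    have hsI : s ∈ Icc (-1 : ℝ) 1 := ⟨by linarith [h01.1], h01.2.le⟩
    have hpos : 0 < 1 - s := by linarith [h01.2]
    have h1 : ∑ k ∈ Finset.range N, ((p k).toReal - (p k).toReal * s ^ k) ≤ 1 - pgf p s := by
      have hs' := (hasSum_pmf_toReal p).sub (summable_pgf p hsI).hasSum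
      refine sum_le_hasSum _ (fun k _ => ?_) hs'
      exact sub_nonneg.2 ((le_abs_self _).trans (norm_pgf_term_le p hsI k))
    have h2 : ∑ k ∈ Finset.range N, ((p k).toReal - (p k).toReal * s ^ k) =
        (1 - s) * ∑ k ∈ Finset.range N, (p k).toReal * ∑ i ∈ Finset.range k, s ^ i := by
      rw [Finset.mul_sum]
      refine Finset.sum_congr rfl fun k _ => ?_
      have := mul_neg_geom_sum s k
      linear_combination (-(p k).toReal) * this
    rw [h2] at h1
    have h3 : (1 - s) * ∑ k ∈ Finset.range N, (p k).toReal * ∑ i ∈ Finset.range k, s ^ i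
      ≤ (1 - s) * 1 := by linarith
    exact le_of_mul_le_mul_left h3 hpos
  have hnn : ∀ k : ℕ, 0 ≤ (p k).toReal * k := fun k => by positivity
  have hsum : Summable (fun k : ℕ => (p k).toReal * k) := summable_of_sum_range_le hnn key
  exact ⟨hsum, hsum.tsum_le_of_sum_range_le key⟩

/-- Termwise $b^k-a^k\le k(b-a)$, and the mean is at most one. Thus $f(u)-u$ is nonincreasing, which
carries its sign near $1$ back to all of $[0,1)$. -/
lemma pgf_sub_le_of_mean_le (h : ∀ᶠ s in 𝓝[<] (1 : ℝ), s ≤ pgf p s) {a b : ℝ}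
    (ha : a ∈ Icc (0 : ℝ) 1) (hb : b ∈ Icc (0 : ℝ) 1) (hab : a ≤ b) :
    pgf p b - pgf p a ≤ b - a := by
  obtain ⟨hs, h1⟩ := summable_mul_pmf_of_le p h
  have hd := (summable_pgf p (mem_Icc_neg_one hb)).hasSum.sub
    (summable_pgf p (mem_Icc_neg_one ha)).hasSum
  have h2 : pgf p b - pgf p a ≤ (b - a) * ∑' k : ℕ, (p k).toReal * k := by
    refine hasSum_le (fun k => ?_) hd (hs.hasSum.mul_left (b - a))
    have h3 : b ^ k - a ^ k ≤ (b - a) * k := by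
      rw [← (Commute.all b a).mul_geom_sum₂ k]
      refine mul_le_mul_of_nonneg_left ?_ (by linarith)
      calc ∑ i ∈ Finset.range k, b ^ i * a ^ (k - 1 - i) ≤ ∑ i ∈ Finset.range k, (1 : ℝ) :=
            Finset.sum_le_sum fun i _ => mul_le_one₀ (pow_le_one₀ hb.1 hb.2)
              (pow_nonneg ha.1 _) (pow_le_one₀ ha.1 ha.2)
        _ = k := by simp
    have := mul_le_mul_of_nonneg_left h3 (ENNReal.toReal_nonneg (a := p k))
    linarith
  have h4 : (b - a) * ∑' k : ℕ, (p k).toReal * k ≤ (b - a) * 1 :=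
    mul_le_mul_of_nonneg_left h1 (by linarith)
  linarith

end PGF

/-! ### Behaviour of the offspring generating function near one -/

lemma tendsto_one_div_one_sub : Tendsto (fun s : ℝ => 1 / (1 - s)) (𝓝[<] 1) atTop := by
  simp_rw [one_div]
  refine tendsto_inv_nhdsGT_zero.comp ?_
  refine tendsto_nhdsWithin_iff.2 ⟨?_, ?_⟩
  · have : Tendsto (fun s : ℝ => 1 - s) (𝓝 1) (𝓝 (1 - 1)) := by
      exact Continuous.tendsto (by fun_prop) 1
    rw [sub_self] at this
    exact this.mono_left nhdsWithin_le_nhds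
  · filter_upwards [self_mem_nhdsWithin] with s hs
    simpa using hs

lemma SlowlyVarying.eventually_pos {L : ℝ → ℝ} (hL : SlowlyVarying L) : ∀ᶠ x in atTop, 0 < L x := by
  obtain ⟨⟨a, ha, -⟩, -⟩ := hL
  exact eventually_atTop.2 ⟨a, ha⟩

section Critical

variable {p : PMF ℕ} {γ : ℝ} {L : ℝ → ℝ}

lemma eventually_lt_pgf (hL : SlowlyVarying L)
    (hf : ∀ s ∈ Ico (0 : ℝ) 1, pgf p s = s + (1 - s) ^ (γ + 1) * L (1 / (1 - s))) :
    ∀ᶠ s in 𝓝[<] (1 : ℝ), s < pgf p s := by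
  filter_upwards [tendsto_one_div_one_sub.eventually hL.eventually_pos,
    Ioo_mem_nhdsLT (show (0 : ℝ) < 1 by norm_num)] with s h1 h2
  rw [hf s ⟨h2.1.le, h2.2⟩]
  have := Real.rpow_pos_of_pos (sub_pos.2 h2.2) (γ + 1)
  nlinarith [mul_pos this h1]

/-- An offspring distribution with mean at most one, not concentrated at one child. -/
structure Subcritical (p : PMF ℕ) : Prop where
  ev : ∀ᶠ s in 𝓝[<] (1 : ℝ), s < pgf p s

lemma Subcritical.ev_le (h : Subcritical p) : ∀ᶠ s in 𝓝[<] (1 : ℝ), s ≤ pgf p s :=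
  h.ev.mono fun _ => le_of_lt

lemma Subcritical.sub_antitoneOn (h : Subcritical p) :
    AntitoneOn (fun u => pgf p u - u) (Icc 0 1) := by
  intro a ha b hb hab
  have := pgf_sub_le_of_mean_le p h.ev_le ha hb hab
  simp only
  linarith

lemma Subcritical.lt_pgf (h : Subcritical p) {u : ℝ} (hu : u ∈ Ico (0 : ℝ) 1) :
    u < pgf p u := by
  obtain ⟨b, h1, h2⟩ := (h.ev.and (Ioo_mem_nhdsLT hu.2)).exists
  have := h.sub_antitoneOn ⟨hu.1, hu.2.le⟩ ⟨hu.1.trans h2.1.le, h2.2.le⟩ h2.1.le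
  simp only at this
  linarith

lemma Subcritical.of_eq (hL : SlowlyVarying L)
    (hf : ∀ s ∈ Ico (0 : ℝ) 1, pgf p s = s + (1 - s) ^ (γ + 1) * L (1 / (1 - s))) :
    Subcritical p := ⟨eventually_lt_pgf hL hf⟩

end Critical

/-! ### The branching property: decomposing a tree at its ancestor -/

/-- The family indexed by words whose value at `[]` is `a`, and whose values at the words `j :: w`
are given by `y j`. -/
def joinTree {X : Type*} (a : X) (y : ℕ → List ℕ → X) : List ℕ → X
  | [] => a
  | j :: w => y j w

lemma measurable_joinTree {X : Type*} [MeasurableSpace X] :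
    Measurable fun ay : X × (ℕ → List ℕ → X) => joinTree ay.1 ay.2 := by
  refine measurable_pi_lambda _ fun w => ?_
  cases w with
  | nil => exact measurable_fst
  | cons j w =>
    exact (measurable_pi_apply w).comp ((measurable_pi_apply j).comp measurable_snd)

/-- The branching property: the ancestor's data and the subtrees of its potential children are
independent, and each subtree has the law of the whole tree. It suffices to test boxes; a nonempty
word is a pair (first letter, rest), so their product factors through currying. -/
lemma infinitePi_map_joinTree {X : Type*} [MeasurableSpace X] (m : Measure X)
    [IsProbabilityMeasure m] :
    (m.prod (Measure.infinitePi fun _ : ℕ => Measure.infinitePi fun _ : List ℕ => m)).map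
      (fun ay => joinTree ay.1 ay.2) = Measure.infinitePi fun _ : List ℕ => m := by
  classical
  refine Measure.eq_infinitePi _ fun s t ht => ?_
  have hinj : Function.Injective fun jw : ℕ × List ℕ => jw.1 :: jw.2 := by
    rintro ⟨a, b⟩ ⟨c, d⟩ h
    simpa using h
  set s' : Finset (ℕ × List ℕ) := s.preimage (fun jw => jw.1 :: jw.2) hinj.injOn with hs'
  set t' : ℕ × List ℕ → Set X := fun jw => t (jw.1 :: jw.2) with ht'
  have hset : (fun ay : X × (ℕ → List ℕ → X) => joinTree ay.1 ay.2) ⁻¹' Set.pi s t =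
      (if [] ∈ s then t [] else univ) ×ˢ
        ((MeasurableEquiv.curry ℕ (List ℕ) X) '' Set.pi s' t') := by
    rw [MeasurableEquiv.image_eq_preimage_symm]
    ext ⟨a, y⟩
    simp only [mem_preimage, Set.mem_pi, mem_prod]
    constructor
    · intro h
      refine ⟨?_, fun jw hjw => ?_⟩
      · split_ifs with h0
        · exact h [] h0
        · trivial
      · exact h (jw.1 :: jw.2) (by simpa [hs'] using hjw)
    · rintro ⟨h0, h1⟩ w hw
      cases w with
      | nil =>
        rw [if_pos (by simpa using hw)] at h0
        exact h0
      | cons j w => exact h1 (j, w) (by simpa [hs'] using hw)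
  rw [Measure.map_apply measurable_joinTree
    (MeasurableSet.pi s.countable_toSet fun i _ => ht i), hset, Measure.prod_prod,
    MeasurableEquiv.image_eq_preimage_symm, ← Measure.map_apply (MeasurableEquiv.measurable _)
      (MeasurableSet.pi s'.countable_toSet fun i _ => ht _),
    Measure.infinitePi_map_curry_symm (fun _ _ => m), Measure.infinitePi_pi _ fun i _ => ht _]
  have h1 : ∏ i ∈ s', m (t' i) = ∏ w ∈ s, if w = [] then 1 else m (t w) := by
    rw [← Finset.prod_preimage (fun jw : ℕ × List ℕ => jw.1 :: jw.2) s hinj.injOn]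
    · simp [t', s']
    · intro w _ hw
      cases w with
      | nil => simp
      | cons j w => exact absurd ⟨(j, w), rfl⟩ hw
  have h2 : m (if [] ∈ s then t [] else univ) = ∏ w ∈ s, if w = [] then m (t w) else 1 := by
    rw [Finset.prod_ite_eq' s [] fun w => m (t w)]
    split_ifs <;> simp
  rw [h1, h2, ← Finset.prod_mul_distrib]
  refine Finset.prod_congr rfl fun w _ => ?_
  split_ifs <;> simp

namespace MarkovBranching

variable {μ : ℝ} {p : PMF ℕ}

instance : IsProbabilityMeasure p.toMeasure := PMF.toMeasure.isProbabilityMeasure p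

lemma isProbabilityMeasure_node (hμ : 0 < μ) :
    IsProbabilityMeasure ((expMeasure μ).prod p.toMeasure) := by
  have := isProbabilityMeasure_expMeasure hμ
  infer_instance

lemma isProbabilityMeasure_treeLaw (hμ : 0 < μ) : IsProbabilityMeasure (treeLaw μ p) := by
  have := isProbabilityMeasure_node (p := p) hμ
  unfold treeLaw
  infer_instance

lemma treeLaw_map_joinTree (hμ : 0 < μ) :
    (((expMeasure μ).prod p.toMeasure).prod (Measure.infinitePi fun _ : ℕ => treeLaw μ p)).map
      (fun ay => joinTree ay.1 ay.2) = treeLaw μ p := by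
  have := isProbabilityMeasure_node (p := p) hμ
  exact infinitePi_map_joinTree _

lemma measurableSet_alive (u : List ℕ) :
    MeasurableSet {tx : ℝ × TreeData | Alive tx.2 tx.1 u} := by
  induction u with
  | nil =>
    have h1 : Measurable fun tx : ℝ × TreeData => (tx.2 []).1 := by fun_prop
    exact (measurableSet_le measurable_const measurable_fst).inter
      (measurableSet_lt measurable_fst h1)
  | cons j v ih =>
    have h1 : Measurable fun tx : ℝ × TreeData => (tx.2 []).1 := by fun_prop
    have h2 : Measurable fun tx : ℝ × TreeData => (tx.2 []).2 := by fun_prop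
    have h3 : Measurable fun tx : ℝ × TreeData =>
        (tx.1 - (tx.2 []).1, fun w => tx.2 (j :: w)) := by fun_prop
    exact (measurableSet_lt measurable_const h2).inter (h3 ih)

lemma measurable_Z : Measurable fun tx : ℝ × TreeData => Z tx.1 tx.2 := by
  refine measurable_ncard.comp (measurable_set_iff.2 fun u => ?_)
  exact measurableSet_setOfPred.1 (measurableSet_alive u)

open Classical in
/-- The number of particles alive at time `t`, as an extended nonnegative real. -/
noncomputable def count (t : ℝ) (x : TreeData) : ENNReal :=
  ∑' u : List ℕ, if Alive x t u then 1 else 0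

lemma count_eq_encard (t : ℝ) (x : TreeData) :
    count t x = ({u : List ℕ | Alive x t u}.encard : ENNReal) := by
  classical
  rw [← ENNReal.tsum_set_one, tsum_subtype _ fun _ => (1 : ENNReal)]
  simp [count, indicator_apply]

lemma count_eq_Z {t : ℝ} {x : TreeData} (h : count t x ≠ ⊤) : count t x = Z t x := by
  rw [count_eq_encard] at h ⊢
  have hf : {u : List ℕ | Alive x t u}.Finite := by
    rw [← Set.encard_ne_top_iff]
    rintro h'
    simp [h'] at h
  rw [Z, ← hf.cast_ncard_eq]
  simp

lemma measurable_count : Measurable fun tx : ℝ × TreeData => count tx.1 tx.2 := by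
  classical
  refine Measurable.tsum fun u => ?_
  exact Measurable.ite (measurableSet_alive u) measurable_const measurable_const

lemma tsum_list (g : List ℕ → ENNReal) :
    ∑' u, g u = g [] + ∑' j : ℕ, ∑' w : List ℕ, g (j :: w) := by
  classical
  have hinj : Function.Injective fun jw : ℕ × List ℕ => jw.1 :: jw.2 := by
    rintro ⟨a, b⟩ ⟨c, d⟩ h
    simpa using h
  rw [ENNReal.tsum_eq_add_tsum_ite [], ← hinj.tsum_eq, ← ENNReal.tsum_prod]
  · simp
  · intro w hw
    cases w with
    | nil => simp at hw
    | cons j w => exact ⟨(j, w), rfl⟩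

lemma tsum_ite_lt (n : ℕ) (g : ℕ → ENNReal) :
    ∑' j, (if j < n then g j else 0) = ∑ j ∈ Finset.range n, g j := by
  rw [tsum_eq_sum (s := Finset.range n)]
  · exact Finset.sum_congr rfl fun j hj => if_pos (Finset.mem_range.1 hj)
  · intro j hj
    exact if_neg (by simpa using hj)

-- This recursion needs no finiteness. The corresponding one for `Z` can fail, since `ncard` is $0$
-- on infinite sets; it is recovered later, almost surely, from `count`.
open Classical in
lemma count_joinTree (t : ℝ) (a : ℝ × ℕ) (y : ℕ → TreeData) :
    count t (joinTree a y) = (if 0 ≤ t ∧ t < a.1 then 1 else 0) +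
      ∑ j ∈ Finset.range a.2, count (t - a.1) (y j) := by
  rw [count, tsum_list, ← tsum_ite_lt]
  refine congrArg₂ (· + ·) (if_congr Iff.rfl rfl rfl) (tsum_congr fun j => ?_)
  by_cases hj : j < a.2
  · simp only [hj, if_true, count]
    refine tsum_congr fun w : List ℕ => ?_
    congr 1
    simp [Alive, joinTree, hj]
  · simp [hj, Alive, joinTree]

end MarkovBranching

/-! ### Almost sure finiteness of the population through its mean -/

namespace MarkovBranching

variable {μ : ℝ} {p : PMF ℕ}

/-- The law of the life length and the number of children of a particle. -/
noncomputable abbrev nodeLaw (μ : ℝ) (p : PMF ℕ) : Measure (ℝ × ℕ) :=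
  (expMeasure μ).prod p.toMeasure

lemma expMeasure_eq_withDensity (μ : ℝ) :
    expMeasure μ = volume.withDensity (exponentialPDF μ) := rfl

lemma ae_nonneg_expMeasure (μ : ℝ) : ∀ᵐ τ ∂(expMeasure μ), 0 ≤ τ := by
  rw [expMeasure_eq_withDensity, ae_withDensity_iff
    (show Measurable (exponentialPDF μ) from (measurable_exponentialPDFReal μ).ennreal_ofReal)]
  refine ae_of_all _ fun τ h => ?_
  by_contra hneg
  exact h (exponentialPDF_of_neg (not_le.1 hneg))

lemma ae_nonneg_nodeLaw (hμ : 0 < μ) : ∀ᵐ a ∂(nodeLaw μ p), 0 ≤ a.1 := by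
  have := isProbabilityMeasure_expMeasure hμ
  exact (Measure.quasiMeasurePreserving_fst (μ := expMeasure μ) (ν := p.toMeasure)).ae
    (ae_nonneg_expMeasure μ)

lemma lintegral_treeLaw (hμ : 0 < μ) {G : TreeData → ENNReal} (hG : Measurable G) :
    ∫⁻ x, G x ∂(treeLaw μ p) = ∫⁻ a, ∫⁻ y, G (joinTree a y)
      ∂(Measure.infinitePi fun _ : ℕ => treeLaw μ p) ∂(nodeLaw μ p) := by
  have := isProbabilityMeasure_node (p := p) hμ
  have := isProbabilityMeasure_treeLaw (p := p) hμ
  conv_lhs => rw [← treeLaw_map_joinTree hμ]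
  rw [lintegral_map hG measurable_joinTree, lintegral_prod]
  exact (hG.comp measurable_joinTree).aemeasurable

/-- The probability that the particle `u` is alive at time `t`. -/
noncomputable def aliveProb (μ : ℝ) (p : PMF ℕ) (t : ℝ) (u : List ℕ) : ENNReal :=
  treeLaw μ p {x | Alive x t u}

lemma measurableSet_alive' (t : ℝ) (u : List ℕ) : MeasurableSet {x | Alive x t u} :=
  (measurable_const.prodMk measurable_id : Measurable fun x : TreeData => (t, x))
    (measurableSet_alive u)

lemma measurable_aliveProb (hμ : 0 < μ) (u : List ℕ) :
    Measurable fun t => aliveProb μ p t u := by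
  have := isProbabilityMeasure_treeLaw (p := p) hμ
  exact measurable_measure_prodMk_left (measurableSet_alive u)

lemma aliveProb_cons (hμ : 0 < μ) (t : ℝ) (j : ℕ) (v : List ℕ) :
    aliveProb μ p t (j :: v) =
      ∫⁻ a, (if j < a.2 then aliveProb μ p (t - a.1) v else 0) ∂(nodeLaw μ p) := by
  have := isProbabilityMeasure_treeLaw (p := p) hμ
  rw [aliveProb, ← lintegral_indicator_one (measurableSet_alive' _ _), lintegral_treeLaw hμ
    (measurable_one.indicator (measurableSet_alive' _ _))]
  refine lintegral_congr fun a => ?_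
  have h1 : ∀ y : ℕ → TreeData, {x | Alive x t (j :: v)}.indicator (1 : TreeData → ENNReal)
      (joinTree a y) = if j < a.2 then {x | Alive x (t - a.1) v}.indicator 1 (y j) else 0 := by
    classical
    intro y
    by_cases hj : j < a.2
    · simp [indicator_apply, Alive, joinTree, hj]
    · simp [Alive, joinTree, hj]
  simp_rw [h1]
  split_ifs with hj
  · rw [(measurePreserving_eval_infinitePi (fun _ : ℕ => treeLaw μ p) j).lintegral_comp
      (measurable_one.indicator (measurableSet_alive' _ _)),
      lintegral_indicator_one (measurableSet_alive' _ _), aliveProb]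
  · simp

lemma aliveProb_nil_of_neg {t : ℝ} (ht : t < 0) : aliveProb μ p t [] = 0 := by
  have : {x : TreeData | Alive x t []} = ∅ := by
    ext x
    simp [Alive, ht]
  rw [aliveProb, this, measure_empty]

lemma aliveProb_of_neg (hμ : 0 < μ) (u : List ℕ) : ∀ {t : ℝ}, t < 0 → aliveProb μ p t u = 0 := by
  induction u with
  | nil => exact aliveProb_nil_of_neg
  | cons j v ih =>
    intro t ht
    rw [aliveProb_cons hμ, lintegral_eq_zero_of_ae_eq_zero]
    filter_upwards [ae_nonneg_nodeLaw hμ] with a ha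
    rw [ih (by linarith)]
    simp

lemma aliveProb_nil (hμ : 0 < μ) {t : ℝ} (ht : 0 ≤ t) :
    aliveProb μ p t [] = expMeasure μ (Ioi t) := by
  have := isProbabilityMeasure_node (p := p) hμ
  have := isProbabilityMeasure_expMeasure hμ
  have h : {x : TreeData | Alive x t []} = (fun x => x []) ⁻¹' (Ioi t ×ˢ univ) := by
    ext x
    simp [Alive, ht]
  rw [aliveProb, h, treeLaw]
  rw [(measurePreserving_eval_infinitePi (fun _ : List ℕ => nodeLaw μ p) []).measure_preimage
    (measurableSet_Ioi.prod .univ).nullMeasurableSet, Measure.prod_prod]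
  simp

/-- The expected number of particles alive at time `t` in the first `n` generations. -/
noncomputable def meanBelow (μ : ℝ) (p : PMF ℕ) (n : ℕ) (t : ℝ) : ENNReal :=
  ∑' u : List ℕ, if u.length < n then aliveProb μ p t u else 0

lemma meanBelow_of_neg (hμ : 0 < μ) (n : ℕ) {t : ℝ} (ht : t < 0) : meanBelow μ p n t = 0 := by
  simp [meanBelow, aliveProb_of_neg hμ _ ht]

lemma lintegral_pmf_id_le (h : Subcritical p) : ∫⁻ k : ℕ, (k : ENNReal) ∂p.toMeasure ≤ 1 := by
  obtain ⟨hs, h1⟩ := summable_mul_pmf_of_le p h.ev_le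
  rw [lintegral_countable']
  have : ∀ k : ℕ, (k : ENNReal) * p.toMeasure {k} = ENNReal.ofReal ((p k).toReal * k) := by
    intro k
    rw [PMF.toMeasure_apply_singleton _ _ (measurableSet_singleton k), ENNReal.ofReal_mul
      ENNReal.toReal_nonneg, ENNReal.ofReal_toReal (p.apply_ne_top k), ENNReal.ofReal_natCast,
      mul_comm]
  simp_rw [this]
  rw [← ENNReal.ofReal_tsum_of_nonneg (fun k => by positivity) hs]
  exact ENNReal.ofReal_le_one.2 h1

lemma meanBelow_succ (hμ : 0 < μ) (n : ℕ) (t : ℝ) :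
    meanBelow μ p (n + 1) t = aliveProb μ p t [] +
      ∫⁻ a, a.2 * meanBelow μ p n (t - a.1) ∂(nodeLaw μ p) := by
  rw [meanBelow, tsum_list]
  refine congrArg₂ (· + ·) (by simp) ?_
  have hm : ∀ w : List ℕ, ∀ j : ℕ, Measurable fun a : ℝ × ℕ =>
      if j < a.2 then (if w.length < n then aliveProb μ p (t - a.1) w else 0) else 0 := by
    intro w j
    refine Measurable.ite (measurableSet_lt measurable_const measurable_snd) ?_ measurable_const
    split_ifs
    · exact (measurable_aliveProb hμ w).comp (by fun_prop)
    · exact measurable_const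
  have h1 : ∀ j : ℕ, ∑' w : List ℕ, (if (j :: w).length < n + 1 then aliveProb μ p t (j :: w)
      else 0) = ∫⁻ a, (if j < a.2 then meanBelow μ p n (t - a.1) else 0) ∂(nodeLaw μ p) := by
    intro j
    have : ∀ a : ℝ × ℕ, (if j < a.2 then meanBelow μ p n (t - a.1) else 0) =
        ∑' w : List ℕ, if j < a.2 then (if w.length < n then aliveProb μ p (t - a.1) w else 0)
          else 0 := by
      intro a
      split_ifs <;> simp [meanBelow]
    simp_rw [this]
    rw [lintegral_tsum fun w => (hm w j).aemeasurable]
    refine tsum_congr fun w => ?_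
    simp only [List.length_cons, Nat.add_lt_add_iff_right]
    split_ifs with hw
    · rw [aliveProb_cons hμ]
    · simp
  simp_rw [h1]
  rw [← lintegral_tsum]
  · refine lintegral_congr fun a => ?_
    rw [tsum_ite_lt]
    simp
  · intro j
    refine (Measurable.ite (measurableSet_lt measurable_const measurable_snd) ?_
      measurable_const).aemeasurable
    refine Measurable.tsum fun w => ?_
    split_ifs
    · exact (measurable_aliveProb hμ w).comp (by fun_prop)
    · exact measurable_const

/-- Induction on the number of generations. With $\tau$ the ancestor's life length, the ancestor
contributes $P(\tau>t)$. Its offspring contribute at most $P(\tau\le t)$, because the mean number of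
children and each truncated mean are at most one. Truncation by generation avoids any a priori
finiteness. -/
lemma meanBelow_le_one (hμ : 0 < μ) (h : Subcritical p) (n : ℕ) :
    ∀ t : ℝ, meanBelow μ p n t ≤ 1 := by
  have := isProbabilityMeasure_expMeasure hμ
  induction n with
  | zero => simp [meanBelow]
  | succ n ih =>
    intro t
    rcases lt_or_ge t 0 with ht | ht
    · simp [meanBelow_of_neg hμ _ ht]
    rw [meanBelow_succ hμ, aliveProb_nil hμ ht]
    have h1 : ∫⁻ a, a.2 * meanBelow μ p n (t - a.1) ∂(nodeLaw μ p) ≤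
        ∫⁻ a, (Iic t).indicator 1 a.1 * (a.2 : ENNReal) ∂(nodeLaw μ p) := by
      refine lintegral_mono fun a => ?_
      by_cases ha : a.1 ≤ t
      · simp only [indicator_apply, mem_Iic, ha, if_true, Pi.one_apply, one_mul]
        exact mul_le_of_le_one_right' (ih _)
      · simp [meanBelow_of_neg hμ n (show t - a.1 < 0 by linarith [not_le.1 ha])]
    have h2 : ∫⁻ a, (Iic t).indicator 1 a.1 * (a.2 : ENNReal) ∂(nodeLaw μ p) ≤
        expMeasure μ (Iic t) := by
      rw [lintegral_prod_mul (f := (Iic t).indicator 1) (g := fun k : ℕ => (k : ENNReal))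
        (measurable_one.indicator measurableSet_Iic).aemeasurable (by fun_prop),
        lintegral_indicator_one measurableSet_Iic]
      exact mul_le_of_le_one_right' (lintegral_pmf_id_le h)
    calc expMeasure μ (Ioi t) + _ ≤ expMeasure μ (Ioi t) + expMeasure μ (Iic t) := by
          gcongr
          exact h1.trans h2
      _ = 1 := by
          rw [← compl_Ioi, measure_add_measure_compl measurableSet_Ioi, measure_univ]

lemma lintegral_count (t : ℝ) :
    ∫⁻ x, count t x ∂(treeLaw μ p) = ∑' u, aliveProb μ p t u := by
  classical
  unfold count
  rw [lintegral_tsum fun u => (Measurable.ite (measurableSet_alive' t u) measurable_const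
    measurable_const).aemeasurable]
  refine tsum_congr fun u => ?_
  rw [aliveProb, ← lintegral_indicator_one (measurableSet_alive' t u)]
  simp [indicator_apply]

lemma lintegral_count_le (hμ : 0 < μ) (h : Subcritical p) (t : ℝ) :
    ∫⁻ x, count t x ∂(treeLaw μ p) ≤ 1 := by
  rw [lintegral_count, ENNReal.tsum_eq_iSup_sum]
  refine iSup_le fun B => ?_
  -- A finite set of words lies below some generation.
  refine le_trans ?_ (meanBelow_le_one hμ h (B.sup List.length + 1) t)
  refine le_trans (Finset.sum_le_sum fun u hu => ?_) (ENNReal.sum_le_tsum B)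
  rw [if_pos (Nat.lt_succ_of_le (Finset.le_sup (f := List.length) hu))]

lemma ae_count_ne_top (hμ : 0 < μ) (h : Subcritical p) (t : ℝ) :
    ∀ᵐ x ∂(treeLaw μ p), count t x ≠ ⊤ := by
  have hm : Measurable (count t) :=
    measurable_count.comp (measurable_const.prodMk measurable_id)
  filter_upwards [ae_lt_top hm ((lintegral_count_le hμ h t).trans_lt ENNReal.one_lt_top).ne]
    with x hx using hx.ne

lemma ae_count_eq_zero (hμ : 0 < μ) {t : ℝ} (ht : t < 0) :
    ∀ᵐ x ∂(treeLaw μ p), count t x = 0 := by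
  have hm : Measurable (count t) :=
    measurable_count.comp (measurable_const.prodMk measurable_id)
  refine (lintegral_eq_zero_iff hm).1 ?_
  simp [lintegral_count, aliveProb_of_neg hμ _ ht]

end MarkovBranching

/-! ### The renewal equation for $F$ -/

namespace MarkovBranching

variable {μ : ℝ} {p : PMF ℕ} {s : ℝ}

lemma measurable_pow_Z (s : ℝ) : Measurable fun tx : ℝ × TreeData => s ^ Z tx.1 tx.2 :=
  (measurable_of_countable fun n : ℕ => s ^ n).comp measurable_Z

lemma measurable_pow_Z_right (s t : ℝ) : Measurable fun x : TreeData => s ^ Z t x :=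
  (measurable_pow_Z s).comp (measurable_const.prodMk measurable_id)

lemma pow_mem_Icc (hs : s ∈ Icc (0 : ℝ) 1) (n : ℕ) : s ^ n ∈ Icc (0 : ℝ) 1 :=
  ⟨pow_nonneg hs.1 _, pow_le_one₀ hs.1 hs.2⟩

lemma integrable_of_mem_Icc {α : Type*} [MeasurableSpace α] {m : Measure α} [IsFiniteMeasure m]
    {g : α → ℝ} (hg : AEStronglyMeasurable g m) (h : ∀ x, g x ∈ Icc (0 : ℝ) 1) : Integrable g m :=
  Integrable.of_bound hg 1 (ae_of_all _ fun x => by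
    rw [Real.norm_of_nonneg (h x).1]; exact (h x).2)

lemma integral_mem_Icc {α : Type*} [MeasurableSpace α] {m : Measure α} [IsProbabilityMeasure m]
    {g : α → ℝ} (hg : AEStronglyMeasurable g m) (h : ∀ x, g x ∈ Icc (0 : ℝ) 1) :
    ∫ x, g x ∂m ∈ Icc (0 : ℝ) 1 := by
  refine ⟨integral_nonneg fun x => (h x).1, ?_⟩
  calc ∫ x, g x ∂m ≤ ∫ _, (1 : ℝ) ∂m :=
        integral_mono (integrable_of_mem_Icc hg h) (integrable_const _) fun x => (h x).2
    _ = 1 := by simp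

lemma F_mem_Icc (hμ : 0 < μ) (hs : s ∈ Icc (0 : ℝ) 1) (t : ℝ) : F μ p t s ∈ Icc (0 : ℝ) 1 := by
  have := isProbabilityMeasure_treeLaw (p := p) hμ
  exact integral_mem_Icc (measurable_pow_Z_right s t).aestronglyMeasurable fun x => pow_mem_Icc hs _

lemma F_one (hμ : 0 < μ) (t : ℝ) : F μ p t 1 = 1 := by
  have := isProbabilityMeasure_treeLaw (p := p) hμ
  simp [F]

lemma measurable_F (hμ : 0 < μ) (s : ℝ) : Measurable fun t => F μ p t s := by
  have := isProbabilityMeasure_treeLaw (p := p) hμ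
  exact (StronglyMeasurable.integral_prod_right (measurable_pow_Z s).stronglyMeasurable).measurable

lemma Z_joinTree_of_lt {t : ℝ} (ht : 0 ≤ t) {a : ℝ × ℕ} (ha : t < a.1) {y : ℕ → TreeData}
    (hy : ∀ j, count (t - a.1) (y j) = 0) : Z t (joinTree a y) = 1 := by
  have h : count t (joinTree a y) = 1 := by
    rw [count_joinTree, if_pos ⟨ht, ha⟩]
    simp [hy]
  have h2 := count_eq_Z (h.trans_ne ENNReal.one_ne_top)
  rw [h] at h2
  exact_mod_cast h2.symm

lemma Z_joinTree_of_le {t : ℝ} {a : ℝ × ℕ} (ha : a.1 ≤ t) {y : ℕ → TreeData}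
    (hy : ∀ j, count (t - a.1) (y j) ≠ ⊤) :
    Z t (joinTree a y) = ∑ j ∈ Finset.range a.2, Z (t - a.1) (y j) := by
  have h : count t (joinTree a y) = ((∑ j ∈ Finset.range a.2, Z (t - a.1) (y j) : ℕ) : ENNReal) := by
    rw [count_joinTree, if_neg (by simp [ha])]
    simp [fun j => count_eq_Z (hy j)]
  have h2 := count_eq_Z (h.trans_ne (ENNReal.natCast_ne_top _))
  rw [h] at h2
  exact_mod_cast h2.symm

lemma ae_infinitePi_eval {X : Type*} [MeasurableSpace X] {m : Measure X} [IsProbabilityMeasure m]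
    {P : X → Prop} (h : ∀ᵐ x ∂m, P x) :
    ∀ᵐ y ∂(Measure.infinitePi fun _ : ℕ => m), ∀ j, P (y j) :=
  ae_all_iff.2 fun j =>
    (measurePreserving_eval_infinitePi (fun _ : ℕ => m) j).quasiMeasurePreserving.ae h

lemma integral_prod_infinitePi {X : Type*} [MeasurableSpace X] {m : Measure X}
    [IsProbabilityMeasure m] {h : X → ℝ} (hh : Measurable h) (n : ℕ) :
    ∫ y, ∏ j ∈ Finset.range n, h (y j) ∂(Measure.infinitePi fun _ : ℕ => m) =
      (∫ x, h x ∂m) ^ n := by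
  have hind := (iIndepFun_infinitePi (P := fun _ : ℕ => m) (X := fun _ => h) fun _ => hh).precomp
    (g := fun j : Fin n => (j : ℕ)) Fin.val_injective
  have := hind.integral_fun_prod_eq_prod_integral
    fun i => (hh.comp (measurable_pi_apply _)).aestronglyMeasurable
  simp_rw [Finset.prod_range]
  rw [this]
  have h1 : ∀ i : ℕ, ∫ y, h (y i) ∂(Measure.infinitePi fun _ : ℕ => m) = ∫ x, h x ∂m := by
    intro i
    have := (measurePreserving_eval_infinitePi (fun _ : ℕ => m) i)
    conv_rhs => rw [← this.map_eq]
    rw [integral_map this.measurable.aemeasurable hh.aestronglyMeasurable]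
  simp [h1]

/-- Conditioning on the ancestor's life length and number of children: given these, the subtrees are
independent, so $s^{Z}$ averages to a power of $F$, and averaging over the number of children
produces $f$. -/
lemma F_eq_integral (hμ : 0 < μ) (h : Subcritical p) (hs : s ∈ Icc (0 : ℝ) 1) {t : ℝ}
    (ht : 0 ≤ t) :
    F μ p t s = ∫ τ, (if t < τ then s else pgf p (F μ p (t - τ) s)) ∂(expMeasure μ) := by
  have := isProbabilityMeasure_treeLaw (p := p) hμ
  have := isProbabilityMeasure_node (p := p) hμ
  have := isProbabilityMeasure_expMeasure hμ
  have hI : Integrable (fun ay : (ℝ × ℕ) × (ℕ → TreeData) => s ^ Z t (joinTree ay.1 ay.2))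
      ((nodeLaw μ p).prod (Measure.infinitePi fun _ : ℕ => treeLaw μ p)) :=
    integrable_of_mem_Icc ((measurable_pow_Z_right s t).comp measurable_joinTree).aestronglyMeasurable
      fun _ => pow_mem_Icc hs _
  have h1 : ∀ a : ℝ × ℕ, ∫ y, s ^ Z t (joinTree a y)
      ∂(Measure.infinitePi fun _ : ℕ => treeLaw μ p) =
      if t < a.1 then s else (F μ p (t - a.1) s) ^ a.2 := by
    intro a
    split_ifs with ha
    -- The children would be born after $t$. Their trees, seen at a negative time, are empty only
    -- almost surely, since a negative life length is merely a null event.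
    · have : ∀ᵐ y ∂(Measure.infinitePi fun _ : ℕ => treeLaw μ p),
          s ^ Z t (joinTree a y) = s := by
        filter_upwards [ae_infinitePi_eval (ae_count_eq_zero (p := p) hμ
          (show t - a.1 < 0 by linarith))] with y hy
        rw [Z_joinTree_of_lt ht ha hy, pow_one]
      rw [integral_congr_ae this]
      simp
    · have : ∀ᵐ y ∂(Measure.infinitePi fun _ : ℕ => treeLaw μ p),
          s ^ Z t (joinTree a y) = ∏ j ∈ Finset.range a.2, s ^ Z (t - a.1) (y j) := by
        filter_upwards [ae_infinitePi_eval (ae_count_ne_top hμ h (t - a.1))] with y hy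
        rw [Z_joinTree_of_le (not_lt.1 ha) hy, Finset.prod_pow_eq_pow_sum]
      rw [integral_congr_ae this, integral_prod_infinitePi (measurable_pow_Z_right s _)]
      rfl
  have hmeas : Measurable fun a : ℝ × ℕ => if t < a.1 then s else (F μ p (t - a.1) s) ^ a.2 :=
    Measurable.ite (measurableSet_lt measurable_const measurable_fst) measurable_const
      (((measurable_F hμ s).comp (by fun_prop)).pow measurable_snd)
  have h2 : F μ p t s = ∫ a, (if t < a.1 then s else (F μ p (t - a.1) s) ^ a.2)
      ∂(nodeLaw μ p) := by
    conv_lhs => rw [F, ← treeLaw_map_joinTree hμ]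
    rw [integral_map measurable_joinTree.aemeasurable
      (measurable_pow_Z_right s t).aestronglyMeasurable, integral_prod _ hI]
    simp_rw [h1]
  rw [h2, integral_prod _ (integrable_of_mem_Icc hmeas.aestronglyMeasurable fun a => by
    split_ifs
    · exact hs
    · exact pow_mem_Icc (F_mem_Icc hμ hs _) _)]
  refine integral_congr_ae (ae_of_all _ fun τ => ?_)
  simp only
  split_ifs with hτ
  · simp
  · rw [pgf_eq_integral p (F_mem_Icc hμ hs _)]

lemma integral_expMeasure (hμ : 0 < μ) (g : ℝ → ℝ) :
    ∫ τ, g τ ∂(expMeasure μ) = ∫ τ in Ioi (0 : ℝ), μ * Real.exp (-(μ * τ)) * g τ := by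
  have hm : Measurable (exponentialPDF μ) := (measurable_exponentialPDFReal μ).ennreal_ofReal
  rw [expMeasure_eq_withDensity, integral_withDensity_eq_integral_toReal_smul hm
    (ae_of_all _ fun τ => ENNReal.ofReal_lt_top), ← integral_Ici_eq_integral_Ioi,
    ← integral_indicator measurableSet_Ici]
  refine integral_congr_ae (ae_of_all _ fun τ => ?_)
  simp only [exponentialPDF_eq, indicator_apply, mem_Ici, smul_eq_mul]
  split_ifs
  · rw [ENNReal.toReal_ofReal (by positivity)]
  · simp

lemma measurable_pgf_F {g : PMF ℕ} (hμ : 0 < μ) (hs : s ∈ Icc (0 : ℝ) 1) :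
    Measurable fun t => pgf g (F μ p t s) := by
  have h1 : Measurable fun t : ℝ => ∫ k : ℕ, (F μ p t s) ^ k ∂g.toMeasure := by
    have : Measurable fun tk : ℝ × ℕ => (F μ p tk.1 s) ^ tk.2 :=
      ((measurable_F hμ s).comp measurable_fst).pow measurable_snd
    exact (StronglyMeasurable.integral_prod_right this.stronglyMeasurable).measurable
  simpa only [← pgf_eq_integral g (F_mem_Icc (p := p) hμ hs _)] using h1

/-- The renewal equation for the generating function of a Markov branching process. -/
lemma F_renewal (hμ : 0 < μ) (h : Subcritical p) (hs : s ∈ Icc (0 : ℝ) 1) {t : ℝ}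
    (ht : 0 ≤ t) :
    F μ p t s = Real.exp (-(μ * t)) *
      (s + ∫ v in (0 : ℝ)..t, μ * Real.exp (μ * v) * pgf p (F μ p v s)) := by
  have hexp : IntegrableOn (fun τ => μ * Real.exp (-(μ * τ))) (Ioi 0) := by
    simp_rw [← neg_mul]
    exact (exp_neg_integrableOn_Ioi 0 hμ).const_mul μ
  have hmG : Measurable fun τ => if t < τ then s else pgf p (F μ p (t - τ) s) :=
    Measurable.ite measurableSet_Ioi measurable_const ((measurable_pgf_F hμ hs).comp (by fun_prop))
  have hint : IntegrableOn (fun τ => μ * Real.exp (-(μ * τ)) *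
      (if t < τ then s else pgf p (F μ p (t - τ) s))) (Ioi 0) := by
    refine hexp.mul_bdd (c := 1) hmG.aestronglyMeasurable (ae_of_all _ fun τ => ?_)
    split_ifs
    · rw [Real.norm_of_nonneg hs.1]; exact hs.2
    · have := pgf_mem_Icc p (F_mem_Icc (p := p) hμ hs (t - τ))
      rw [Real.norm_of_nonneg this.1]; exact this.2
  rw [F_eq_integral hμ h hs ht, integral_expMeasure hμ, ← Ioc_union_Ioi_eq_Ioi ht,
    setIntegral_union (Ioc_disjoint_Ioi le_rfl) measurableSet_Ioi
      (hint.mono_set Ioc_subset_Ioi_self) (hint.mono_set (Ioi_subset_Ioi ht))]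
  have h1 : ∫ τ in Ioi t, μ * Real.exp (-(μ * τ)) *
      (if t < τ then s else pgf p (F μ p (t - τ) s)) = Real.exp (-(μ * t)) * s := by
    have : ∫ τ in Ioi t, μ * Real.exp (-(μ * τ)) *
      (if t < τ then s else pgf p (F μ p (t - τ) s)) = ∫ τ in Ioi t, (μ * s) * Real.exp (-μ * τ) := by
      refine setIntegral_congr_fun measurableSet_Ioi fun τ hτ => ?_
      simp only [if_pos (show t < τ from hτ), neg_mul]
      ring
    rw [this, integral_const_mul, integral_exp_mul_Ioi (by linarith)]
    field_simp
  have h2 : ∫ τ in Ioc 0 t, μ * Real.exp (-(μ * τ)) *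
      (if t < τ then s else pgf p (F μ p (t - τ) s)) =
      Real.exp (-(μ * t)) * ∫ v in (0 : ℝ)..t, μ * Real.exp (μ * v) * pgf p (F μ p v s) := by
    -- The substitution $v=t-\tau$ leaves $t$ only in the prefactor and in the upper limit, so that
    -- regularity in $t$ can be read off.
    have h3 := intervalIntegral.integral_comp_sub_left (a := 0) (b := t)
      (fun v => μ * Real.exp (μ * v) * pgf p (F μ p v s)) t
    rw [sub_self, sub_zero] at h3
    rw [← h3, ← intervalIntegral.integral_const_mul, intervalIntegral.integral_of_le ht]
    refine setIntegral_congr_fun measurableSet_Ioc fun τ hτ => ?_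
    simp only [if_neg (not_lt.2 hτ.2)]
    rw [show -(μ * τ) = -(μ * t) + μ * (t - τ) by ring, Real.exp_add]
    ring
  rw [h1, h2]
  ring

lemma F_zero (hμ : 0 < μ) (h : Subcritical p) (hs : s ∈ Icc (0 : ℝ) 1) : F μ p 0 s = s := by
  simp [F_renewal hμ h hs le_rfl]

/-- A bootstrap: the integrand of the renewal equation is measurable and bounded, so its primitive
is continuous. Continuity of $F$ then makes the integrand continuous and $F$ differentiable. -/
lemma continuousOn_F (hμ : 0 < μ) (h : Subcritical p) (hs : s ∈ Icc (0 : ℝ) 1) :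
    ContinuousOn (fun t => F μ p t s) (Ici 0) := by
  have hint : ∀ a b : ℝ, IntervalIntegrable
      (fun v => μ * Real.exp (μ * v) * pgf p (F μ p v s)) volume a b := by
    intro a b
    have hc : IntervalIntegrable (fun v => μ * Real.exp (μ * v)) volume a b :=
      Continuous.intervalIntegrable (by fun_prop) _ _
    have hb : ∀ τ, ‖pgf p (F μ p τ s)‖ ≤ 1 := fun τ => by
      have := pgf_mem_Icc p (F_mem_Icc (p := p) hμ hs τ)
      rw [Real.norm_of_nonneg this.1]; exact this.2
    have hm := (measurable_pgf_F (p := p) (g := p) hμ hs).aestronglyMeasurable (μ := volume)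
    exact ⟨hc.1.mul_bdd hm.restrict (ae_of_all _ hb), hc.2.mul_bdd hm.restrict (ae_of_all _ hb)⟩
  have hc := intervalIntegral.continuous_primitive (fun a b => hint a b) 0
  have hc2 : Continuous fun t => Real.exp (-(μ * t)) *
      (s + ∫ v in (0 : ℝ)..t, μ * Real.exp (μ * v) * pgf p (F μ p v s)) := by fun_prop
  exact hc2.continuousOn.congr fun t ht => F_renewal hμ h hs ht

end MarkovBranching

/-! ### The backward equation and its explicit solution -/

namespace MarkovBranching

variable {μ : ℝ} {p : PMF ℕ} {s : ℝ}

/-- Bounding $f$ by $1$ in the renewal equation leaves the gap $e^{-\mu t}(1-s)$. This keeps $F$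
inside $[0,1)$, where $1/(f(u)-u)$ is continuous. -/
lemma F_lt_one (hμ : 0 < μ) (h : Subcritical p) (hs : s ∈ Ico (0 : ℝ) 1) {t : ℝ} (ht : 0 ≤ t) :
    F μ p t s < 1 := by
  have hs' : s ∈ Icc (0 : ℝ) 1 := ⟨hs.1, hs.2.le⟩
  have hc : IntervalIntegrable (fun v => μ * Real.exp (μ * v)) volume 0 t :=
    Continuous.intervalIntegrable (by fun_prop) _ _
  have hJ : ∫ v in (0 : ℝ)..t, μ * Real.exp (μ * v) * pgf p (F μ p v s) ≤
      Real.exp (μ * t) - 1 := by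
    have h1 : ∫ v in (0 : ℝ)..t, μ * Real.exp (μ * v) = Real.exp (μ * t) - 1 := by
      have hd : ∀ v ∈ uIcc 0 t, HasDerivAt (fun v => Real.exp (μ * v)) (μ * Real.exp (μ * v)) v := by
        intro v _
        have := ((hasDerivAt_id v).const_mul μ).exp
        simpa [mul_comm] using this
      rw [intervalIntegral.integral_eq_sub_of_hasDerivAt hd hc]
      simp
    rw [← h1]
    have hb : ∀ τ, ‖pgf p (F μ p τ s)‖ ≤ 1 := fun τ => by
      have := pgf_mem_Icc p (F_mem_Icc (p := p) hμ hs' τ)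
      rw [Real.norm_of_nonneg this.1]; exact this.2
    have hm := (measurable_pgf_F (p := p) (g := p) hμ hs').aestronglyMeasurable (μ := volume)
    refine intervalIntegral.integral_mono_on ht
      ⟨hc.1.mul_bdd hm.restrict (ae_of_all _ hb), hc.2.mul_bdd hm.restrict (ae_of_all _ hb)⟩ hc
      fun v _ => ?_
    exact mul_le_of_le_one_right (by positivity) (pgf_mem_Icc p (F_mem_Icc hμ hs' v)).2
  rw [F_renewal hμ h hs' ht]
  calc _ ≤ Real.exp (-(μ * t)) * (s + (Real.exp (μ * t) - 1)) := by gcongr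
    _ = 1 - Real.exp (-(μ * t)) * (1 - s) := by
      rw [Real.exp_neg]
      field_simp
      ring
    _ < 1 := by
      have := mul_pos (Real.exp_pos (-(μ * t))) (sub_pos.2 hs.2)
      linarith

lemma F_mem_Ico (hμ : 0 < μ) (h : Subcritical p) (hs : s ∈ Ico (0 : ℝ) 1) {t : ℝ} (ht : 0 ≤ t) :
    F μ p t s ∈ Ico (0 : ℝ) 1 :=
  ⟨(F_mem_Icc hμ ⟨hs.1, hs.2.le⟩ t).1, F_lt_one hμ h hs ht⟩

lemma continuousOn_pgf_F {g : PMF ℕ} (hμ : 0 < μ) (h : Subcritical p) (hs : s ∈ Icc (0 : ℝ) 1) :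
    ContinuousOn (fun t => pgf g (F μ p t s)) (Ici 0) :=
  (continuousOn_pgf g).comp (continuousOn_F hμ h hs) fun t _ =>
    mem_Icc_neg_one (F_mem_Icc hμ hs t)

lemma hasDerivAt_F (hμ : 0 < μ) (h : Subcritical p) (hs : s ∈ Icc (0 : ℝ) 1) {t : ℝ}
    (ht : 0 < t) :
    HasDerivAt (fun t => F μ p t s) (μ * (pgf p (F μ p t s) - F μ p t s)) t := by
  have hcont : ContinuousOn (fun v => μ * Real.exp (μ * v) * pgf p (F μ p v s)) (Ici 0) := by
    have := continuousOn_pgf_F (g := p) hμ h hs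
    fun_prop
  have hJ : HasDerivAt (fun t => ∫ v in (0 : ℝ)..t, μ * Real.exp (μ * v) * pgf p (F μ p v s))
      (μ * Real.exp (μ * t) * pgf p (F μ p t s)) t := by
    refine intervalIntegral.integral_hasDerivAt_right ?_ ?_
      (hcont.continuousAt (Ici_mem_nhds ht))
    · exact (hcont.mono (by rw [uIcc_of_le ht.le]; exact Icc_subset_Ici_self)).intervalIntegrable
    · have : Measurable fun v => μ * Real.exp (μ * v) * pgf p (F μ p v s) := by
        have := measurable_pgf_F (p := p) (g := p) hμ hs
        fun_prop
      exact this.stronglyMeasurable.stronglyMeasurableAtFilter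
  have hE : HasDerivAt (fun t => Real.exp (-(μ * t))) (-μ * Real.exp (-(μ * t))) t := by
    have := ((hasDerivAt_id t).const_mul μ).neg.exp
    simpa [mul_comm] using this
  have hmul := hE.mul (hJ.const_add s)
  have heq : (fun t => F μ p t s) =ᶠ[𝓝 t] ((fun t => Real.exp (-(μ * t))) *
      (fun t => s + ∫ v in (0 : ℝ)..t, μ * Real.exp (μ * v) * pgf p (F μ p v s))) := by
    filter_upwards [Ioi_mem_nhds ht] with v hv using F_renewal hμ h hs (le_of_lt hv)
  refine (hmul.congr_of_eventuallyEq heq).congr_deriv ?_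
  have h1 := F_renewal hμ h hs ht.le
  set J := s + ∫ v in (0 : ℝ)..t, μ * Real.exp (μ * v) * pgf p (F μ p v s)
  have h2 : Real.exp (-(μ * t)) * Real.exp (μ * t) = 1 := by
    rw [← Real.exp_add]; simp
  linear_combination (μ * pgf p (F μ p t s)) * h2 + μ * h1

lemma continuousOn_inv_pgf_sub (h : Subcritical p) :
    ContinuousOn (fun u => 1 / (pgf p u - u)) (Ico 0 1) := by
  refine ContinuousOn.div continuousOn_const (ContinuousOn.sub ((continuousOn_pgf p).mono ?_)
    continuousOn_id) fun u hu => ?_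
  · exact fun u hu => mem_Icc_neg_one ⟨hu.1, hu.2.le⟩
  · exact (sub_pos.2 (h.lt_pgf hu)).ne'

lemma uIcc_subset_Ico {a b : ℝ} (ha : a ∈ Ico (0 : ℝ) 1) (hb : b ∈ Ico (0 : ℝ) 1) :
    uIcc a b ⊆ Ico 0 1 :=
  (ordConnected_Ico (a := (0 : ℝ)) (b := 1)).uIcc_subset ha hb

lemma intervalIntegrable_inv_pgf_sub (h : Subcritical p) {a b : ℝ} (ha : a ∈ Ico (0 : ℝ) 1)
    (hb : b ∈ Ico (0 : ℝ) 1) :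
    IntervalIntegrable (fun u => 1 / (pgf p u - u)) volume a b :=
  ((continuousOn_inv_pgf_sub h).mono (uIcc_subset_Ico ha hb)).intervalIntegrable

lemma zero_mem_Ico : (0 : ℝ) ∈ Ico (0 : ℝ) 1 := ⟨le_rfl, zero_lt_one⟩

lemma U_sub (h : Subcritical p) {a b : ℝ} (ha : a ∈ Ico (0 : ℝ) 1) (hb : b ∈ Ico (0 : ℝ) 1) :
    U p b - U p a = ∫ u in a..b, 1 / (pgf p u - u) := by
  rw [U, U, intervalIntegral.integral_interval_sub_left
    (intervalIntegrable_inv_pgf_sub h zero_mem_Ico hb)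
    (intervalIntegrable_inv_pgf_sub h zero_mem_Ico ha)]

lemma U_strictMonoOn (h : Subcritical p) : StrictMonoOn (U p) (Ico 0 1) := by
  intro a ha b hb hab
  rw [← sub_pos, U_sub h ha hb]
  refine intervalIntegral.intervalIntegral_pos_of_pos_on
    (intervalIntegrable_inv_pgf_sub h ha hb) (fun u hu => ?_) hab
  exact one_div_pos.2 (sub_pos.2 (h.lt_pgf ⟨ha.1.trans hu.1.le, hu.2.trans hb.2⟩))

/-- Separation of variables: along $u=F(t;s)$ the integrand $du/(f(u)-u)$ becomes $\mu\,dt$. -/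
lemma U_F (hμ : 0 < μ) (h : Subcritical p) (hs : s ∈ Ico (0 : ℝ) 1) {t : ℝ} (ht : 0 ≤ t) :
    U p (F μ p t s) = U p s + μ * t := by
  have hs' : s ∈ Icc (0 : ℝ) 1 := ⟨hs.1, hs.2.le⟩
  have hIci : uIcc 0 t ⊆ Ici 0 := by rw [uIcc_of_le ht]; exact Icc_subset_Ici_self
  have key := intervalIntegral.integral_comp_mul_deriv'' (a := 0) (b := t)
    (f := fun t => F μ p t s) (f' := fun t => μ * (pgf p (F μ p t s) - F μ p t s))
    (g := fun u => 1 / (pgf p u - u)) ((continuousOn_F hμ h hs').mono hIci)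
    (fun v hv => (hasDerivAt_F hμ h hs' (by simpa [ht] using hv.1)).hasDerivWithinAt)
    (by
      have h1 := (continuousOn_F hμ h hs').mono hIci
      have h2 := (continuousOn_pgf_F (g := p) hμ h hs').mono hIci
      fun_prop)
    ((continuousOn_inv_pgf_sub h).mono (by
      rintro _ ⟨v, hv, rfl⟩
      exact F_mem_Ico hμ h hs (hIci hv)))
  simp only [F_zero hμ h hs'] at key
  rw [← U_sub h hs (F_mem_Ico hμ h hs ht)] at key
  have h2 : ∫ x in (0 : ℝ)..t, ((fun u => 1 / (pgf p u - u)) ∘ fun t => F μ p t s) x *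
      (μ * (pgf p (F μ p x s) - F μ p x s)) = ∫ _ in (0 : ℝ)..t, μ := by
    refine intervalIntegral.integral_congr fun v hv => ?_
    have := sub_pos.2 (h.lt_pgf (F_mem_Ico hμ h hs (hIci hv)))
    simp only [Function.comp]
    field_simp
  rw [h2] at key
  simp at key
  linarith

lemma one_sub_one_div_mem {x : ℝ} (hx : 1 ≤ x) : 1 - 1 / x ∈ Ico (0 : ℝ) 1 := by
  have h1 : 0 < 1 / x := by positivity
  have h2 : 1 / x ≤ 1 := (div_le_one (by linarith)).2 hx
  exact ⟨by linarith, by linarith⟩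

lemma one_le_one_div_one_sub (hs : s ∈ Ico (0 : ℝ) 1) : 1 ≤ 1 / (1 - s) := by
  rw [le_div_iff₀ (by linarith [hs.2])]
  linarith [hs.1]

lemma V_one_div_one_sub (s : ℝ) : V p (1 / (1 - s)) = U p s := by
  simp [V]

lemma V_strictMonoOn (h : Subcritical p) : StrictMonoOn (V p) (Ici 1) := by
  intro a ha b hb hab
  refine U_strictMonoOn h (one_sub_one_div_mem ha) (one_sub_one_div_mem hb) ?_
  have ha : (1 : ℝ) ≤ a := ha
  have : 1 / b < 1 / a := one_div_lt_one_div_of_lt (by linarith) hab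
  linarith

lemma V_one : V p 1 = 0 := by simp [V, U]

lemma V_nonneg (h : Subcritical p) {x : ℝ} (hx : 1 ≤ x) : 0 ≤ V p x := by
  rw [← V_one (p := p)]
  exact (V_strictMonoOn h).monotoneOn (mem_Ici.2 le_rfl) hx hx

/-- The process itself supplies the preimage: for $\mu=1$, $s=0$ the integrated equation reads
$V(1/(1-F(y;0)))=y$. The divergence of $\int du/(f(u)-u)$ at $1$ follows without a separate
estimate. -/
lemma exists_V_eq (h : Subcritical p) {y : ℝ} (hy : 0 ≤ y) : ∃ x ∈ Ici 1, V p x = y := by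
  refine ⟨1 / (1 - F 1 p y 0), one_le_one_div_one_sub (F_mem_Ico one_pos h zero_mem_Ico hy), ?_⟩
  rw [V_one_div_one_sub, U_F one_pos h zero_mem_Ico hy]
  simp [U]

lemma V_W (h : Subcritical p) {y : ℝ} (hy : 0 ≤ y) : V p (W p y) = y :=
  Function.invFunOn_eq (exists_V_eq h hy)

lemma one_le_W (h : Subcritical p) {y : ℝ} (hy : 0 ≤ y) : 1 ≤ W p y :=
  Function.invFunOn_mem (exists_V_eq h hy)

lemma W_V (h : Subcritical p) {x : ℝ} (hx : 1 ≤ x) : W p (V p x) = x :=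
  (V_strictMonoOn h).injOn (one_le_W h (V_nonneg h hx)) hx (V_W h (V_nonneg h hx))

lemma W_strictMonoOn (h : Subcritical p) : StrictMonoOn (W p) (Ici 0) := by
  intro a ha b hb hab
  rw [← (V_strictMonoOn h).lt_iff_lt (one_le_W h ha) (one_le_W h hb), V_W h ha, V_W h hb]
  exact hab

lemma tendsto_V_atTop (h : Subcritical p) : Tendsto (V p) atTop atTop := by
  refine tendsto_atTop.2 fun b => ?_
  filter_upwards [eventually_ge_atTop (W p (max b 0))] with x hx
  have h0 : (0 : ℝ) ≤ max b 0 := le_max_right _ _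
  calc b ≤ max b 0 := le_max_left _ _
    _ = V p (W p (max b 0)) := (V_W h h0).symm
    _ ≤ V p x := (V_strictMonoOn h).monotoneOn (one_le_W h h0) ((one_le_W h h0).trans hx) hx

lemma tendsto_W_atTop (h : Subcritical p) : Tendsto (W p) atTop atTop := by
  refine tendsto_atTop.2 fun b => ?_
  have h1 : (1 : ℝ) ≤ max b 1 := le_max_right _ _
  filter_upwards [eventually_ge_atTop (V p (max b 1))] with y hy
  have h0 := V_nonneg h h1
  calc b ≤ max b 1 := le_max_left _ _
    _ = W p (V p (max b 1)) := (W_V h h1).symm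
    _ ≤ W p y := (W_strictMonoOn h).monotoneOn h0 (h0.trans hy) hy

lemma one_div_one_sub_F (hμ : 0 < μ) (h : Subcritical p) (hs : s ∈ Ico (0 : ℝ) 1) {t : ℝ}
    (ht : 0 ≤ t) : 1 / (1 - F μ p t s) = W p (μ * t + V p (1 / (1 - s))) := by
  rw [V_one_div_one_sub, add_comm, ← U_F hμ h hs ht, ← V_one_div_one_sub,
    W_V h (one_le_one_div_one_sub (F_mem_Ico hμ h hs ht))]

/-- The tail `1 - g(1 - 1/x)` of a generating function. -/
noncomputable def pgfTail (g : PMF ℕ) (x : ℝ) : ℝ := 1 - pgf g (1 - 1 / x)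

lemma q_eq (hμ : 0 < μ) (h : Subcritical p) (g : PMF ℕ) (hs : s ∈ Ico (0 : ℝ) 1) {t : ℝ}
    (ht : 0 ≤ t) : q μ p g t s = pgfTail g (W p (μ * t + V p (1 / (1 - s)))) := by
  rw [← one_div_one_sub_F hμ h hs ht]
  simp [q, pgfTail]

end MarkovBranching

/-! ### Regular variation of $V$, $W$ and the immigration tail -/

/-- Monotone regularly varying functions turn asymptotic proportionality of the arguments into
asymptotic proportionality of the values. -/
lemma tendsto_ratio_of_monotoneOn {h : ℝ → ℝ} {ρ κ : ℝ} (hmono : MonotoneOn h (Ici 1))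
    (hpos : ∀ᶠ x in atTop, 0 < h x)
    (hrv : ∀ c : ℝ, 0 < c → Tendsto (fun x => h (c * x) / h x) atTop (𝓝 (c ^ ρ)))
    {ι : Type*} {l : Filter ι} {x x' : ι → ℝ} (hx : Tendsto x l atTop) (hκ : 0 < κ)
    (hx' : Tendsto (fun i => x' i / x i) l (𝓝 κ)) :
    Tendsto (fun i => h (x' i) / h (x i)) l (𝓝 (κ ^ ρ)) := by
  have hcont : ContinuousAt (fun c : ℝ => c ^ ρ) κ :=
    Real.continuousAt_rpow_const _ _ (Or.inl hκ.ne')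
  have hge : ∀ c : ℝ, 0 < c → ∀ᶠ i in l, 1 ≤ c * x i := fun c hc =>
    (hx.const_mul_atTop hc).eventually_ge_atTop 1
  refine tendsto_order.2 ⟨fun a ha => ?_, fun a ha => ?_⟩
  -- Take $c$ slightly below $\kappa$ with $c^\rho>a$. Eventually $cx\le x'$, so monotonicity
  -- replaces locally uniform convergence. The upper bound is symmetric.
  · obtain ⟨c, h1, h2⟩ := (((hcont.mono_left nhdsWithin_le_nhds).eventually (lt_mem_nhds ha)).and
      (Ioo_mem_nhdsLT hκ)).exists
    filter_upwards [((hrv c h2.1).comp hx).eventually (lt_mem_nhds h1), hge c h2.1,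
      hx'.eventually (lt_mem_nhds h2.2), hx.eventually_gt_atTop 0, hx.eventually hpos]
      with i i1 i2 i3 i4 i5
    refine lt_of_lt_of_le i1 ?_
    have : c * x i ≤ x' i := ((lt_div_iff₀ i4).1 i3).le
    exact div_le_div_of_nonneg_right (hmono i2 (i2.trans this) this) i5.le
  · obtain ⟨c, h1, h2⟩ := (((hcont.mono_left nhdsWithin_le_nhds).eventually (gt_mem_nhds ha)).and
      (self_mem_nhdsWithin (a := κ) (s := Ioi κ))).exists
    have h2 : κ < c := h2
    filter_upwards [((hrv c (hκ.trans h2)).comp hx).eventually (gt_mem_nhds h1),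
      hge (κ / 2) (half_pos hκ), hx'.eventually (lt_mem_nhds (half_lt_self hκ)),
      hx'.eventually (gt_mem_nhds h2), hx.eventually_gt_atTop 0, hx.eventually hpos]
      with i i1 i2 i3 i3' i4 i5
    refine lt_of_le_of_lt ?_ i1
    have h3 : x' i ≤ c * x i := ((div_lt_iff₀ i4).1 i3').le
    have h4 : 1 ≤ x' i := i2.trans ((lt_div_iff₀ i4).1 i3).le
    exact div_le_div_of_nonneg_right (hmono h4 (h4.trans h3) h3) i5.le

lemma tendsto_ratio_of_antitoneOn {h : ℝ → ℝ} {ρ κ : ℝ} (hanti : AntitoneOn h (Ici 1))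
    (hpos : ∀ x, 1 ≤ x → 0 < h x)
    (hrv : ∀ c : ℝ, 0 < c → Tendsto (fun x => h (c * x) / h x) atTop (𝓝 (c ^ ρ)))
    {ι : Type*} {l : Filter ι} {x x' : ι → ℝ} (hx : Tendsto x l atTop) (hκ : 0 < κ)
    (hx' : Tendsto (fun i => x' i / x i) l (𝓝 κ)) :
    Tendsto (fun i => h (x' i) / h (x i)) l (𝓝 (κ ^ ρ)) := by
  have key := tendsto_ratio_of_monotoneOn (h := fun x => (h x)⁻¹) (ρ := -ρ) (κ := κ)
    (fun a ha b hb hab => inv_anti₀ (hpos b hb) (hanti ha hb hab))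
    ((eventually_ge_atTop 1).mono fun x hx => inv_pos.2 (hpos x hx))
    (fun c hc => by
      rw [Real.rpow_neg hc.le]
      refine ((hrv c hc).inv₀ (Real.rpow_pos_of_pos hc _).ne').congr fun x => ?_
      rw [inv_div, inv_div_inv]) hx hκ hx'
  have h2 := key.inv₀ (Real.rpow_pos_of_pos hκ _).ne'
  rw [Real.rpow_neg hκ.le, inv_inv] at h2
  refine h2.congr fun i => ?_
  rw [inv_div_inv, inv_div]

/-- If `a / k → ℓ` at the right end point and `∫ k` diverges there, then `∫ a / ∫ k → ℓ`. -/
lemma tendsto_integral_div_integral {a k : ℝ → ℝ} {ℓ : ℝ} (ha : ContinuousOn a (Ico 0 1))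
    (hk : ContinuousOn k (Ico 0 1)) (hkpos : ∀ u ∈ Ico (0 : ℝ) 1, 0 < k u)
    (hlim : Tendsto (fun u => a u / k u) (𝓝[<] 1) (𝓝 ℓ))
    (hdiv : Tendsto (fun b => ∫ u in (0 : ℝ)..b, k u) (𝓝[<] 1) atTop) :
    Tendsto (fun b => (∫ u in (0 : ℝ)..b, a u) / ∫ u in (0 : ℝ)..b, k u) (𝓝[<] 1) (𝓝 ℓ) := by
  have hI : ∀ {g : ℝ → ℝ}, ContinuousOn g (Ico 0 1) → ∀ {x y : ℝ}, x ∈ Ico (0 : ℝ) 1 →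
      y ∈ Ico (0 : ℝ) 1 → IntervalIntegrable g volume x y := fun {g} hg {x y} hx hy =>
    ContinuousOn.intervalIntegrable (hg.mono ((ordConnected_Ico (a := (0 : ℝ)) (b := 1)).uIcc_subset hx hy))
  have h0 : (0 : ℝ) ∈ Ico (0 : ℝ) 1 := ⟨le_rfl, zero_lt_one⟩
  refine Metric.tendsto_nhds.2 fun ε hε => ?_
  have hev : ∀ᶠ u in 𝓝[<] (1 : ℝ), |a u / k u - ℓ| < ε / 2 := by
    have := Metric.tendsto_nhds.1 hlim (ε / 2) (half_pos hε)
    simpa only [Real.dist_eq] using this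
  obtain ⟨v0, hv0, hv⟩ := (mem_nhdsLT_iff_exists_Ioo_subset).1 hev
  set v := (max v0 0 + 1) / 2 with hvdef
  have hm : max v0 0 < 1 := max_lt hv0 zero_lt_one
  have hvm : max v0 0 < v := by rw [hvdef]; linarith
  have hv1 : v ∈ Ico (0 : ℝ) 1 := ⟨(le_max_right _ _).trans hvm.le, by rw [hvdef]; linarith⟩
  -- The part of the difference over $[0,v]$ is a constant, negligible against the diverging
  -- denominator; beyond $v$ the integrands are within $\varepsilon/2$ relative to $k$.
  set C := |∫ u in (0 : ℝ)..v, (a u - ℓ * k u)| with hC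
  filter_upwards [hdiv.eventually_gt_atTop (C / (ε / 2)), hdiv.eventually_gt_atTop 0,
    Ioo_mem_nhdsLT hv1.2] with b hb hb0 hvb
  have hbI : b ∈ Ico (0 : ℝ) 1 := ⟨hv1.1.trans hvb.1.le, hvb.2⟩
  have hdc : ContinuousOn (fun u => a u - ℓ * k u) (Ico 0 1) := by fun_prop
  have hsplit : (∫ u in (0 : ℝ)..b, a u) - ℓ * ∫ u in (0 : ℝ)..b, k u =
      (∫ u in (0 : ℝ)..v, (a u - ℓ * k u)) + ∫ u in v..b, (a u - ℓ * k u) := by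
    rw [intervalIntegral.integral_add_adjacent_intervals (hI hdc h0 hv1) (hI hdc hv1 hbI),
      intervalIntegral.integral_sub (hI ha h0 hbI) ((hI hk h0 hbI).const_mul _),
      intervalIntegral.integral_const_mul]
  have h2 : |∫ u in v..b, (a u - ℓ * k u)| ≤ ε / 2 * ∫ u in (0 : ℝ)..b, k u := by
    have h3 : |∫ u in v..b, (a u - ℓ * k u)| ≤ ∫ u in v..b, ε / 2 * k u := by
      rw [← Real.norm_eq_abs]
      refine intervalIntegral.norm_integral_le_of_norm_le hvb.1.le (ae_of_all _ fun u hu => ?_)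
        ((hI hk hv1 hbI).const_mul _)
      have hu1 : u ∈ Ioo v0 1 := ⟨(le_max_left _ _).trans_lt (hvm.trans hu.1), hu.2.trans_lt hvb.2⟩
      have h4 : |a u / k u - ℓ| < ε / 2 := hv hu1
      have hku : 0 < k u := hkpos u ⟨hv1.1.trans hu.1.le, hu1.2⟩
      rw [Real.norm_eq_abs]
      have : a u - ℓ * k u = (a u / k u - ℓ) * k u := by field_simp
      rw [this, abs_mul, abs_of_pos hku]
      exact mul_le_mul_of_nonneg_right h4.le hku.le
    refine h3.trans ?_
    rw [intervalIntegral.integral_const_mul]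
    refine mul_le_mul_of_nonneg_left ?_ (half_pos hε).le
    rw [← intervalIntegral.integral_add_adjacent_intervals (hI hk h0 hv1) (hI hk hv1 hbI)]
    have : 0 ≤ ∫ u in (0 : ℝ)..v, k u := intervalIntegral.integral_nonneg hv1.1 fun u hu =>
      (hkpos u ⟨hu.1, hu.2.trans_lt hv1.2⟩).le
    linarith
  rw [Real.dist_eq]
  have h5 : (∫ u in (0 : ℝ)..b, a u) / (∫ u in (0 : ℝ)..b, k u) - ℓ =
      ((∫ u in (0 : ℝ)..b, a u) - ℓ * ∫ u in (0 : ℝ)..b, k u) / ∫ u in (0 : ℝ)..b, k u := by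
    field_simp
  rw [h5, hsplit, abs_div, abs_of_pos hb0, div_lt_iff₀ hb0]
  have h6 := (div_lt_iff₀ (half_pos hε)).1 hb
  have h7 := abs_add_le (∫ u in (0 : ℝ)..v, (a u - ℓ * k u)) (∫ u in v..b, (a u - ℓ * k u))
  linarith

lemma SlowlyVarying.tendsto_comp {L : ℝ → ℝ} (hL : SlowlyVarying L) {c : ℝ} (hc : 0 < c) :
    Tendsto (fun x => L (c * x) / L x) atTop (𝓝 1) := hL.2 c hc

lemma tendsto_one_sub_one_div : Tendsto (fun x : ℝ => 1 - 1 / x) atTop (𝓝[<] 1) := by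
  refine tendsto_nhdsWithin_iff.2 ⟨?_, ?_⟩
  · have := (tendsto_inv_atTop_zero (𝕜 := ℝ)).const_sub 1
    simpa using this
  · filter_upwards [eventually_gt_atTop 0] with x hx
    have : 0 < 1 / x := by positivity
    simp only [mem_Iio]
    linarith

namespace MarkovBranching

variable {p : PMF ℕ} {γ : ℝ} {L : ℝ → ℝ}

/-- The affine change $1-u=(1-v)/c$ turns $V(cx)$, up to the constant $U(1-1/c)$, into an integral
over the same interval as $V(x)$. The ratio of the integrands tends to
$c^{-1}c^{\gamma+1}=c^\gamma$, hence so does the ratio of the diverging integrals. The condition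
$c\ge1$ keeps the affine image inside $[0,1)$. -/
lemma tendsto_V_ratio_of_one_le (hL : SlowlyVarying L)
    (hf : ∀ s ∈ Ico (0 : ℝ) 1, pgf p s = s + (1 - s) ^ (γ + 1) * L (1 / (1 - s)))
    {c : ℝ} (hc : 1 ≤ c) : Tendsto (fun x => V p (c * x) / V p x) atTop (𝓝 (c ^ γ)) := by
  have h := Subcritical.of_eq hL hf
  have hc0 : 0 < c := by linarith
  set k : ℝ → ℝ := fun u => 1 / (pgf p u - u) with hk
  have hmaps : ∀ v ∈ Ico (0 : ℝ) 1, v / c + (1 - 1 / c) ∈ Ico (0 : ℝ) 1 := by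
    intro v hv
    have h1 : 1 / c ≤ 1 := (div_le_one hc0).2 hc
    have h2 : v / c < 1 / c := div_lt_div_of_pos_right hv.2 hc0
    have h3 : 0 ≤ v / c := div_nonneg hv.1 hc0.le
    exact ⟨by linarith, by linarith⟩
  have hkc := continuousOn_inv_pgf_sub h
  have hac : ContinuousOn (fun v => c⁻¹ * k (v / c + (1 - 1 / c))) (Ico 0 1) :=
    continuousOn_const.mul (hkc.comp (by fun_prop) hmaps)
  have hdiv : Tendsto (fun b => ∫ u in (0 : ℝ)..b, k u) (𝓝[<] 1) atTop := by
    refine ((tendsto_V_atTop h).comp tendsto_one_div_one_sub).congr fun b => ?_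
    rw [Function.comp_apply, V_one_div_one_sub, U]
  have hlim : Tendsto (fun v => (c⁻¹ * k (v / c + (1 - 1 / c))) / k v) (𝓝[<] 1) (𝓝 (c ^ γ)) := by
    have h1 := ((hL.tendsto_comp hc0).comp tendsto_one_div_one_sub).inv₀ one_ne_zero
    have h2 := h1.const_mul (c ^ γ)
    rw [inv_one, mul_one] at h2
    refine h2.congr' ?_
    filter_upwards [Ioo_mem_nhdsLT (show (0 : ℝ) < 1 by norm_num),
      tendsto_one_div_one_sub.eventually hL.eventually_pos,
      (tendsto_one_div_one_sub.const_mul_atTop hc0).eventually hL.eventually_pos] with v hv p1 p2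
    have e1 : 1 - (v / c + (1 - 1 / c)) = (1 - v) / c := by field_simp; ring
    have hv1 : 0 < 1 - v := by linarith [hv.2]
    simp only [hk, Function.comp]
    rw [hf v ⟨hv.1.le, hv.2⟩, hf _ (hmaps v ⟨hv.1.le, hv.2⟩), e1, Real.div_rpow hv1.le hc0.le,
      one_div_div, Real.rpow_add hc0, Real.rpow_one, show c / (1 - v) = c * (1 / (1 - v)) by ring]
    have h3 := Real.rpow_pos_of_pos hv1 (γ + 1)
    have h4 := Real.rpow_pos_of_pos hc0 γ
    field_simp
    ring_nf
    field_simp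
  have key := tendsto_integral_div_integral hac hkc
    (fun u hu => one_div_pos.2 (sub_pos.2 (h.lt_pgf hu))) hlim hdiv
  have key2 := key.comp tendsto_one_sub_one_div
  have hzero : Tendsto (fun x => U p (1 - 1 / c) / V p x) atTop (𝓝 0) :=
    (tendsto_V_atTop h).const_div_atTop _
  have hsum := hzero.add key2
  rw [zero_add] at hsum
  refine hsum.congr' ?_
  filter_upwards [eventually_gt_atTop 1] with x hx
  have hb := one_sub_one_div_mem hx.le
  simp only [Function.comp]
  rw [intervalIntegral.integral_const_mul, intervalIntegral.integral_comp_div_add _ hc0.ne',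
    smul_eq_mul, inv_mul_cancel_left₀ hc0.ne']
  have e2 : (1 - 1 / x) / c + (1 - 1 / c) = 1 - 1 / (c * x) := by field_simp; ring
  have e3 : V p x = ∫ u in (0 : ℝ)..(1 - 1 / x), k u := rfl
  have e4 := U_sub h (one_sub_one_div_mem hc) (one_sub_one_div_mem (show 1 ≤ c * x by nlinarith))
  rw [zero_div, zero_add, e2, ← e3, ← e4, ← add_div, add_sub_cancel]
  rfl

lemma tendsto_V_ratio (hL : SlowlyVarying L)
    (hf : ∀ s ∈ Ico (0 : ℝ) 1, pgf p s = s + (1 - s) ^ (γ + 1) * L (1 / (1 - s)))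
    {c : ℝ} (hc : 0 < c) : Tendsto (fun x => V p (c * x) / V p x) atTop (𝓝 (c ^ γ)) := by
  rcases le_or_gt 1 c with h1 | h1
  · exact tendsto_V_ratio_of_one_le hL hf h1
  · have h2 := (tendsto_V_ratio_of_one_le hL hf (one_le_inv₀ hc |>.2 h1.le)).comp
      (tendsto_id.const_mul_atTop hc)
    have h3 := h2.inv₀ (Real.rpow_pos_of_pos (inv_pos.2 hc) _).ne'
    rw [Real.inv_rpow hc.le, inv_inv] at h3
    refine h3.congr fun x => ?_
    simp [hc.ne']

lemma tendsto_V_ratio' (hL : SlowlyVarying L)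
    (hf : ∀ s ∈ Ico (0 : ℝ) 1, pgf p s = s + (1 - s) ^ (γ + 1) * L (1 / (1 - s)))
    {ι : Type*} {l : Filter ι} {x x' : ι → ℝ} {κ : ℝ} (hx : Tendsto x l atTop) (hκ : 0 < κ)
    (hx' : Tendsto (fun i => x' i / x i) l (𝓝 κ)) :
    Tendsto (fun i => V p (x' i) / V p (x i)) l (𝓝 (κ ^ γ)) :=
  tendsto_ratio_of_monotoneOn (V_strictMonoOn (Subcritical.of_eq hL hf)).monotoneOn
    ((tendsto_V_atTop (Subcritical.of_eq hL hf)).eventually_gt_atTop 0)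
    (fun _ hc => tendsto_V_ratio hL hf hc) hx hκ hx'

/-- Asymptotic inversion: if $c<\kappa^{1/\gamma}$ then $V(cW(y))\approx c^\gamma y$ is eventually
below $y'=V(W(y'))$, so $cW(y)<W(y')$ by strict monotonicity of $V$; likewise from above. -/
lemma tendsto_W_ratio (hL : SlowlyVarying L) (hγ : 0 < γ)
    (hf : ∀ s ∈ Ico (0 : ℝ) 1, pgf p s = s + (1 - s) ^ (γ + 1) * L (1 / (1 - s)))
    {ι : Type*} {l : Filter ι} {y y' : ι → ℝ} {κ : ℝ} (hy : Tendsto y l atTop) (hκ : 0 < κ)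
    (hy' : Tendsto (fun i => y' i / y i) l (𝓝 κ)) :
    Tendsto (fun i => W p (y' i) / W p (y i)) l (𝓝 (κ ^ (1 / γ))) := by
  have h := Subcritical.of_eq hL hf
  have hW := (tendsto_W_atTop h).comp hy
  have hy0 := hy.eventually_gt_atTop 0
  have hy'0 : ∀ᶠ i in l, 0 < y' i := by
    filter_upwards [hy0, hy'.eventually (lt_mem_nhds hκ)] with i h1 h2
    exact (div_pos_iff_of_pos_right h1).1 h2
  have hκ' : 0 < κ ^ (1 / γ) := Real.rpow_pos_of_pos hκ _
  have hroot : (κ ^ (1 / γ)) ^ γ = κ := by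
    rw [← Real.rpow_mul hκ.le, one_div_mul_cancel hγ.ne', Real.rpow_one]
  refine tendsto_order.2 ⟨fun a ha => ?_, fun a ha => ?_⟩
  · obtain ⟨c, h1, h2⟩ := exists_between (max_lt ha hκ')
    have hc : 0 < c := (le_max_right _ _).trans_lt h1
    have hlt : c ^ γ < κ := by
      rw [← hroot]; exact Real.rpow_lt_rpow hc.le h2 hγ
    obtain ⟨m, hm1, hm2⟩ := exists_between hlt
    filter_upwards [((tendsto_V_ratio hL hf hc).comp hW).eventually (gt_mem_nhds hm1), hy0, hy'0,
      hy'.eventually (lt_mem_nhds hm2), (hW.const_mul_atTop hc).eventually_ge_atTop 1]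
      with i i1 i2 i3 i4 i5
    have hWi : 0 < W p (y i) := by linarith [one_le_W h i2.le]
    simp only [Function.comp, V_W h i2.le] at i1 i5
    have h3 : V p (c * W p (y i)) < V p (W p (y' i)) := by
      rw [V_W h i3.le]
      exact (div_lt_div_iff_of_pos_right i2).1 (i1.trans i4)
    have h4 := (V_strictMonoOn h).lt_iff_lt i5 (one_le_W h i3.le) |>.1 h3
    rw [lt_div_iff₀ hWi]
    refine lt_of_le_of_lt ?_ h4
    exact mul_le_mul_of_nonneg_right ((le_max_left _ _).trans h1.le) hWi.le
  · obtain ⟨c, h1, h2⟩ := exists_between ha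
    have hc : 0 < c := hκ'.trans h1
    have hlt : κ < c ^ γ := by
      conv_lhs => rw [← hroot]
      exact Real.rpow_lt_rpow hκ'.le h1 hγ
    obtain ⟨m, hm1, hm2⟩ := exists_between hlt
    filter_upwards [((tendsto_V_ratio hL hf hc).comp hW).eventually (lt_mem_nhds hm2), hy0, hy'0,
      hy'.eventually (gt_mem_nhds hm1), (hW.const_mul_atTop hc).eventually_ge_atTop 1]
      with i i1 i2 i3 i4 i5
    have hWi : 0 < W p (y i) := by linarith [one_le_W h i2.le]
    simp only [Function.comp, V_W h i2.le] at i1 i5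
    have h3 : V p (W p (y' i)) < V p (c * W p (y i)) := by
      rw [V_W h i3.le]
      exact (div_lt_div_iff_of_pos_right i2).1 (i4.trans i1)
    have h4 := (V_strictMonoOn h).lt_iff_lt (one_le_W h i3.le) i5 |>.1 h3
    rw [div_lt_iff₀ hWi]
    exact h4.trans (mul_lt_mul_of_pos_right h2 hWi)

variable {g : PMF ℕ} {α : ℝ} {l : ℝ → ℝ}

/-- Slow variation gives $l>0$ only near infinity, i.e. for $s$ near $1$; monotonicity of $g$ brings
the strict bound back to every $s<1$. -/
lemma pgf_lt_one (hl : SlowlyVarying l)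
    (hg : ∀ s ∈ Ico (0 : ℝ) 1, pgf g s = 1 - (1 - s) ^ α * l (1 / (1 - s)))
    {s : ℝ} (hs : s ∈ Ico (0 : ℝ) 1) : pgf g s < 1 := by
  obtain ⟨b, h1, h2⟩ := ((tendsto_one_div_one_sub.eventually hl.eventually_pos).and
    (Ioo_mem_nhdsLT hs.2)).exists
  have hb : b ∈ Ico (0 : ℝ) 1 := ⟨hs.1.trans h2.1.le, h2.2⟩
  refine lt_of_le_of_lt (pgf_monotoneOn g ⟨hs.1, hs.2.le⟩ ⟨hb.1, hb.2.le⟩ h2.1.le) ?_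
  rw [hg b hb]
  have := mul_pos (Real.rpow_pos_of_pos (sub_pos.2 hb.2) α) h1
  linarith

lemma pgfTail_pos (hl : SlowlyVarying l)
    (hg : ∀ s ∈ Ico (0 : ℝ) 1, pgf g s = 1 - (1 - s) ^ α * l (1 / (1 - s)))
    {x : ℝ} (hx : 1 ≤ x) : 0 < pgfTail g x :=
  sub_pos.2 (pgf_lt_one hl hg (one_sub_one_div_mem hx))

lemma pgfTail_antitoneOn (g : PMF ℕ) : AntitoneOn (pgfTail g) (Ici 1) := by
  intro a ha b hb hab
  have h1 := one_sub_one_div_mem (mem_Ici.1 ha)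
  have h2 := one_sub_one_div_mem (mem_Ici.1 hb)
  have ha : (1 : ℝ) ≤ a := ha
  have h3 : 1 / b ≤ 1 / a := one_div_le_one_div_of_le (by linarith) hab
  have := pgf_monotoneOn g ⟨h1.1, h1.2.le⟩ ⟨h2.1, h2.2.le⟩ (by linarith)
  simp only [pgfTail]
  linarith

lemma tendsto_pgfTail_ratio (hl : SlowlyVarying l)
    (hg : ∀ s ∈ Ico (0 : ℝ) 1, pgf g s = 1 - (1 - s) ^ α * l (1 / (1 - s)))
    {ι : Type*} {F : Filter ι} {x x' : ι → ℝ} {κ : ℝ} (hx : Tendsto x F atTop) (hκ : 0 < κ)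
    (hx' : Tendsto (fun i => x' i / x i) F (𝓝 κ)) :
    Tendsto (fun i => pgfTail g (x' i) / pgfTail g (x i)) F (𝓝 (κ ^ (-α))) := by
  refine tendsto_ratio_of_antitoneOn (pgfTail_antitoneOn g) (fun x hx => pgfTail_pos hl hg hx)
    (fun c hc => ?_) hx hκ hx'
  have e : ∀ x : ℝ, 1 ≤ x → pgfTail g x = x ^ (-α) * l x := by
    intro x hx
    rw [pgfTail, hg _ (one_sub_one_div_mem hx), sub_sub_cancel, sub_sub_cancel, one_div_one_div,
      one_div, Real.inv_rpow (by linarith), Real.rpow_neg (by linarith)]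
  have h1 := (hl.tendsto_comp hc).const_mul (c ^ (-α))
  rw [mul_one] at h1
  refine h1.congr' ?_
  filter_upwards [eventually_ge_atTop 1, (tendsto_id.const_mul_atTop hc).eventually_ge_atTop 1]
    with x h2 h3
  rw [e x h2, e (c * x) h3, Real.mul_rpow hc.le (by linarith)]
  have := Real.rpow_pos_of_pos (show 0 < x by linarith) (-α)
  field_simp

end MarkovBranching

/-! ### The uniform convergence theorem for slowly varying functions -/

lemma quasiMeasurePreserving_const_mul {x : ℝ} (hx : x ≠ 0) :
    Measure.QuasiMeasurePreserving (fun c : ℝ => x * c) volume volume :=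
  ⟨measurable_const_mul x, by
    rw [Real.map_volume_mul_left hx]
    exact Measure.smul_absolutelyContinuous⟩

namespace SlowlyVarying

variable {L : ℝ → ℝ}

lemma tendsto_log_sub (hL : SlowlyVarying L) {c : ℝ} (hc : 0 < c) :
    Tendsto (fun x => Real.log (L (x * c)) - Real.log (L x)) atTop (𝓝 0) := by
  have h1 := (Real.continuousAt_log one_ne_zero).tendsto.comp (hL.tendsto_comp hc)
  rw [Real.log_one] at h1
  refine h1.congr' ?_
  filter_upwards [hL.eventually_pos, (tendsto_id.const_mul_atTop hc).eventually hL.eventually_pos]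
    with x h2 h3
  simp only [id] at h3
  rw [Function.comp_apply, Real.log_div h3.ne' h2.ne', mul_comm c x]

lemma aestronglyMeasurable_log_sub {a x : ℝ} (hm : AEMeasurable L (volume.restrict (Ici a)))
    (hx : 0 < x) (hax : a ≤ x) :
    AEStronglyMeasurable (fun c => Real.log (L (x * c)) - Real.log (L x))
      (volume.restrict (Icc 1 4)) := by
  obtain ⟨L', hL', heq⟩ := hm
  have h1 : ∀ᵐ y, y ∈ Ici a → L y = L' y := (ae_restrict_iff' measurableSet_Ici).1 heq
  have h2 := (quasiMeasurePreserving_const_mul hx.ne').ae h1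
  have h3 : Measurable fun c => Real.log (L' (x * c)) - Real.log (L x) := by fun_prop
  refine ⟨_, h3.stronglyMeasurable, ?_⟩
  refine (ae_restrict_iff' measurableSet_Icc).2 ?_
  filter_upwards [h2] with c hc hc1
  have : a ≤ x * c := by nlinarith [hc1.1]
  rw [hc this]

/-- Convergence in measure along any sequence of base points. -/
lemma tendsto_volume_log_sub (hL : SlowlyVarying L) {a : ℝ}
    (hm : AEMeasurable L (volume.restrict (Ici a))) {x : ℕ → ℝ} (hx : Tendsto x atTop atTop)
    (hx0 : ∀ n, 0 < x n) (hax : ∀ n, a ≤ x n) {δ : ℝ} (hδ : 0 < δ) :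
    Tendsto (fun n => volume (Icc (1 : ℝ) 4 ∩
      {c | δ ≤ |Real.log (L (x n * c)) - Real.log (L (x n))|})) atTop (𝓝 0) := by
  have h1 := tendstoInMeasure_of_tendsto_ae (μ := volume.restrict (Icc (1 : ℝ) 4))
    (f := fun n c => Real.log (L (x n * c)) - Real.log (L (x n))) (g := fun _ => 0)
    (fun n => aestronglyMeasurable_log_sub hm (hx0 n) (hax n))
    ((ae_restrict_iff' measurableSet_Icc).2 (ae_of_all _ fun c hc =>
      (hL.tendsto_log_sub (lt_of_lt_of_le one_pos hc.1)).comp hx))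
  have h2 := tendstoInMeasure_iff_norm.1 h1 δ hδ
  simp only [sub_zero, Real.norm_eq_abs] at h2
  refine h2.congr fun n => ?_
  rw [Measure.restrict_apply' measurableSet_Icc, inter_comm]

/-- The uniform convergence theorem for slowly varying functions. -/
lemma uniform (hL : SlowlyVarying L) {ε : ℝ} (hε : 0 < ε) :
    ∃ X : ℝ, 0 < X ∧ ∀ x ≥ X, ∀ u ∈ Icc (1 : ℝ) 2,
      |Real.log (L (x * u)) - Real.log (L x)| < ε := by
  obtain ⟨⟨a, -, hm⟩, -⟩ := id hL
  by_contra! hcon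
  have hpos : ∀ n : ℕ, (0 : ℝ) < max a 1 + n := fun n => by
    have := le_max_right a 1
    positivity
  choose x hx u hu hbad using fun n : ℕ => hcon (max a 1 + n) (hpos n)
  have hx0 : ∀ n, 0 < x n := fun n => (hpos n).trans_le (hx n)
  have hax : ∀ n, a ≤ x n := fun n => by
    have := le_max_left a 1
    have h2 : (0 : ℝ) ≤ n := n.cast_nonneg
    linarith [hx n]
  have hxt : Tendsto x atTop atTop := tendsto_atTop_mono hx
    (tendsto_atTop_add_const_left _ _ tendsto_natCast_atTop_atTop)
  have hle : ∀ n, x n ≤ x n * u n := fun n => le_mul_of_one_le_right (hx0 n).le (hu n).1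
  have hv := hL.tendsto_volume_log_sub hm hxt hx0 hax (half_pos hε)
  have hw := hL.tendsto_volume_log_sub hm (tendsto_atTop_mono hle hxt)
    (fun n => (hx0 n).trans_le (hle n)) (fun n => (hax n).trans (hle n)) (half_pos hε)
  have hhalf : (0 : ENNReal) < ENNReal.ofReal (1 / 2) := by simp
  obtain ⟨n, h1, h2⟩ := ((hv.eventually (gt_mem_nhds hhalf)).and
    (hw.eventually (gt_mem_nhds hhalf))).exists
  have hun : 0 < u n := lt_of_lt_of_le one_pos (hu n).1
  set A := Icc (1 : ℝ) 4 ∩ {c | ε / 2 ≤ |Real.log (L (x n * c)) - Real.log (L (x n))|}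
  set B := Icc (1 : ℝ) 4 ∩
    {c | ε / 2 ≤ |Real.log (L (x n * u n * c)) - Real.log (L (x n * u n))|}
  -- If the oscillation between $x_n$ and $x_nu_n$ is at least $\varepsilon$, every third point
  -- $x_nc$ is $\varepsilon/2$-far from one of them. For $c\in[2,4]$ and $u_n\in[1,2]$ both $c$ and
  -- $c/u_n$ lie in $[1,4]$, the window of the convergence in measure.
  have hcover : Icc (2 : ℝ) 4 ⊆ A ∪ (fun c => (u n)⁻¹ * c) ⁻¹' B := by
    intro c hc
    by_contra hnot
    simp only [mem_union, not_or] at hnot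
    have hc1 : (u n)⁻¹ * c ∈ Icc (1 : ℝ) 4 := by
      rw [inv_mul_eq_div]
      constructor
      · rw [le_div_iff₀ hun]; linarith [(hu n).2, hc.1]
      · rw [div_le_iff₀ hun]; nlinarith [(hu n).1, hc.2]
    have h3 : |Real.log (L (x n * c)) - Real.log (L (x n))| < ε / 2 := by
      by_contra h
      exact hnot.1 ⟨⟨by linarith [hc.1], hc.2⟩, not_lt.1 h⟩
    have h4 : |Real.log (L (x n * u n * ((u n)⁻¹ * c))) - Real.log (L (x n * u n))| < ε / 2 := by
      by_contra h
      exact hnot.2 ⟨hc1, not_lt.1 h⟩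
    rw [show x n * u n * ((u n)⁻¹ * c) = x n * c by field_simp] at h4
    have h5 := hbad n
    rw [abs_lt] at h3 h4
    have h6 : |Real.log (L (x n * u n)) - Real.log (L (x n))| < ε := by
      rw [abs_lt]; constructor <;> linarith
    linarith
  -- The interval of length $2$ is covered by sets of measure at most $1/2$ and
  -- $u_n\cdot\frac12\le1$, a contradiction.
  have hvol : volume (Icc (2 : ℝ) 4) ≤ ENNReal.ofReal (1 / 2) + ENNReal.ofReal 2 *
      ENNReal.ofReal (1 / 2) := by
    refine (measure_mono hcover).trans ((measure_union_le _ _).trans (add_le_add h1.le ?_))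
    rw [Real.volume_preimage_mul_left (inv_pos.2 hun).ne', inv_inv, abs_of_pos hun]
    exact mul_le_mul' (ENNReal.ofReal_le_ofReal (hu n).2) h2.le
  rw [Real.volume_Icc, ← ENNReal.ofReal_mul (by norm_num), ← ENNReal.ofReal_add (by norm_num)
    (by norm_num), ENNReal.ofReal_le_ofReal_iff (by norm_num)] at hvol
  norm_num at hvol

end SlowlyVarying

/-! ### Local behaviour of the immigration intensity -/

section Intensity

variable {r LR : ℝ → ℝ} {θ : ℝ}

lemma intensity_eventually_pos (hLR : SlowlyVarying LR)
    (hr : ∀ t, 0 < t → r t = t ^ (-θ) * LR t) : ∀ᶠ t in atTop, 0 < r t := by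
  filter_upwards [hLR.eventually_pos, eventually_gt_atTop 0] with t h1 h2
  rw [hr t h2]
  exact mul_pos (Real.rpow_pos_of_pos h2 _) h1

lemma log_sub_lt_of_le_half {X ε : ℝ} (hX : 0 < X) (h : ∀ x ≥ X, ∀ u ∈ Icc (1 : ℝ) 2,
      |Real.log (LR (x * u)) - Real.log (LR x)| < ε) {t u : ℝ} (ht : 2 * X ≤ t) (hu : 0 ≤ u)
      (hut : u ≤ t / 2) : |Real.log (LR t) - Real.log (LR (t - u))| < ε := by
  have h0 : 0 < t - u := by linarith
  have := h (t - u) (by linarith) (t / (t - u)) ⟨by rw [le_div_iff₀ h0]; linarith,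
    by rw [div_le_iff₀ h0]; linarith⟩
  rwa [mul_div_cancel₀ _ h0.ne'] at this

/-- The domination for the recent-immigrant part of the convolution. For $u\le t/2$ the power
contributes at most $2^\theta$; uniform convergence with $\varepsilon=1$ contributes $e$ from the
slowly varying factor. -/
lemma intensity_bound (hLR : SlowlyVarying LR)
    (hr : ∀ t, 0 < t → r t = t ^ (-θ) * LR t) (hθ : 0 ≤ θ) :
    ∃ C X : ℝ, 0 < X ∧ 0 < C ∧ ∀ t ≥ X, 0 < r t ∧ ∀ u ∈ Icc 0 (t / 2), r (t - u) ≤ C * r t := by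
  obtain ⟨X, hX, h⟩ := hLR.uniform one_pos
  obtain ⟨a, ha⟩ := eventually_atTop.1 hLR.eventually_pos
  refine ⟨2 ^ θ * Real.exp 1, 2 * max X (max a 1), by positivity, by positivity, fun t ht => ?_⟩
  have e1 := le_max_left X (max a 1)
  have e2 := (le_max_left a 1).trans (le_max_right X (max a 1))
  have e3 := (le_max_right a 1).trans (le_max_right X (max a 1))
  have hpos : ∀ u ∈ Icc 0 (t / 2), 0 < LR (t - u) := fun u hu => ha _ (by linarith [hu.2])
  have ht0 : 0 < t := by linarith
  have hLt : 0 < LR t := by simpa using hpos 0 ⟨le_rfl, by positivity⟩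
  rw [hr t ht0]
  refine ⟨mul_pos (Real.rpow_pos_of_pos ht0 _) hLt, fun u hu => ?_⟩
  have h1 := log_sub_lt_of_le_half hX h (t := t) (by linarith) hu.1 hu.2
  have hLu := hpos u hu
  have h2 : LR (t - u) ≤ Real.exp 1 * LR t := by
    rw [abs_lt] at h1
    rw [← Real.exp_log hLu, ← Real.exp_log hLt, ← Real.exp_add]
    exact Real.exp_le_exp.2 (by linarith)
  have htu : 0 < t - u := by linarith [hu.2]
  have h3 : (t - u) ^ (-θ) ≤ 2 ^ θ * t ^ (-θ) := by
    calc (t - u) ^ (-θ) ≤ (t / 2) ^ (-θ) :=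
          Real.rpow_le_rpow_of_nonpos (by positivity) (by linarith [hu.2]) (by linarith)
      _ = 2 ^ θ * t ^ (-θ) := by
          rw [Real.div_rpow ht0.le (by norm_num), Real.rpow_neg (by norm_num : (0 : ℝ) ≤ 2)]
          field_simp
  rw [hr (t - u) htu]
  calc (t - u) ^ (-θ) * LR (t - u) ≤ (2 ^ θ * t ^ (-θ)) * (Real.exp 1 * LR t) :=
        mul_le_mul h3 h2 hLu.le (by positivity)
    _ = _ := by ring

/-- A shift by $u$ is a dilation by $t/(t-u)$, which varies with $t$, so slow variation for each
fixed factor does not suffice: uniformity over factors in $[1,2]$ is what is used. -/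
lemma tendsto_intensity_ratio (hLR : SlowlyVarying LR)
    (hr : ∀ t, 0 < t → r t = t ^ (-θ) * LR t) {u : ℝ} (hu : 0 ≤ u) :
    Tendsto (fun t => r (t - u) / r t) atTop (𝓝 1) := by
  have h1 : Tendsto (fun t => (t - u) / t) atTop (𝓝 1) := by
    have h := (tendsto_const_nhds (x := u)).div_atTop tendsto_id |>.const_sub 1
    rw [sub_zero] at h
    refine h.congr' ?_
    filter_upwards [eventually_gt_atTop 0] with t ht
    simp only [id]
    field_simp
  have h2 : Tendsto (fun t => Real.log (LR (t - u)) - Real.log (LR t)) atTop (𝓝 0) := by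
    refine Metric.tendsto_nhds.2 fun ε hε => ?_
    obtain ⟨X, hX, h⟩ := hLR.uniform hε
    filter_upwards [eventually_ge_atTop (2 * X), eventually_ge_atTop (2 * u)] with t ht1 ht2
    rw [Real.dist_eq, sub_zero, abs_sub_comm]
    exact log_sub_lt_of_le_half hX h ht1 hu (by linarith)
  have h3 := (h1.rpow_const (p := -θ) (Or.inl one_ne_zero)).mul
    ((Real.continuous_exp.tendsto 0).comp h2)
  rw [Real.one_rpow, Real.exp_zero, one_mul] at h3
  refine h3.congr' ?_
  filter_upwards [eventually_gt_atTop 0, eventually_gt_atTop u, hLR.eventually_pos,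
    (tendsto_atTop_add_const_right atTop (-u) tendsto_id).eventually hLR.eventually_pos]
    with t t1 t2 t3 t4
  simp only [id, ← sub_eq_add_neg] at t4
  have htu : 0 < t - u := by linarith
  rw [hr t t1, hr (t - u) htu, Function.comp_apply, Real.exp_sub, Real.exp_log t4, Real.exp_log t3,
    Real.div_rpow htu.le t1.le, div_mul_div_comm]

end Intensity

/-! ### Convolutions with an integrable intensity -/

/-- Convolution of an integrable regularly varying intensity with a family of functions
dominated by an integrable antitone function of dominated variation: both ends contribute. -/
lemma exists_convolution_asymptotics {r LR : ℝ → ℝ} {θ : ℝ} (hLR : SlowlyVarying LR)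
    (hr_nonneg : ∀ t, 0 < t → 0 ≤ r t)
    (hr : ∀ t, 0 < t → r t = t ^ (-θ) * LR t) (hθ : 0 ≤ θ) (hR : IntegrableOn r (Ioi 0))
    {q₀ : ℝ → ℝ} (hq₀_pos : ∀ t, 0 ≤ t → 0 < q₀ t) (hq₀_anti : AntitoneOn q₀ (Ici 0))
    (hq₀_int : IntegrableOn q₀ (Ioi 0))
    {C₀ : ℝ} (hC₀ : ∀ᶠ t in atTop, q₀ (t / 2) ≤ C₀ * q₀ t)
    {k : ℝ → ℝ → ℝ} (hk_meas : ∀ᶠ t in atTop, Measurable (k t))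
    (hk : ∀ᶠ t in atTop, ∀ u, 0 ≤ u → 0 ≤ k t u ∧ k t u ≤ q₀ u) {k₁ : ℝ → ℝ}
    (hk_lim : ∀ u, 0 ≤ u → Tendsto (fun t => k t u) atTop (𝓝 (k₁ u))) {φ : ℝ}
    (hφ : ∀ u, 0 ≤ u → Tendsto (fun t => k t (t - u) / q₀ t) atTop (𝓝 φ)) :
    ∃ A B : ℝ → ℝ, Tendsto A atTop (𝓝 (∫ u in Ioi 0, k₁ u)) ∧
      Tendsto B atTop (𝓝 ((∫ u in Ioi 0, r u) * φ)) ∧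
      ∀ᶠ t in atTop, ∫ u in (0 : ℝ)..t, r u * k t (t - u) = r t * A t + q₀ t * B t := by
  obtain ⟨C, X, hX, hC, hbd⟩ := intensity_bound hLR hr hθ
  -- Extending $r$ by zero makes $u\mapsto r(t-u)$ measurable on the whole line, since nothing is
  -- assumed about $r$ on the negative axis.
  set r' : ℝ → ℝ := indicator (Ioi 0) r with hr'
  have hr'm : AEStronglyMeasurable r' volume :=
    (aestronglyMeasurable_indicator_iff measurableSet_Ioi).2 hR.aestronglyMeasurable
  have hr'e : ∀ u, 0 < u → r' u = r u := fun u hu => indicator_of_mem (mem_Ioi.2 hu) _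
  have hr'sub : ∀ t, AEStronglyMeasurable (fun u => r' (t - u)) volume := fun t =>
    hr'm.comp_quasiMeasurePreserving (Measure.measurePreserving_sub_left volume t).quasiMeasurePreserving
  -- The convolution is cut at $t/2$. In $A$ the variable is the age of the immigrants, with
  -- $r(t-u)$ compared to $r(t)$; in $B$ it is their arrival time, with $k(t-u)$ compared to
  -- $q_0(t)$. The indicators put both on a fixed domain for dominated convergence.
  refine ⟨fun t => ∫ u in Ioi (0 : ℝ), indicator (Iic (t / 2)) (fun u => r' (t - u) / r t * k t u) u,
    fun t => ∫ u in Ioi (0 : ℝ), indicator (Iic (t / 2)) (fun u => r u * (k t (t - u) / q₀ t)) u,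
    ?_, ?_, ?_⟩
  · refine tendsto_integral_filter_of_dominated_convergence (fun u => C * q₀ u) ?_ ?_
      (hq₀_int.const_mul C) ?_
    · filter_upwards [hk_meas] with t hkm
      refine AEStronglyMeasurable.indicator ?_ measurableSet_Iic
      exact (((hr'sub t).mul_const (r t)⁻¹).mul hkm.aestronglyMeasurable).restrict
    · filter_upwards [hk, eventually_ge_atTop X] with t hkt ht
      refine (ae_restrict_iff' measurableSet_Ioi).2 (ae_of_all _ fun u (hu : 0 < u) => ?_)
      have h0 := hq₀_pos u hu.le
      by_cases hut : u ∈ Iic (t / 2)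
      · have hut' : u ≤ t / 2 := hut
        rw [indicator_of_mem hut, hr'e _ (by linarith)]
        obtain ⟨hrt, hb⟩ := hbd t ht
        have h1 := hr_nonneg (t - u) (by linarith)
        have h2 := hkt u hu.le
        rw [Real.norm_of_nonneg (mul_nonneg (div_nonneg h1 hrt.le) h2.1)]
        exact mul_le_mul ((div_le_iff₀ hrt).2 (hb u ⟨hu.le, hut⟩)) h2.2 h2.1 hC.le
      · rw [indicator_of_notMem hut, norm_zero]
        positivity
    · refine (ae_restrict_iff' measurableSet_Ioi).2 (ae_of_all _ fun u (hu : 0 < u) => ?_)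
      have h1 := (tendsto_intensity_ratio hLR hr hu.le).mul (hk_lim u hu.le)
      rw [one_mul] at h1
      refine h1.congr' ?_
      filter_upwards [eventually_ge_atTop (2 * u)] with t ht
      rw [indicator_of_mem (show u ∈ Iic (t / 2) by simp only [mem_Iic]; linarith),
        hr'e _ (by linarith)]
  -- Domination for $B$: if $u\le t/2$ then $k(t-u)\le q_0(t-u)\le q_0(t/2)\le C_0q_0(t)$.
  · rw [← integral_mul_const]
    refine tendsto_integral_filter_of_dominated_convergence (fun u => r u * C₀) ?_ ?_
      (hR.mul_const C₀) ?_
    · filter_upwards [hk_meas] with t hkm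
      refine AEStronglyMeasurable.indicator ?_ measurableSet_Iic
      refine hR.aestronglyMeasurable.mul (Measurable.aestronglyMeasurable ?_)
      exact (hkm.comp (measurable_const.sub measurable_id)).div_const _
    · filter_upwards [hk, hC₀, eventually_gt_atTop 0] with t hkt hCt ht
      refine (ae_restrict_iff' measurableSet_Ioi).2 (ae_of_all _ fun u (hu : 0 < u) => ?_)
      have hqt := hq₀_pos t ht.le
      have hC₀' : 0 ≤ C₀ := by
        have := (hq₀_pos (t / 2) (by positivity)).le.trans hCt
        exact nonneg_of_mul_nonneg_left this hqt
      by_cases hut : u ∈ Iic (t / 2)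
      · have hut' : u ≤ t / 2 := hut
        have h2 := hkt (t - u) (by linarith)
        rw [indicator_of_mem hut, Real.norm_of_nonneg
          (mul_nonneg (hr_nonneg u hu) (div_nonneg h2.1 hqt.le))]
        refine mul_le_mul_of_nonneg_left ((div_le_iff₀ hqt).2 ?_) (hr_nonneg u hu)
        exact h2.2.trans ((hq₀_anti (mem_Ici.2 (by positivity)) (mem_Ici.2 (by linarith))
          (by linarith)).trans hCt)
      · rw [indicator_of_notMem hut, norm_zero]
        exact mul_nonneg (hr_nonneg u hu) hC₀'
    · refine (ae_restrict_iff' measurableSet_Ioi).2 (ae_of_all _ fun u (hu : 0 < u) => ?_)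
      refine ((hφ u hu.le).const_mul (r u)).congr' ?_
      filter_upwards [eventually_ge_atTop (2 * u)] with t ht
      rw [indicator_of_mem (show u ∈ Iic (t / 2) by simp only [mem_Iic]; linarith)]
  · filter_upwards [hk, hk_meas, eventually_ge_atTop X] with t hkt hkm ht
    have ht0 : 0 < t := hX.trans_le ht
    have hhalf : 0 ≤ t / 2 := by positivity
    obtain ⟨hrt, -⟩ := hbd t ht
    have hqt := hq₀_pos t ht0.le
    have hint : IntegrableOn (fun u => r u * k t (t - u)) (Ioc 0 t) := by
      refine (hR.mono_set Ioc_subset_Ioi_self).mul_bdd (c := q₀ 0)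
        (hkm.comp (measurable_const.sub measurable_id)).aestronglyMeasurable
        ((ae_restrict_iff' measurableSet_Ioc).2 (ae_of_all _ fun u hu => ?_))
      have h2 := hkt (t - u) (by linarith [hu.2])
      rw [Real.norm_of_nonneg h2.1]
      exact h2.2.trans (hq₀_anti (mem_Ici.2 le_rfl) (mem_Ici.2 (by linarith [hu.2]))
        (by linarith [hu.2]))
    have hint' : IntervalIntegrable (fun u => r u * k t (t - u)) volume 0 t :=
      (intervalIntegrable_iff_integrableOn_Ioc_of_le ht0.le).2 hint
    have hm : t / 2 ∈ uIcc 0 t := by rw [uIcc_of_le ht0.le]; constructor <;> linarith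
    rw [← intervalIntegral.integral_add_adjacent_intervals
      (hint'.mono_set (uIcc_subset_uIcc left_mem_uIcc hm))
      (hint'.mono_set (uIcc_subset_uIcc hm right_mem_uIcc)), add_comm]
    have hset : ∀ g : ℝ → ℝ, ∫ u in Ioi (0 : ℝ), indicator (Iic (t / 2)) g u =
        ∫ u in (0 : ℝ)..t / 2, g u := by
      intro g
      rw [setIntegral_indicator measurableSet_Iic, intervalIntegral.integral_of_le hhalf]
      rfl
    congr 1
    · rw [hset, ← intervalIntegral.integral_const_mul]
      have h3 := intervalIntegral.integral_comp_sub_left (a := 0) (b := t / 2)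
        (fun u => r u * k t (t - u)) t
      rw [sub_zero, sub_half] at h3
      rw [← h3]
      refine intervalIntegral.integral_congr fun u hu => ?_
      rw [uIcc_of_le hhalf] at hu
      rw [sub_sub_cancel]
      rw [hr'e _ (by linarith [hu.2])]
      field_simp
    · rw [hset, ← intervalIntegral.integral_const_mul]
      refine intervalIntegral.integral_congr fun u _ => ?_
      field_simp

/-- The convolution of an integrable intensity with a bounded function vanishing at infinity
vanishes at infinity. -/
lemma tendsto_convolution_zero {r q₀ : ℝ → ℝ} (hr_nonneg : ∀ t, 0 < t → 0 ≤ r t)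
    (hR : IntegrableOn r (Ioi 0)) (hq : Measurable q₀) (hq1 : ∀ t, 0 ≤ t → q₀ t ∈ Icc (0 : ℝ) 1)
    (hlim : Tendsto q₀ atTop (𝓝 0)) :
    Tendsto (fun t => ∫ u in (0 : ℝ)..t, r u * q₀ (t - u)) atTop (𝓝 0) := by
  have h : Tendsto (fun t => ∫ u in Ioi (0 : ℝ), indicator (Iic t) (fun u => r u * q₀ (t - u)) u)
      atTop (𝓝 (∫ _ in Ioi (0 : ℝ), (0 : ℝ))) := by
    refine tendsto_integral_filter_of_dominated_convergence r ?_ ?_ hR ?_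
    · refine Eventually.of_forall fun t => AEStronglyMeasurable.indicator ?_ measurableSet_Iic
      exact hR.aestronglyMeasurable.mul
        (hq.comp (measurable_const.sub measurable_id)).aestronglyMeasurable
    · refine Eventually.of_forall fun t => ?_
      refine (ae_restrict_iff' measurableSet_Ioi).2 (ae_of_all _ fun u (hu : 0 < u) => ?_)
      have h0 := hr_nonneg u hu
      by_cases hut : u ∈ Iic t
      · have h2 := hq1 (t - u) (sub_nonneg.2 hut)
        rw [indicator_of_mem hut, Real.norm_of_nonneg (mul_nonneg h0 h2.1)]
        exact mul_le_of_le_one_right h0 h2.2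
      · rw [indicator_of_notMem hut, norm_zero]
        exact h0
    · refine ae_of_all _ fun u => ?_
      have h1 := (hlim.comp (tendsto_atTop_add_const_right atTop (-u) tendsto_id)).const_mul (r u)
      rw [mul_zero] at h1
      refine h1.congr' ?_
      filter_upwards [eventually_ge_atTop u] with t ht
      rw [indicator_of_mem (mem_Iic.2 ht)]
      simp [sub_eq_add_neg]
  rw [integral_zero] at h
  refine h.congr' ?_
  filter_upwards [eventually_ge_atTop 0] with t ht
  rw [setIntegral_indicator measurableSet_Iic, intervalIntegral.integral_of_le ht]
  rfl

/-! ### The group survival function $q$ and its asymptotics -/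

namespace MarkovBranching

section General

variable {μ : ℝ} {p g : PMF ℕ} {s : ℝ}

lemma q_mem_Icc (hμ : 0 < μ) (hs : s ∈ Icc (0 : ℝ) 1) (t : ℝ) : q μ p g t s ∈ Icc (0 : ℝ) 1 := by
  have := pgf_mem_Icc g (F_mem_Icc (p := p) hμ hs t)
  exact ⟨sub_nonneg.2 this.2, by simp only [q]; linarith [this.1]⟩

lemma measurable_q (hμ : 0 < μ) (hs : s ∈ Icc (0 : ℝ) 1) : Measurable fun t => q μ p g t s :=
  measurable_const.sub (measurable_pgf_F hμ hs)

lemma q_one (hμ : 0 < μ) (t : ℝ) : q μ p g t 1 = 0 := by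
  simp [q, F_one hμ, pgf_one]

lemma F_mono (hμ : 0 < μ) {a b : ℝ} (ha : a ∈ Icc (0 : ℝ) 1) (hb : b ∈ Icc (0 : ℝ) 1)
    (hab : a ≤ b) (t : ℝ) : F μ p t a ≤ F μ p t b := by
  have := isProbabilityMeasure_treeLaw (p := p) hμ
  exact integral_mono
    (integrable_of_mem_Icc (measurable_pow_Z_right a t).aestronglyMeasurable fun _ => pow_mem_Icc ha _)
    (integrable_of_mem_Icc (measurable_pow_Z_right b t).aestronglyMeasurable fun _ => pow_mem_Icc hb _)
    fun x => pow_le_pow_left₀ ha.1 hab _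

lemma q_le_q_zero (hμ : 0 < μ) (hs : s ∈ Icc (0 : ℝ) 1) (t : ℝ) :
    q μ p g t s ≤ q μ p g t 0 := by
  have h0 : (0 : ℝ) ∈ Icc (0 : ℝ) 1 := ⟨le_rfl, zero_le_one⟩
  have := pgf_monotoneOn g (F_mem_Icc hμ h0 t) (F_mem_Icc (p := p) hμ hs t) (F_mono hμ h0 hs hs.1 t)
  simp only [q]
  linarith

lemma tendsto_F {ι : Type*} {l : Filter ι} [l.IsCountablyGenerated] {σ : ι → ℝ} (hμ : 0 < μ)
    (hσ : ∀ᶠ i in l, σ i ∈ Icc (0 : ℝ) 1) (hlim : Tendsto σ l (𝓝 s)) (t : ℝ) :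
    Tendsto (fun i => F μ p t (σ i)) l (𝓝 (F μ p t s)) := by
  have := isProbabilityMeasure_treeLaw (p := p) hμ
  refine tendsto_integral_filter_of_dominated_convergence (fun _ => 1) ?_ ?_
    (integrable_const _) (ae_of_all _ fun x => hlim.pow _)
  · exact Eventually.of_forall fun i => (measurable_pow_Z_right _ t).aestronglyMeasurable
  · filter_upwards [hσ] with i hi
    refine ae_of_all _ fun x => ?_
    rw [Real.norm_of_nonneg (pow_mem_Icc hi _).1]
    exact (pow_mem_Icc hi _).2

lemma tendsto_q {ι : Type*} {l : Filter ι} [l.IsCountablyGenerated] {σ : ι → ℝ} (hμ : 0 < μ)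
    (hσ : ∀ᶠ i in l, σ i ∈ Icc (0 : ℝ) 1) (hlim : Tendsto σ l (𝓝 s)) (hs : s ∈ Icc (0 : ℝ) 1)
    (t : ℝ) : Tendsto (fun i => q μ p g t (σ i)) l (𝓝 (q μ p g t s)) := by
  have h1 := (continuousOn_pgf g) _ (mem_Icc_neg_one (F_mem_Icc (p := p) hμ hs t))
  refine (h1.tendsto.comp (tendsto_nhdsWithin_iff.2 ⟨tendsto_F hμ hσ hlim t, ?_⟩)).const_sub 1
  filter_upwards [hσ] with i hi using mem_Icc_neg_one (F_mem_Icc hμ hi t)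

lemma integrableOn_q (hμ : 0 < μ) (hs : s ∈ Icc (0 : ℝ) 1)
    (hQ : IntegrableOn (fun t => q μ p g t 0) (Ioi 0)) :
    IntegrableOn (fun t => q μ p g t s) (Ioi 0) :=
  hQ.mono' (measurable_q hμ hs).aestronglyMeasurable (ae_of_all _ fun t => by
    rw [Real.norm_of_nonneg (q_mem_Icc hμ hs t).1]
    exact q_le_q_zero hμ hs t)

lemma Δ_one (hμ : 0 < μ) : Δ μ p g 1 = 0 := by
  simp [Δ, q_one hμ]

lemma tendsto_Δ (hμ : 0 < μ) (hQ : IntegrableOn (fun t => q μ p g t 0) (Ioi 0)) :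
    Tendsto (Δ μ p g) (𝓝[<] 1) (𝓝 0) := by
  have hev : ∀ᶠ σ in 𝓝[<] (1 : ℝ), σ ∈ Icc (0 : ℝ) 1 := by
    filter_upwards [Ioo_mem_nhdsLT (show (0 : ℝ) < 1 by norm_num)] with σ hσ
      using ⟨hσ.1.le, hσ.2.le⟩
  rw [← Δ_one (p := p) (g := g) hμ]
  refine tendsto_integral_filter_of_dominated_convergence (fun t => q μ p g t 0) ?_ ?_ hQ ?_
  · filter_upwards [hev] with σ hσ using (measurable_q hμ hσ).aestronglyMeasurable
  · filter_upwards [hev] with σ hσ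
    refine ae_of_all _ fun t => ?_
    rw [Real.norm_of_nonneg (q_mem_Icc hμ hσ t).1]
    exact q_le_q_zero hμ hσ t
  · exact ae_of_all _ fun t => tendsto_q hμ hev (tendsto_id.mono_left nhdsWithin_le_nhds)
      ⟨zero_le_one, le_rfl⟩ t

lemma zero_mem_Icc : (0 : ℝ) ∈ Icc (0 : ℝ) 1 := ⟨le_rfl, zero_le_one⟩

lemma q_zero_eq (hμ : 0 < μ) (h : Subcritical p) {t : ℝ} (ht : 0 ≤ t) :
    q μ p g t 0 = pgfTail g (W p (μ * t)) := by
  simp [q_eq hμ h g zero_mem_Ico ht, V_one]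

lemma q_zero_antitoneOn (hμ : 0 < μ) (h : Subcritical p) :
    AntitoneOn (fun t => q μ p g t 0) (Ici 0) := by
  intro a ha b hb hab
  have ha' : 0 ≤ μ * a := mul_nonneg hμ.le ha
  have hb' : 0 ≤ μ * b := mul_nonneg hμ.le hb
  simp only [q_zero_eq hμ h ha, q_zero_eq hμ h hb]
  exact pgfTail_antitoneOn g (one_le_W h ha') (one_le_W h hb')
    ((W_strictMonoOn h).monotoneOn ha' hb' (by gcongr))

end General

variable {μ : ℝ} {p g : PMF ℕ} {γ α : ℝ} {L l : ℝ → ℝ}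

lemma q_zero_pos (hμ : 0 < μ) (h : Subcritical p) (hl : SlowlyVarying l)
    (hg : ∀ s ∈ Ico (0 : ℝ) 1, pgf g s = 1 - (1 - s) ^ α * l (1 / (1 - s))) {t : ℝ} (ht : 0 ≤ t) :
    0 < q μ p g t 0 := by
  rw [q_zero_eq hμ h ht]
  exact pgfTail_pos hl hg (one_le_W h (mul_nonneg hμ.le ht))

/-- Asymptotics of `q(t - u; σ(t)) / q(t)`, where `σ(t)` may tend to one. -/
lemma tendsto_q_ratio (hμ : 0 < μ) (hγ : 0 < γ) (hL : SlowlyVarying L)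
    (hf : ∀ s ∈ Ico (0 : ℝ) 1, pgf p s = s + (1 - s) ^ (γ + 1) * L (1 / (1 - s)))
    (hl : SlowlyVarying l)
    (hg : ∀ s ∈ Ico (0 : ℝ) 1, pgf g s = 1 - (1 - s) ^ α * l (1 / (1 - s)))
    {a : ℝ} (ha : 0 < a) {τ : ℝ → ℝ} (hτ : Tendsto (fun t => τ t / t) atTop (𝓝 a))
    {σ : ℝ → ℝ} (hσ : ∀ᶠ t in atTop, σ t ∈ Ico (0 : ℝ) 1) {v : ℝ} (hv : 0 ≤ v)
    (hσv : Tendsto (fun t => V p (1 / (1 - σ t)) / (μ * t)) atTop (𝓝 v)) :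
    Tendsto (fun t => q μ p g (τ t) (σ t) / q μ p g t 0) atTop (𝓝 ((a + v) ^ (-(α / γ)))) := by
  have h := Subcritical.of_eq hL hf
  have hy : Tendsto (fun t : ℝ => μ * t) atTop atTop := tendsto_id.const_mul_atTop hμ
  have hav : 0 < a + v := by linarith
  have hy' : Tendsto (fun t => (μ * τ t + V p (1 / (1 - σ t))) / (μ * t)) atTop (𝓝 (a + v)) := by
    refine (hτ.add hσv).congr fun t => ?_
    rw [add_div, mul_div_mul_left _ _ hμ.ne']
  -- The argument of $W$ is asymptotic to $(a+v)\mu t$. Applying $W$ and then the immigration tail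
  -- raises $a+v$ to the power $(1/\gamma)(-\alpha)$.
  have hW := tendsto_W_ratio hL hγ hf hy hav hy'
  have hT := tendsto_pgfTail_ratio hl hg ((tendsto_W_atTop h).comp hy)
    (Real.rpow_pos_of_pos hav _) hW
  rw [← Real.rpow_mul hav.le, show 1 / γ * -α = -(α / γ) by ring] at hT
  refine hT.congr' ?_
  filter_upwards [hσ, eventually_gt_atTop 0, hτ.eventually (lt_mem_nhds ha)] with t h1 h2 h3
  have h4 : 0 < τ t := (div_pos_iff_of_pos_right h2).1 h3
  rw [q_eq hμ h g h1 h4.le, q_zero_eq hμ h h2.le]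
  rfl

lemma tendsto_sub_div (u : ℝ) : Tendsto (fun t : ℝ => (t - u) / t) atTop (𝓝 1) := by
  have h := (tendsto_const_nhds (x := u)).div_atTop tendsto_id |>.const_sub 1
  rw [sub_zero] at h
  refine h.congr' ?_
  filter_upwards [eventually_gt_atTop 0] with t ht
  simp only [id]
  field_simp

lemma tendsto_const_V_div (hμ : 0 < μ) (c : ℝ) :
    Tendsto (fun t : ℝ => c / (μ * t)) atTop (𝓝 0) :=
  tendsto_const_nhds.div_atTop (tendsto_id.const_mul_atTop hμ)

lemma tendsto_q_ratio_const (hμ : 0 < μ) (hγ : 0 < γ) (hL : SlowlyVarying L)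
    (hf : ∀ s ∈ Ico (0 : ℝ) 1, pgf p s = s + (1 - s) ^ (γ + 1) * L (1 / (1 - s)))
    (hl : SlowlyVarying l)
    (hg : ∀ s ∈ Ico (0 : ℝ) 1, pgf g s = 1 - (1 - s) ^ α * l (1 / (1 - s)))
    {s : ℝ} (hs : s ∈ Ico (0 : ℝ) 1) (u : ℝ) :
    Tendsto (fun t => q μ p g (t - u) s / q μ p g t 0) atTop (𝓝 1) := by
  have := tendsto_q_ratio hμ hγ hL hf hl hg one_pos (tendsto_sub_div u)
    (Eventually.of_forall fun _ => hs) le_rfl (tendsto_const_V_div hμ _)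
  simpa using this

lemma exists_q_half_le (hμ : 0 < μ) (hγ : 0 < γ) (hL : SlowlyVarying L)
    (hf : ∀ s ∈ Ico (0 : ℝ) 1, pgf p s = s + (1 - s) ^ (γ + 1) * L (1 / (1 - s)))
    (hl : SlowlyVarying l)
    (hg : ∀ s ∈ Ico (0 : ℝ) 1, pgf g s = 1 - (1 - s) ^ α * l (1 / (1 - s))) :
    ∃ C, ∀ᶠ t in atTop, q μ p g (t / 2) 0 ≤ C * q μ p g t 0 := by
  have hτ : Tendsto (fun t : ℝ => t / 2 / t) atTop (𝓝 (1 / 2)) := by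
    refine tendsto_const_nhds.congr' ?_
    filter_upwards [eventually_gt_atTop 0] with t ht
    field_simp
  have h1 := tendsto_q_ratio hμ hγ hL hf hl hg (by norm_num) hτ
    (Eventually.of_forall fun _ => zero_mem_Ico) le_rfl (tendsto_const_V_div hμ _)
  refine ⟨(1 / 2 + 0) ^ (-(α / γ)) + 1, ?_⟩
  filter_upwards [h1.eventually (gt_mem_nhds (lt_add_one _)), eventually_ge_atTop 0] with t h2 h3
  exact ((div_lt_iff₀ (q_zero_pos hμ (Subcritical.of_eq hL hf) hl hg h3)).1 h2).le

/-- The generating function argument at which the scaled process has Laplace parameter `lam`. -/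
noncomputable def laplaceArg (μ : ℝ) (p : PMF ℕ) (lam t : ℝ) : ℝ :=
  Real.exp (-(lam / W p (μ * t)))

lemma tendsto_W_mul (hμ : 0 < μ) (h : Subcritical p) :
    Tendsto (fun t => W p (μ * t)) atTop atTop :=
  (tendsto_W_atTop h).comp (tendsto_id.const_mul_atTop hμ)

lemma laplaceArg_mem (hμ : 0 < μ) (h : Subcritical p) {lam t : ℝ} (hlam : 0 < lam) (ht : 0 ≤ t) :
    laplaceArg μ p lam t ∈ Ico (0 : ℝ) 1 := by
  have h1 := one_le_W h (mul_nonneg hμ.le ht)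
  refine ⟨(Real.exp_pos _).le, Real.exp_lt_one_iff.2 ?_⟩
  have : 0 < lam / W p (μ * t) := by positivity
  linarith

lemma tendsto_laplaceArg (hμ : 0 < μ) (h : Subcritical p) (lam : ℝ) :
    Tendsto (laplaceArg μ p lam) atTop (𝓝 1) := by
  have h1 := ((tendsto_const_nhds (x := lam)).div_atTop (tendsto_W_mul hμ h)).neg
  rw [neg_zero] at h1
  have := (Real.continuous_exp.tendsto 0).comp h1
  rwa [Real.exp_zero] at this

/-- The factorisation $1-e^{-x}=xE(x)$, with $E$ continuous at $0$ and $E(0)=1$, holds at $x=0$ too.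
It linearises exponentials without excluding vanishing arguments, such as the cumulant at $s=1$. -/
lemma continuousAt_dslope_exp :
    ContinuousAt (dslope (fun x : ℝ => 1 - Real.exp (-x)) 0) 0 ∧
      dslope (fun x : ℝ => 1 - Real.exp (-x)) 0 0 = 1 ∧
      ∀ x : ℝ, 1 - Real.exp (-x) = x * dslope (fun x : ℝ => 1 - Real.exp (-x)) 0 x := by
  have hd : HasDerivAt (fun x : ℝ => 1 - Real.exp (-x)) 1 0 := by
    have := ((hasDerivAt_id (0 : ℝ)).neg.exp).const_sub 1
    simpa using this
  refine ⟨continuousAt_dslope_same.2 hd.differentiableAt, ?_, fun x => ?_⟩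
  · rw [dslope_same, hd.deriv]
  · have := sub_smul_dslope (fun x : ℝ => 1 - Real.exp (-x)) 0 x
    simpa using this.symm

lemma tendsto_one_sub_exp_ratio {ι : Type*} {F : Filter ι} {x y : ι → ℝ} {c : ℝ}
    (hy : Tendsto y F (𝓝 0)) (hy0 : ∀ᶠ i in F, y i ≠ 0)
    (hxy : Tendsto (fun i => x i / y i) F (𝓝 c)) :
    Tendsto (fun i => (1 - Real.exp (-x i)) / (1 - Real.exp (-y i))) F (𝓝 c) := by
  obtain ⟨hc, h1, he⟩ := continuousAt_dslope_exp
  set E := dslope (fun x : ℝ => 1 - Real.exp (-x)) 0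
  have hE := hc.tendsto
  rw [h1] at hE
  have hx : Tendsto x F (𝓝 0) := by
    have := hxy.mul hy
    rw [mul_zero] at this
    refine this.congr' ?_
    filter_upwards [hy0] with i hi
    field_simp
  have := hxy.mul ((hE.comp hx).div (hE.comp hy) one_ne_zero)
  rw [div_one, mul_one] at this
  refine this.congr fun i => ?_
  rw [he (x i), he (y i), Pi.div_apply, Function.comp_apply, Function.comp_apply,
    div_mul_div_comm]

/-- Here $1/(1-e^{-\lambda/W})\sim W/\lambda$, so regular variation of $V$ gives
$\lambda^{-\gamma}V(W(\mu t))=\lambda^{-\gamma}\mu t$. -/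
lemma tendsto_laplaceArg_V (hμ : 0 < μ) (hL : SlowlyVarying L)
    (hf : ∀ s ∈ Ico (0 : ℝ) 1, pgf p s = s + (1 - s) ^ (γ + 1) * L (1 / (1 - s)))
    {lam : ℝ} (hlam : 0 < lam) :
    Tendsto (fun t => V p (1 / (1 - laplaceArg μ p lam t)) / (μ * t)) atTop (𝓝 (lam ^ (-γ))) := by
  have h := Subcritical.of_eq hL hf
  have hW := tendsto_W_mul hμ h
  have hratio : Tendsto (fun t => (1 / (1 - laplaceArg μ p lam t)) / W p (μ * t)) atTop
      (𝓝 lam⁻¹) := by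
    obtain ⟨hc, h1, he⟩ := continuousAt_dslope_exp
    set E := dslope (fun x : ℝ => 1 - Real.exp (-x)) 0
    have hE := hc.tendsto
    rw [h1] at hE
    have h2 := (hE.comp ((tendsto_const_nhds (x := lam)).div_atTop hW)).const_mul lam
    rw [mul_one] at h2
    refine (h2.inv₀ hlam.ne').congr' ?_
    filter_upwards [hW.eventually_gt_atTop 0] with t ht
    rw [Function.comp_apply, laplaceArg, he (lam / W p (μ * t)), one_div, mul_inv, mul_inv, inv_div]
    field_simp
  have h3 := tendsto_V_ratio' hL hf hW (inv_pos.2 hlam) hratio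
  rw [Real.inv_rpow hlam.le, ← Real.rpow_neg hlam.le] at h3
  refine h3.congr' ?_
  filter_upwards [eventually_ge_atTop 0] with t ht
  rw [V_W h (mul_nonneg hμ.le ht)]

/-- `λ^α / (1 + λ^γ)^(α/γ)`, one minus the Laplace transform of the limit law. -/
noncomputable def laplaceTail (α γ lam : ℝ) : ℝ := lam ^ α / (1 + lam ^ γ) ^ (α / γ)

lemma laplaceTail_eq (hγ : 0 < γ) (α : ℝ) {lam : ℝ} (hlam : 0 < lam) :
    (1 + lam ^ (-γ)) ^ (-(α / γ)) = laplaceTail α γ lam := by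
  have h1 : 0 < lam ^ γ := Real.rpow_pos_of_pos hlam _
  have h2 : 1 + lam ^ (-γ) = (1 + lam ^ γ) / lam ^ γ := by
    rw [Real.rpow_neg hlam.le]
    field_simp
    ring
  rw [h2, Real.rpow_neg (by positivity), Real.div_rpow (by positivity) h1.le, inv_div,
    ← Real.rpow_mul hlam.le, mul_div_cancel₀ _ hγ.ne', laplaceTail]

lemma tendsto_q_ratio_laplace (hμ : 0 < μ) (hγ : 0 < γ) (hL : SlowlyVarying L)
    (hf : ∀ s ∈ Ico (0 : ℝ) 1, pgf p s = s + (1 - s) ^ (γ + 1) * L (1 / (1 - s)))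
    (hl : SlowlyVarying l)
    (hg : ∀ s ∈ Ico (0 : ℝ) 1, pgf g s = 1 - (1 - s) ^ α * l (1 / (1 - s)))
    {lam : ℝ} (hlam : 0 < lam) (u : ℝ) :
    Tendsto (fun t => q μ p g (t - u) (laplaceArg μ p lam t) / q μ p g t 0) atTop
      (𝓝 (laplaceTail α γ lam)) := by
  have h := Subcritical.of_eq hL hf
  rw [← laplaceTail_eq hγ α hlam]
  refine tendsto_q_ratio hμ hγ hL hf hl hg one_pos (tendsto_sub_div u) ?_
    (Real.rpow_nonneg hlam.le _) (tendsto_laplaceArg_V hμ hL hf hlam)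
  filter_upwards [eventually_ge_atTop 0] with t ht using laplaceArg_mem hμ h hlam ht

end MarkovBranching

/-- Divide through by $x$, the scale that is not negligible: $r$ in case (i), $q$ in cases (ii) and
(iii). -/
lemma tendsto_mixed_ratio {ι : Type*} {F : Filter ι} {x y A B A' B' : ι → ℝ} {δ a b a' b' : ℝ}
    (hx : ∀ᶠ i in F, 0 < x i) (hxy : Tendsto (fun i => y i / x i) F (𝓝 δ))
    (hA : Tendsto A F (𝓝 a)) (hB : Tendsto B F (𝓝 b)) (hA' : Tendsto A' F (𝓝 a'))
    (hB' : Tendsto B' F (𝓝 b')) (h0 : a' + δ * b' ≠ 0) :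
    Tendsto (fun i => (x i * A i + y i * B i) / (x i * A' i + y i * B' i)) F
      (𝓝 ((a + δ * b) / (a' + δ * b'))) := by
  refine ((hA.add (hxy.mul hB)).div (hA'.add (hxy.mul hB')) h0).congr' ?_
  filter_upwards [hx] with i hi
  have h1 : A i + y i / x i * B i = (x i * A i + y i * B i) / x i := by field_simp
  have h2 : A' i + y i / x i * B' i = (x i * A' i + y i * B' i) / x i := by field_simp
  simp only [Pi.div_apply]
  rw [h1, h2, div_div_div_cancel_right₀ hi.ne']

/-! ### Ratios of cumulants -/

namespace MarkovBranching

/-- Integrable regularly varying immigration into a critical branching process whose survival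
probability of an immigrating group is integrable. -/
structure IntegrableRegime (μ : ℝ) (p g : PMF ℕ) (γ α θ : ℝ) (L l r LR : ℝ → ℝ) : Prop where
  hμ : 0 < μ
  hγ : 0 < γ
  hL : SlowlyVarying L
  hf : ∀ s ∈ Ico (0 : ℝ) 1, pgf p s = s + (1 - s) ^ (γ + 1) * L (1 / (1 - s))
  hl : SlowlyVarying l
  hg : ∀ s ∈ Ico (0 : ℝ) 1, pgf g s = 1 - (1 - s) ^ α * l (1 / (1 - s))
  hr_nonneg : ∀ t, 0 < t → 0 ≤ r t
  hLR : SlowlyVarying LR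
  hr : ∀ t, 0 < t → r t = t ^ (-θ) * LR t
  hθ : 0 ≤ θ
  hR : IntegrableOn r (Ioi 0)
  hQ : IntegrableOn (fun t => q μ p g t 0) (Ioi 0)

/-- The cumulant `∫₀ᵗ r(u) q(t - u; s) du` of the process with immigration. -/
noncomputable def cumulant (r : ℝ → ℝ) (μ : ℝ) (p g : PMF ℕ) (t s : ℝ) : ℝ :=
  ∫ u in (0 : ℝ)..t, r u * q μ p g (t - u) s

namespace IntegrableRegime

variable {μ : ℝ} {p g : PMF ℕ} {γ α θ : ℝ} {L l r LR : ℝ → ℝ}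

lemma subcritical (H : IntegrableRegime μ p g γ α θ L l r LR) : Subcritical p :=
  Subcritical.of_eq H.hL H.hf

lemma q_pos (H : IntegrableRegime μ p g γ α θ L l r LR) {t : ℝ} (ht : 0 ≤ t) :
    0 < q μ p g t 0 :=
  q_zero_pos H.hμ H.subcritical H.hl H.hg ht

lemma Q_pos (H : IntegrableRegime μ p g γ α θ L l r LR) : 0 < Q μ p g := by
  rw [Q, setIntegral_pos_iff_support_of_nonneg_ae _ H.hQ]
  · have : Function.support (fun t => q μ p g t 0) ∩ Ioi 0 = Ioi 0 :=
      inter_eq_right.2 fun t ht => (H.q_pos (le_of_lt ht)).ne'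
    rw [this]
    simp
  · exact ae_of_all _ fun t => (q_mem_Icc H.hμ zero_mem_Icc t).1

lemma integral_r_pos (H : IntegrableRegime μ p g γ α θ L l r LR) : 0 < ∫ t in Ioi (0 : ℝ), r t := by
  obtain ⟨a, ha⟩ := eventually_atTop.1 (intensity_eventually_pos H.hLR H.hr)
  rw [setIntegral_pos_iff_support_of_nonneg_ae _ H.hR]
  · refine lt_of_lt_of_le (b := volume (Ioi (max a 0))) (by simp) (measure_mono fun t ht => ?_)
    have ht : max a 0 < t := ht
    exact ⟨(ha t ((le_max_left _ _).trans ht.le)).ne', (le_max_right _ _).trans_lt ht⟩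
  · exact (ae_restrict_iff' measurableSet_Ioi).2 (ae_of_all _ fun t ht => H.hr_nonneg t ht)

/-- The argument $\sigma(t)$ may move: it is constant for the limits of generating functions and is
`laplaceArg`, tending to $1$, for the scaled limits. -/
lemma exists_cumulant_asymptotics (H : IntegrableRegime μ p g γ α θ L l r LR) {σ : ℝ → ℝ}
    (hσ : ∀ᶠ t in atTop, σ t ∈ Icc (0 : ℝ) 1) {s : ℝ} (hs : s ∈ Icc (0 : ℝ) 1)
    (hlim : Tendsto σ atTop (𝓝 s)) {φ : ℝ}
    (hφ : ∀ u, Tendsto (fun t => q μ p g (t - u) (σ t) / q μ p g t 0) atTop (𝓝 φ)) :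
    ∃ A B : ℝ → ℝ, Tendsto A atTop (𝓝 (Δ μ p g s)) ∧
      Tendsto B atTop (𝓝 ((∫ u in Ioi 0, r u) * φ)) ∧
      ∀ᶠ t in atTop, cumulant r μ p g t (σ t) = r t * A t + q μ p g t 0 * B t := by
  obtain ⟨C, hC⟩ := exists_q_half_le H.hμ H.hγ H.hL H.hf H.hl H.hg
  refine exists_convolution_asymptotics H.hLR H.hr_nonneg H.hr H.hθ H.hR
    (q₀ := fun t => q μ p g t 0) (k := fun t u => q μ p g u (σ t)) (fun t ht => H.q_pos ht)
    (q_zero_antitoneOn H.hμ H.subcritical) H.hQ hC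
    (hσ.mono fun t ht => measurable_q H.hμ ht) (hσ.mono fun t ht u _ => ?_)
    (fun u _ => tendsto_q H.hμ hσ hlim hs u) fun u _ => hφ u
  exact ⟨(q_mem_Icc H.hμ ht u).1, q_le_q_zero H.hμ ht u⟩

lemma exists_cumulant_zero_asymptotics (H : IntegrableRegime μ p g γ α θ L l r LR) :
    ∃ A B : ℝ → ℝ, Tendsto A atTop (𝓝 (Q μ p g)) ∧
      Tendsto B atTop (𝓝 (∫ u in Ioi 0, r u)) ∧
      ∀ᶠ t in atTop, cumulant r μ p g t 0 = r t * A t + q μ p g t 0 * B t := by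
  have := H.exists_cumulant_asymptotics (Eventually.of_forall fun _ => zero_mem_Icc) zero_mem_Icc
    tendsto_const_nhds
    (fun u => tendsto_q_ratio_const H.hμ H.hγ H.hL H.hf H.hl H.hg zero_mem_Ico u)
  rwa [mul_one] at this

lemma cumulant_zero_pos (H : IntegrableRegime μ p g γ α θ L l r LR) :
    ∀ᶠ t in atTop, 0 < cumulant r μ p g t 0 := by
  obtain ⟨A, B, hA, hB, h⟩ := H.exists_cumulant_zero_asymptotics
  filter_upwards [h, hA.eventually (lt_mem_nhds H.Q_pos),
    hB.eventually (lt_mem_nhds H.integral_r_pos), intensity_eventually_pos H.hLR H.hr,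
    eventually_ge_atTop 0] with t h1 h2 h3 h4 h5
  rw [h1]
  have := H.q_pos h5
  positivity

lemma tendsto_q_zero (H : IntegrableRegime μ p g γ α θ L l r LR) :
    Tendsto (fun t => q μ p g t 0) atTop (𝓝 0) := by
  have h1 : Tendsto (fun t => pgf g (1 - 1 / W p (μ * t))) atTop (𝓝 1) := by
    have h2 := ((continuousOn_pgf g) 1 ⟨by norm_num, le_rfl⟩).tendsto
    rw [pgf_one] at h2
    refine h2.comp (tendsto_nhdsWithin_iff.2 ⟨?_, ?_⟩)
    · exact (tendsto_one_sub_one_div.comp (tendsto_W_mul H.hμ H.subcritical)).mono_right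
        nhdsWithin_le_nhds
    · filter_upwards [eventually_ge_atTop 0] with t ht
      have := one_sub_one_div_mem (one_le_W H.subcritical (mul_nonneg H.hμ.le ht))
      exact mem_Icc_neg_one ⟨this.1, this.2.le⟩
  have h2 := h1.const_sub 1
  rw [sub_self] at h2
  refine h2.congr' ?_
  filter_upwards [eventually_ge_atTop 0] with t ht
  rw [q_zero_eq H.hμ H.subcritical ht, pgfTail]

lemma tendsto_cumulant_zero (H : IntegrableRegime μ p g γ α θ L l r LR) :
    Tendsto (fun t => cumulant r μ p g t 0) atTop (𝓝 0) :=
  tendsto_convolution_zero (q₀ := fun t => q μ p g t 0) H.hr_nonneg H.hR (measurable_q H.hμ zero_mem_Icc)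
    (fun t _ => q_mem_Icc H.hμ zero_mem_Icc t) H.tendsto_q_zero

/-- The limit of `E[1 - s ^ Y(t)] / P(Y(t) > 0)`, in terms of the cumulants. -/
lemma tendsto_ratio_of_cumulant (H : IntegrableRegime μ p g γ α θ L l r LR) {σ : ℝ → ℝ} {c : ℝ}
    (hc : Tendsto (fun t => cumulant r μ p g t (σ t) / cumulant r μ p g t 0) atTop (𝓝 c)) :
    Tendsto (fun t => (1 - Real.exp (-cumulant r μ p g t (σ t))) /
      (1 - Real.exp (-cumulant r μ p g t 0))) atTop (𝓝 c) :=
  tendsto_one_sub_exp_ratio H.tendsto_cumulant_zero (H.cumulant_zero_pos.mono fun _ h => h.ne') hc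

lemma tendsto_cumulant_ratio_of_isLittleO (H : IntegrableRegime μ p g γ α θ L l r LR)
    (ho : (fun t => q μ p g t 0) =o[atTop] r) {s : ℝ} (hs : s ∈ Icc (0 : ℝ) 1) :
    Tendsto (fun t => cumulant r μ p g t s / cumulant r μ p g t 0) atTop
      (𝓝 (Δ μ p g s / Q μ p g)) := by
  obtain ⟨A', B', hA', hB', h'⟩ := H.exists_cumulant_zero_asymptotics
  -- The value of $\varphi$ is immaterial, since its weight $q/r$ tends to $0$; only existence of
  -- the limit is needed. At $s=1$ it is $0$ rather than $1$.
  have hφ : ∃ φ : ℝ, ∀ u, Tendsto (fun t => q μ p g (t - u) s / q μ p g t 0) atTop (𝓝 φ) := by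
    rcases hs.2.lt_or_eq with h1 | rfl
    · exact ⟨1, tendsto_q_ratio_const H.hμ H.hγ H.hL H.hf H.hl H.hg ⟨hs.1, h1⟩⟩
    · exact ⟨0, fun u => by simp [q_one H.hμ]⟩
  obtain ⟨φ, hφ⟩ := hφ
  obtain ⟨A, B, hA, hB, h⟩ := H.exists_cumulant_asymptotics (Eventually.of_forall fun _ => hs) hs
    tendsto_const_nhds hφ
  have key := tendsto_mixed_ratio (intensity_eventually_pos H.hLR H.hr) ho.tendsto_div_nhds_zero
    hA hB hA' hB' (by rw [zero_mul, add_zero]; exact H.Q_pos.ne')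
  simp only [zero_mul, add_zero] at key
  refine key.congr' ?_
  filter_upwards [h, h'] with t e1 e2
  rw [e1, e2]

/-- Admitting $d=0$ lets this serve (ii) and (iii) alike; $q$ is the reference scale in both. -/
lemma tendsto_cumulant_ratio_of_tendsto (H : IntegrableRegime μ p g γ α θ L l r LR) {d : ℝ}
    (hd : 0 ≤ d) (hrq : Tendsto (fun t => r t / q μ p g t 0) atTop (𝓝 d)) {σ : ℝ → ℝ}
    (hσ : ∀ᶠ t in atTop, σ t ∈ Icc (0 : ℝ) 1) {s : ℝ} (hs : s ∈ Icc (0 : ℝ) 1)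
    (hlim : Tendsto σ atTop (𝓝 s)) {φ : ℝ}
    (hφ : ∀ u, Tendsto (fun t => q μ p g (t - u) (σ t) / q μ p g t 0) atTop (𝓝 φ)) :
    Tendsto (fun t => cumulant r μ p g t (σ t) / cumulant r μ p g t 0) atTop
      (𝓝 (((∫ u in Ioi 0, r u) * φ + d * Δ μ p g s) / ((∫ u in Ioi 0, r u) + d * Q μ p g))) := by
  obtain ⟨A', B', hA', hB', h'⟩ := H.exists_cumulant_zero_asymptotics
  obtain ⟨A, B, hA, hB, h⟩ := H.exists_cumulant_asymptotics hσ hs hlim hφ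
  have hpos : 0 < (∫ u in Ioi 0, r u) + d * Q μ p g := by
    have := H.Q_pos
    have := H.integral_r_pos
    positivity
  have key := tendsto_mixed_ratio ((eventually_ge_atTop 0).mono fun t ht => H.q_pos ht) hrq
    hB hA hB' hA' hpos.ne'
  refine key.congr' ?_
  filter_upwards [h, h'] with t e1 e2
  rw [e1, e2, add_comm, add_comm (r t * A' t)]

end IntegrableRegime

end MarkovBranching

/-! ### Integration over independent ingredients -/

section Independence

variable {Ω : Type*} [MeasurableSpace Ω] {P : Measure Ω}

lemma integral_of_indepFun [IsProbabilityMeasure P] {𝓧 𝓨 : Type*} [MeasurableSpace 𝓧] [MeasurableSpace 𝓨] {X : Ω → 𝓧}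
    {X' : Ω → 𝓨} (hX : Measurable X) (hX' : Measurable X') (h : IndepFun X X' P)
    {f : 𝓧 × 𝓨 → ℝ} (hf : Measurable f) (hf1 : ∀ z, f z ∈ Icc (0 : ℝ) 1) :
    ∫ ω, f (X ω, X' ω) ∂P = ∫ ω, ∫ ω', f (X ω, X' ω') ∂P ∂P := by
  have := Measure.isProbabilityMeasure_map (μ := P) hX.aemeasurable
  have := Measure.isProbabilityMeasure_map (μ := P) hX'.aemeasurable
  have h1 := (indepFun_iff_map_prod_eq_prod_map_map hX.aemeasurable hX'.aemeasurable).1 h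
  rw [← integral_map (hX.prodMk hX').aemeasurable hf.aestronglyMeasurable, h1, integral_prod _
    (MarkovBranching.integrable_of_mem_Icc hf.aestronglyMeasurable hf1), integral_map hX.aemeasurable]
  · refine integral_congr_ae (ae_of_all _ fun ω => ?_)
    exact integral_map hX'.aemeasurable
      (hf.comp (measurable_const.prodMk measurable_id)).aestronglyMeasurable
  · exact hf.stronglyMeasurable.integral_prod_right'.aestronglyMeasurable

lemma integral_finset_prod_of_iIndepFun {ι : Type*} {𝓧 : ι → Type*}
    [∀ i, MeasurableSpace (𝓧 i)] {X : (i : ι) → Ω → 𝓧 i} (h : iIndepFun X P)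
    (hX : ∀ i, Measurable (X i)) {f : (i : ι) → 𝓧 i → ℝ} (hf : ∀ i, Measurable (f i))
    (B : Finset ι) :
    ∫ ω, ∏ i ∈ B, f i (X i ω) ∂P = ∏ i ∈ B, ∫ ω, f i (X i ω) ∂P := by
  have h1 := (h.precomp (g := fun i : B => (i : ι)) Subtype.val_injective).integral_fun_prod_comp
    (f := fun i : B => f i) (fun i => (hX i).aemeasurable) fun i => (hf i).aestronglyMeasurable
  simp_rw [← Finset.prod_coe_sort B]
  exact h1

end Independence

lemma integral_pow_poissonMeasure (lam : ℝ≥0) (x : ℝ) :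
    ∫ k, x ^ k ∂(poissonMeasure lam) = Real.exp (-((lam : ℝ) * (1 - x))) := by
  rw [integral_poissonMeasure]
  have h := (NormedSpace.expSeries_div_hasSum_exp ((lam : ℝ) * x)).mul_left (Real.exp (-lam))
  rw [← Real.exp_eq_exp_ℝ, ← Real.exp_add] at h
  rw [show -((lam : ℝ) * (1 - x)) = -lam + lam * x by ring, ← h.tsum_eq]
  refine tsum_congr fun n => ?_
  rw [mul_pow, smul_eq_mul]
  ring

/-! ### Jump times as measurable functionals of the path -/

namespace MarkovBranching

/-- The `k`-th jump time as a functional of the values of the path along a dense sequence. -/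
noncomputable def jumpTime (k : ℕ) (n : ℝ≥0 → ℕ) : ℝ≥0 :=
  (⨅ i : ℕ, if k ≤ n (TopologicalSpace.denseSeq ℝ≥0 i) then
    ((TopologicalSpace.denseSeq ℝ≥0 i : ℝ≥0) : ENNReal) else ⊤).toNNReal

lemma measurable_jumpTime (k : ℕ) : Measurable (jumpTime k) := by
  refine ENNReal.measurable_toNNReal.comp (Measurable.iInf fun i => ?_)
  exact Measurable.ite (measurableSet_le measurable_const (measurable_pi_apply _))
    measurable_const measurable_const

/-- For a monotone path, points of the dense sequence lie arbitrarily close above the infimum and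
already satisfy the condition. Without a $k$-th jump both sides are $0$, by `⊤.toNNReal = 0` and
`sInf ∅ = 0`. The countable form is what makes `Y` almost surely a measurable functional of its
ingredients. -/
lemma jumpTime_eq {n : ℝ≥0 → ℕ} (hn : Monotone n) (k : ℕ) : jumpTime k n = sInf {t | k ≤ n t} := by
  rcases ({t | k ≤ n t} : Set ℝ≥0).eq_empty_or_nonempty with h | h
  · have : ∀ t, ¬ k ≤ n t := fun t ht => by
      have : t ∈ ({t | k ≤ n t} : Set ℝ≥0) := ht
      rw [h] at this
      exact this
    rw [h, jumpTime]
    simp [this]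
  · rw [jumpTime]
    have : (⨅ i : ℕ, if k ≤ n (TopologicalSpace.denseSeq ℝ≥0 i) then
        ((TopologicalSpace.denseSeq ℝ≥0 i : ℝ≥0) : ENNReal) else ⊤) =
        ((sInf {t | k ≤ n t} : ℝ≥0) : ENNReal) := by
      refine le_antisymm (le_of_forall_gt fun c hc => ?_) (le_iInf fun i => ?_)
      · obtain ⟨b, hb1, hb2⟩ := ENNReal.lt_iff_exists_nnreal_btwn.1 hc
        obtain ⟨a, ha, hab⟩ := exists_lt_of_csInf_lt h (ENNReal.coe_lt_coe.1 hb1)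
        obtain ⟨i, hi⟩ := (TopologicalSpace.denseRange_denseSeq ℝ≥0).exists_mem_open isOpen_Ioo
          (nonempty_Ioo.2 hab)
        refine (iInf_le _ i).trans_lt ?_
        rw [if_pos (le_trans ha (hn hi.1.le))]
        exact (ENNReal.coe_lt_coe.2 hi.2).trans hb2
      · split_ifs with hi
        · exact ENNReal.coe_le_coe.2 (csInf_le (OrderBot.bddBelow _) hi)
        · exact le_top
    rw [this, ENNReal.toNNReal_coe]

lemma jumpTime_le {n : ℝ≥0 → ℕ} (hn : Monotone n) {k : ℕ} {t : ℝ≥0} (h : k ≤ n t) :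
    jumpTime k n ≤ t := by
  rw [jumpTime_eq hn]
  exact csInf_le (OrderBot.bddBelow _) h

/-- Right continuity of an integer-valued path keeps it constant just after $t$, whence the strict
inequality. The hypothesis `h'` excludes the default value $0$ of the infimum. -/
lemma lt_jumpTime {n : ℝ≥0 → ℕ} (hn : Monotone n) {k : ℕ} {t t' : ℝ≥0} (h : n t < k)
    (h' : k ≤ n t') (hc : ContinuousWithinAt n (Ici t) t) : t < jumpTime k n := by
  rw [jumpTime_eq hn]
  have h1 : ∀ᶠ u in 𝓝[≥] t, n u = n t := hc (mem_nhds_discrete.2 (mem_singleton (n t)))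
  have htt' : t < t' := by
    by_contra hle
    exact absurd (hn (not_lt.1 hle)) (by omega)
  obtain ⟨u, hu, hsub⟩ := (mem_nhdsGE_iff_exists_Ico_subset' htt').1 h1
  refine lt_of_lt_of_le hu (le_csInf ⟨t', h'⟩ fun v hv => ?_)
  by_contra hvu
  have hv : k ≤ n v := hv
  rcases le_or_gt t v with h2 | h2
  · have : n v = n t := hsub ⟨h2, not_le.1 hvu⟩
    omega
  · have := hn h2.le
    omega

end MarkovBranching

/-! ### The generating functional of the Poisson process -/

namespace MarkovBranching

/-- The points of the partition of `[0, t]` into `m` equal parts. -/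
noncomputable def gridPoint (t : ℝ≥0) (m i : ℕ) : ℝ≥0 := (i : ℝ≥0) * t / m

/-- The partition point to the right of `x`. -/
noncomputable def gridCeil (t : ℝ≥0) (m : ℕ) (x : ℝ) : ℝ := (⌈x / t * m⌉₊ : ℝ) / m * t

variable {t : ℝ≥0} {m : ℕ}

lemma monotone_gridPoint (t : ℝ≥0) (m : ℕ) : Monotone (gridPoint t m) := fun i j hij => by
  unfold gridPoint
  gcongr

lemma gridPoint_zero (t : ℝ≥0) (m : ℕ) : gridPoint t m 0 = 0 := by simp [gridPoint]

lemma gridPoint_self (hm : 0 < m) : gridPoint t m m = t := by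
  have : (m : ℝ≥0) ≠ 0 := by positivity
  rw [gridPoint]
  field_simp

lemma coe_gridPoint (i : ℕ) : (gridPoint t m i : ℝ) = i * t / m := by simp [gridPoint]

lemma gridCeil_eq (ht : 0 < t) (hm : 0 < m) {i : ℕ} {x : ℝ} (h1 : (gridPoint t m i : ℝ) < x)
    (h2 : x ≤ gridPoint t m (i + 1)) : gridCeil t m x = gridPoint t m (i + 1) := by
  have ht' : (0 : ℝ) < t := ht
  have hm' : (0 : ℝ) < m := by exact_mod_cast hm
  rw [coe_gridPoint] at h1 h2 ⊢
  have : ⌈x / t * m⌉₊ = i + 1 := by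
    rw [Nat.ceil_eq_iff (by omega)]
    constructor
    · rw [div_mul_eq_mul_div, lt_div_iff₀ ht']
      rw [div_lt_iff₀ hm'] at h1
      simpa using h1
    · rw [div_mul_eq_mul_div, div_le_iff₀ ht']
      rw [le_div_iff₀ hm'] at h2
      exact h2
  rw [gridCeil, this]
  ring

lemma tendsto_gridCeil (ht : 0 < t) {x : ℝ} (hx : 0 ≤ x) :
    Tendsto (fun m : ℕ => gridCeil t m x) atTop (𝓝 x) := by
  have ht' : (0 : ℝ) < t := ht
  have h := ((tendsto_nat_ceil_mul_div_atTop (R := ℝ) (div_nonneg hx ht'.le)).comp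
    tendsto_natCast_atTop_atTop).mul_const (t : ℝ)
  rw [div_mul_cancel₀ _ ht'.ne'] at h
  exact h

/-- The indices $k$ with $n(t_i)<k\le n(t_{i+1})$ are those whose jump falls in $(t_i,t_{i+1}]$, and
there `gridCeil` is $t_{i+1}$. The exponent counts them, simultaneous jumps included. -/
lemma prod_Icc_eq_prod_grid {n : ℝ≥0 → ℕ} (hn : Monotone n) (h0 : n 0 = 0)
    (hc : ∀ u, ContinuousWithinAt n (Ici u) u) (h : ℝ → ℝ) (ht : 0 < t) (hm : 0 < m) :
    ∏ i ∈ Finset.range m, h (gridPoint t m (i + 1)) ^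
      (n (gridPoint t m (i + 1)) - n (gridPoint t m i)) =
    ∏ k ∈ Finset.Icc 1 (n t), h (gridCeil t m (jumpTime k n)) := by
  have key : ∀ M : ℕ, ∏ i ∈ Finset.range M, h (gridPoint t m (i + 1)) ^
      (n (gridPoint t m (i + 1)) - n (gridPoint t m i)) =
      ∏ k ∈ Finset.Ioc 0 (n (gridPoint t m M)), h (gridCeil t m (jumpTime k n)) := by
    intro M
    induction M with
    | zero => simp [gridPoint_zero, h0]
    | succ M ih =>
      have hle : n (gridPoint t m M) ≤ n (gridPoint t m (M + 1)) :=
        hn (monotone_gridPoint t m M.le_succ)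
      rw [Finset.prod_range_succ, ih, ← Finset.prod_Ioc_consecutive _ (Nat.zero_le _) hle]
      congr 1
      rw [← Nat.card_Ioc, ← Finset.prod_const]
      refine Finset.prod_congr rfl fun k hk => ?_
      rw [Finset.mem_Ioc] at hk
      rw [gridCeil_eq ht hm (NNReal.coe_lt_coe.2 (lt_jumpTime hn hk.1 hk.2 (hc _)))
        (NNReal.coe_le_coe.2 (jumpTime_le hn hk.2))]
  rw [key m, gridPoint_self hm]
  rfl

section Poisson

variable {Ω : Type*} [MeasurableSpace Ω] {P : Measure Ω}
  {ν : ℝ≥0 → Ω → ℕ} {r : ℝ → ℝ}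

lemma gridCeil_eq_of_mem_uIoc (ht : 0 < t) (hm : 0 < m) {i : ℕ} {x : ℝ}
    (hx : x ∈ Ioc (gridPoint t m i : ℝ) (gridPoint t m (i + 1))) :
    gridCeil t m x = gridPoint t m (i + 1) := gridCeil_eq ht hm hx.1 hx.2

lemma measurable_gridCeil (t : ℝ≥0) (m : ℕ) : Measurable (gridCeil t m) := by
  unfold gridCeil
  exact (((measurable_of_countable (fun n : ℕ => (n : ℝ))).comp
    (Nat.measurable_ceil.comp (by fun_prop))).div_const _).mul_const _

/-- An exact formula at every mesh: the increments are independent Poisson variables, and $h$ is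
replaced by a step function. -/
lemma integral_prod_grid (hν : IsPoissonProcess r ν P) (hr : ∀ t, 0 < t → 0 ≤ r t)
    (hR : IntegrableOn r (Ioi 0)) {h : ℝ → ℝ} (hh : Measurable h) (h01 : ∀ x, h x ∈ Icc (0 : ℝ) 1)
    (ht : 0 < t) (hm : 0 < m) :
    ∫ ω, ∏ i ∈ Finset.range m, h (gridPoint t m (i + 1)) ^
      (ν (gridPoint t m (i + 1)) ω - ν (gridPoint t m i) ω) ∂P =
    Real.exp (-∫ u in (0 : ℝ)..t, r u * (1 - h (gridCeil t m u))) := by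
  have hmono := monotone_gridPoint t m
  have hind := hν.indepIncrements.nat hmono
  rw [integral_finset_prod_of_iIndepFun hind
    (fun i => (hν.measurable _).sub (hν.measurable _))
    (f := fun i k => h (gridPoint t m (i + 1)) ^ k) (fun i => by fun_prop)]
  have hle : ∀ i : ℕ, (gridPoint t m i : ℝ) ≤ gridPoint t m (i + 1) := fun i =>
    NNReal.coe_le_coe.2 (hmono i.le_succ)
  have hI : ∀ i : ℕ, IntegrableOn r (Ioc (gridPoint t m i : ℝ) (gridPoint t m (i + 1))) := fun i =>
    hR.mono_set fun u hu => lt_of_le_of_lt (NNReal.coe_nonneg _) hu.1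
  have hterm : ∀ i ∈ Finset.range m, ∫ ω, h (gridPoint t m (i + 1)) ^
      (ν (gridPoint t m (i + 1)) ω - ν (gridPoint t m i) ω) ∂P =
      Real.exp (-∫ u in (gridPoint t m i : ℝ)..gridPoint t m (i + 1),
        r u * (1 - h (gridCeil t m u))) := by
    intro i _
    have hlaw := hν.law _ _ (hmono i.le_succ)
    refine (hlaw.integral_comp (f := fun k : ℕ => h (gridPoint t m (i + 1)) ^ k)
      (by fun_prop)).trans ?_
    rw [integral_pow_poissonMeasure]
    have hnn : 0 ≤ ∫ u in (gridPoint t m i : ℝ)..gridPoint t m (i + 1), r u :=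
      intervalIntegral.integral_nonneg_of_ae_restrict (hle i)
        ((ae_restrict_iff' measurableSet_Icc).2 (by
          -- Nonnegativity of $r$ is given only on $(0,\infty)$; the point $0$ is null.
          filter_upwards [Measure.ae_ne volume (0 : ℝ)] with u hu0 hu
          exact hr u (lt_of_le_of_ne ((NNReal.coe_nonneg _).trans hu.1) hu0.symm)))
    rw [Real.coe_toNNReal _ hnn, ← intervalIntegral.integral_mul_const]
    congr 2
    refine intervalIntegral.integral_congr_ae (ae_of_all _ fun u hu => ?_)
    rw [uIoc_of_le (hle i)] at hu
    rw [gridCeil_eq_of_mem_uIoc ht hm hu]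
  rw [Finset.prod_congr rfl hterm, ← Real.exp_sum, Finset.sum_neg_distrib,
    intervalIntegral.sum_integral_adjacent_intervals, gridPoint_zero, gridPoint_self hm,
    NNReal.coe_zero]
  intro i _
  rw [intervalIntegrable_iff_integrableOn_Ioc_of_le (hle i)]
  refine (hI i).mul_bdd (c := 1)
    (measurable_const.sub (hh.comp (measurable_gridCeil t m))).aestronglyMeasurable
    (ae_of_all _ fun u => ?_)
  have := h01 (gridCeil t m u)
  rw [Real.norm_of_nonneg (sub_nonneg.2 this.2)]
  linarith [this.1]

/-- The generating functional of a Poisson process. -/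
lemma integral_prod_jumpTime [IsProbabilityMeasure P] (hν : IsPoissonProcess r ν P) (hr : ∀ t, 0 < t → 0 ≤ r t)
    (hR : IntegrableOn r (Ioi 0)) {h : ℝ → ℝ} (hh : Continuous h) (h01 : ∀ x, h x ∈ Icc (0 : ℝ) 1)
    (ht : 0 < t) :
    ∫ ω, ∏ k ∈ Finset.Icc 1 (ν t ω), h (jumpTime k fun u => ν u ω) ∂P =
    Real.exp (-∫ u in (0 : ℝ)..t, r u * (1 - h u)) := by
  have hgood : ∀ᵐ ω ∂P, (ν 0 ω = 0 ∧ Monotone fun u => ν u ω) ∧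
      ∀ u, ContinuousWithinAt (fun u => ν u ω) (Ici u) u :=
    (hν.zero.and hν.mono).and hν.rightCont
  have hmeas : ∀ m i : ℕ, Measurable fun ω => h (gridPoint t m (i + 1)) ^
      (ν (gridPoint t m (i + 1)) ω - ν (gridPoint t m i) ω) := fun m i =>
    (measurable_of_countable fun k : ℕ => h (gridPoint t m (i + 1)) ^ k).comp
      ((hν.measurable _).sub (hν.measurable _))
  -- As the mesh tends to $0$, `gridCeil` tends to the identity. Continuity and boundedness of $h$
  -- allow passing to the limit in the expectation and, below, in the exponent.
  have hlim1 : Tendsto (fun m : ℕ => ∫ ω, ∏ i ∈ Finset.range m, h (gridPoint t m (i + 1)) ^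
      (ν (gridPoint t m (i + 1)) ω - ν (gridPoint t m i) ω) ∂P) atTop
      (𝓝 (∫ ω, ∏ k ∈ Finset.Icc 1 (ν t ω), h (jumpTime k fun u => ν u ω) ∂P)) := by
    refine tendsto_integral_filter_of_dominated_convergence (fun _ => 1) ?_ ?_
      (integrable_const _) ?_
    · exact Eventually.of_forall fun m =>
        (Finset.measurable_fun_prod _ fun i _ => hmeas m i).aestronglyMeasurable
    · refine Eventually.of_forall fun m => ae_of_all _ fun ω => ?_
      rw [Real.norm_of_nonneg (Finset.prod_nonneg fun i _ => pow_nonneg (h01 _).1 _)]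
      exact Finset.prod_le_one (fun i _ => pow_nonneg (h01 _).1 _)
        fun i _ => pow_le_one₀ (h01 _).1 (h01 _).2
    · filter_upwards [hgood] with ω hω
      have : Tendsto (fun m : ℕ => ∏ k ∈ Finset.Icc 1 (ν t ω),
          h (gridCeil t m (jumpTime k fun u => ν u ω))) atTop
          (𝓝 (∏ k ∈ Finset.Icc 1 (ν t ω), h (jumpTime k fun u => ν u ω))) :=
        tendsto_finsetProd _ fun k _ =>
          (hh.tendsto _).comp (tendsto_gridCeil ht (NNReal.coe_nonneg _))
      refine this.congr' ?_
      filter_upwards [eventually_gt_atTop 0] with m hm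
      rw [prod_Icc_eq_prod_grid hω.1.2 hω.1.1 hω.2 h ht hm]
  have hlim2 : Tendsto (fun m : ℕ => ∫ u in (0 : ℝ)..t, r u * (1 - h (gridCeil t m u))) atTop
      (𝓝 (∫ u in (0 : ℝ)..t, r u * (1 - h u))) := by
    have ht0 : (0 : ℝ) ≤ t := NNReal.coe_nonneg t
    refine intervalIntegral.tendsto_integral_filter_of_dominated_convergence r ?_ ?_ ?_ ?_
    · refine Eventually.of_forall fun m => ?_
      rw [uIoc_of_le ht0]
      exact (hR.mono_set Ioc_subset_Ioi_self).aestronglyMeasurable.mul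
        (measurable_const.sub (hh.measurable.comp (measurable_gridCeil t m))).aestronglyMeasurable
    · refine Eventually.of_forall fun m => ae_of_all _ fun u hu => ?_
      rw [uIoc_of_le ht0] at hu
      have h1 := h01 (gridCeil t m u)
      have h2 := hr u hu.1
      rw [Real.norm_of_nonneg (mul_nonneg h2 (by linarith [h1.2]))]
      exact mul_le_of_le_one_right h2 (by linarith [h1.1])
    · exact (intervalIntegrable_iff_integrableOn_Ioc_of_le ht0).2 (hR.mono_set Ioc_subset_Ioi_self)
    · refine ae_of_all _ fun u hu => ?_
      rw [uIoc_of_le ht0] at hu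
      exact (((hh.tendsto u).comp (tendsto_gridCeil ht hu.1.le)).const_sub 1).const_mul (r u)
  refine tendsto_nhds_unique hlim1 ?_
  refine (((Real.continuous_exp.tendsto _).comp hlim2.neg)).congr' ?_
  filter_upwards [eventually_gt_atTop 0] with m hm
  rw [integral_prod_grid hν hr hR hh.measurable h01 ht hm]
  rfl

end Poisson

end MarkovBranching

/-! ### The generating function of $Y(t)$ -/

lemma measurable_sum_Icc_random {α : Type*} [MeasurableSpace α] {N : α → ℕ} (hN : Measurable N)
    {f : ℕ → α → ℕ} (hf : ∀ k, Measurable (f k)) :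
    Measurable fun a => ∑ k ∈ Finset.Icc 1 (N a), f k a := by
  have h : Measurable fun na : ℕ × α => ∑ k ∈ Finset.Icc 1 na.1, f k na.2 :=
    measurable_from_prod_countable_right fun n => by
      exact Finset.measurable_fun_sum (Finset.Icc 1 n) fun k _ => hf k
  exact h.comp (hN.prodMk measurable_id)

namespace MarkovBranching

/-- The number of descendants at time `τ` of a group of `i` particles with family trees `T`. -/
noncomputable def groupSize (τ : ℝ) (i : ℕ) (T : ℕ → TreeData) : ℕ :=
  ∑ j ∈ Finset.Icc 1 i, Z τ (T j)

/-- The process with immigration as a functional of its ingredients. -/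
noncomputable def pathY (t : ℝ≥0) (z : (ℝ≥0 → ℕ) × ((ℕ → ℕ) × (ℕ → ℕ → TreeData))) : ℕ :=
  ∑ k ∈ Finset.Icc 1 (z.1 t), groupSize ((t : ℝ) - jumpTime k z.1) (z.2.1 k) (z.2.2 k)

lemma measurable_groupSize {α : Type*} [MeasurableSpace α] {τ : α → ℝ} (hτ : Measurable τ)
    {i : α → ℕ} (hi : Measurable i) {T : α → ℕ → TreeData} (hT : Measurable T) :
    Measurable fun a => groupSize (τ a) (i a) (T a) :=
  measurable_sum_Icc_random hi fun j =>
    measurable_Z.comp (hτ.prodMk ((measurable_pi_apply j).comp hT))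

lemma measurable_pathY (t : ℝ≥0) : Measurable (pathY t) := by
  refine measurable_sum_Icc_random ((measurable_pi_apply t).comp measurable_fst) fun k => ?_
  refine measurable_groupSize ?_ ?_ ?_
  · exact measurable_const.sub
      (measurable_coe_nnreal_real.comp ((measurable_jumpTime k).comp measurable_fst))
  · exact (measurable_pi_apply k).comp (measurable_fst.comp measurable_snd)
  · exact (measurable_pi_apply k).comp (measurable_snd.comp measurable_snd)

variable {Ω : Type*} [MeasurableSpace Ω] {P : Measure Ω}
  {μ : ℝ} {p im : PMF ℕ} {r : ℝ → ℝ} {ν : ℝ≥0 → Ω → ℕ} {I : ℕ → Ω → ℕ}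
  {T : ℕ → ℕ → Ω → TreeData}

/-- The ingredients of the process, as a single random variable. -/
def ingredients (ν : ℝ≥0 → Ω → ℕ) (I : ℕ → Ω → ℕ) (T : ℕ → ℕ → Ω → TreeData) (ω : Ω) :
    (ℝ≥0 → ℕ) × ((ℕ → ℕ) × (ℕ → ℕ → TreeData)) :=
  (fun t => ν t ω, (fun k => I k ω, fun k j => T k j ω))

lemma IsMBPNPI.measurable_I_T (hY : IsMBPNPI μ p im r ν I T P) :
    Measurable fun ω => ((fun k => I k ω, fun k j => T k j ω) : (ℕ → ℕ) × (ℕ → ℕ → TreeData)) := by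
  have h1 := hY.measurable_I
  have h2 := hY.measurable_T
  refine Measurable.prodMk (measurable_pi_lambda _ h1) (measurable_pi_lambda _ fun k =>
    measurable_pi_lambda _ fun j => h2 k j)

lemma IsMBPNPI.measurable_ν (hY : IsMBPNPI μ p im r ν I T P) :
    Measurable fun ω => (fun t => ν t ω : ℝ≥0 → ℕ) :=
  measurable_pi_lambda _ hY.poisson.measurable

lemma IsMBPNPI.measurable_ingredients (hY : IsMBPNPI μ p im r ν I T P) :
    Measurable (ingredients ν I T) := hY.measurable_ν.prodMk hY.measurable_I_T

lemma IsMBPNPI.Y_ae_eq (hY : IsMBPNPI μ p im r ν I T P) (t : ℝ≥0) :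
    Y ν I T t =ᵐ[P] fun ω => pathY t (ingredients ν I T ω) := by
  filter_upwards [hY.poisson.mono] with ω hω
  refine Finset.sum_congr rfl fun k _ => ?_
  simp only [ingredients, groupSize]
  rw [jumpTime_eq hω]
  rfl

lemma pow_groupSize (s τ : ℝ) (i : ℕ) (T : ℕ → TreeData) :
    s ^ groupSize τ i T = ∏ j ∈ Finset.Icc 1 i, s ^ Z τ (T j) :=
  (Finset.prod_pow_eq_pow_sum _ _ _).symm

lemma IsMBPNPI.integral_trees (hY : IsMBPNPI μ p im r ν I T P) (s : ℝ) (τ : ℕ → ℝ) (N : ℕ)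
    (i : ℕ → ℕ) :
    ∫ ω, ∏ k ∈ Finset.Icc 1 N, s ^ groupSize (τ k) (i k) (fun j => T k j ω) ∂P =
      ∏ k ∈ Finset.Icc 1 N, F μ p (τ k) s ^ i k := by
  have hinj : Function.Injective fun kj : (_ : ℕ) × ℕ => (kj.1, kj.2) := by
    rintro ⟨a, b⟩ ⟨c, d⟩ h
    simp only [Prod.mk.injEq] at h
    rw [h.1, h.2]
  have key := integral_finset_prod_of_iIndepFun (hY.indep_T.precomp hinj)
    (fun kj => hY.measurable_T _ _) (f := fun kj x => s ^ Z (τ kj.1) x)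
    (fun kj => measurable_pow_Z_right s _) ((Finset.Icc 1 N).sigma fun k => Finset.Icc 1 (i k))
  simp only [Finset.prod_sigma] at key
  simp_rw [pow_groupSize]
  rw [key]
  refine Finset.prod_congr rfl fun k _ => ?_
  have h1 : ∀ j, ∫ ω, s ^ Z (τ k) (T k j ω) ∂P = F μ p (τ k) s := fun j =>
    (hY.law_T k j).integral_comp (f := fun x => s ^ Z (τ k) x)
      (measurable_pow_Z_right s _).aestronglyMeasurable
  simp [h1]

lemma prod_mem_Icc {ι : Type*} {f : ι → ℝ} (B : Finset ι) (h : ∀ i ∈ B, f i ∈ Icc (0 : ℝ) 1) :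
    ∏ i ∈ B, f i ∈ Icc (0 : ℝ) 1 :=
  ⟨Finset.prod_nonneg fun i hi => (h i hi).1, Finset.prod_le_one (fun i hi => (h i hi).1)
    fun i hi => (h i hi).2⟩

/-- Averaging over the trees first turns a group of size $i$ into $F^i$; averaging over the
independent sizes turns this into $g(F)$. -/
lemma IsMBPNPI.integral_groups [IsProbabilityMeasure P] (hY : IsMBPNPI μ p im r ν I T P)
    (hμ : 0 < μ) {s : ℝ} (hs : s ∈ Icc (0 : ℝ) 1) (τ : ℕ → ℝ) (N : ℕ) :
    ∫ ω, ∏ k ∈ Finset.Icc 1 N, s ^ groupSize (τ k) (I k ω) (fun j => T k j ω) ∂P =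
      ∏ k ∈ Finset.Icc 1 N, pgf im (F μ p (τ k) s) := by
  have hI : Measurable fun ω => (fun k => I k ω : ℕ → ℕ) := measurable_pi_lambda _ hY.measurable_I
  have hT : Measurable fun ω => (fun k j => T k j ω : ℕ → ℕ → TreeData) :=
    measurable_pi_lambda _ fun k => measurable_pi_lambda _ fun j => hY.measurable_T k j
  have hf : Measurable fun z : (ℕ → ℕ) × (ℕ → ℕ → TreeData) =>
      ∏ k ∈ Finset.Icc 1 N, s ^ groupSize (τ k) (z.1 k) (z.2 k) :=
    Finset.measurable_fun_prod _ fun k _ => (measurable_of_countable fun n : ℕ => s ^ n).comp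
      (measurable_groupSize measurable_const ((measurable_pi_apply k).comp measurable_fst)
        ((measurable_pi_apply k).comp measurable_snd))
  have h1 := integral_of_indepFun hI hT hY.indep_I_T hf
    fun z => prod_mem_Icc _ fun k _ => pow_mem_Icc hs _
  simp only at h1
  rw [h1]
  simp_rw [hY.integral_trees s τ N]
  rw [integral_finset_prod_of_iIndepFun hY.indep_I hY.measurable_I
    (f := fun k n => F μ p (τ k) s ^ n) (fun k => by fun_prop)]
  refine Finset.prod_congr rfl fun k _ => ?_
  rw [pgf_eq_integral im (F_mem_Icc hμ hs _)]
  exact (hY.law_I k).integral_comp (f := fun n : ℕ => F μ p (τ k) s ^ n) (by fun_prop)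

/-- The generating function of the process with immigration. -/
lemma IsMBPNPI.integral_pow_Y [IsProbabilityMeasure P] (hY : IsMBPNPI μ p im r ν I T P)
    (hμ : 0 < μ) (h : Subcritical p) (hr : ∀ t, 0 < t → 0 ≤ r t) (hR : IntegrableOn r (Ioi 0))
    {s : ℝ} (hs : s ∈ Icc (0 : ℝ) 1) {t : ℝ≥0} (ht : 0 < t) :
    ∫ ω, s ^ Y ν I T t ω ∂P = Real.exp (-cumulant r μ p im t s) := by
  have h1 : ∫ ω, s ^ Y ν I T t ω ∂P = ∫ ω, s ^ pathY t (ingredients ν I T ω) ∂P := by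
    refine integral_congr_ae ?_
    filter_upwards [hY.Y_ae_eq t] with ω hω
    rw [hω]
  have h2 := integral_of_indepFun hY.measurable_ν hY.measurable_I_T hY.indep_ν_I_T
    (f := fun z => s ^ pathY t z)
    ((measurable_of_countable fun n : ℕ => s ^ n).comp (measurable_pathY t))
    fun z => pow_mem_Icc hs _
  -- Clamping $t-u$ at $0$ makes $H$ continuous on the whole line, as `integral_prod_jumpTime`
  -- requires. It changes nothing, because the jumps counted by $\nu(t)$ occur no later than $t$.
  set H : ℝ → ℝ := fun u => pgf im (F μ p (max (t - u) 0) s) with hH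
  have hHc : Continuous H := by
    have hc := continuousOn_pgf_F (g := im) hμ h hs
    exact hc.comp_continuous (f := fun u : ℝ => max ((t : ℝ) - u) 0) (by fun_prop)
      fun u => mem_Ici.2 (le_max_right _ _)
  have h3 : ∫ ω, ∫ ω', s ^ pathY t (fun t => ν t ω, (fun k => I k ω', fun k j => T k j ω')) ∂P ∂P =
      ∫ ω, ∏ k ∈ Finset.Icc 1 (ν t ω), H (jumpTime k fun u => ν u ω) ∂P := by
    refine integral_congr_ae ?_
    filter_upwards [hY.poisson.mono] with ω hω
    have h4 := hY.integral_groups hμ hs (fun k => (t : ℝ) - jumpTime k fun u => ν u ω) (ν t ω)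
    simp only [pathY, ← Finset.prod_pow_eq_pow_sum]
    rw [h4]
    refine Finset.prod_congr rfl fun k hk => ?_
    have h5 := jumpTime_le hω (Finset.mem_Icc.1 hk).2
    simp only [hH]
    rw [max_eq_left (sub_nonneg.2 (NNReal.coe_le_coe.2 h5))]
  rw [h1]
  refine h2.trans (h3.trans ?_)
  rw [integral_prod_jumpTime hY.poisson hr hR hHc (fun u => pgf_mem_Icc im (F_mem_Icc hμ hs _)) ht,
    cumulant]
  congr 2
  refine intervalIntegral.integral_congr fun u hu => ?_
  rw [uIcc_of_le (NNReal.coe_nonneg t)] at hu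
  simp only [hH, q]
  rw [max_eq_left (sub_nonneg.2 hu.2)]

end MarkovBranching

/-! ### Weak convergence on the unit interval from moments -/

section MomentMethod

open scoped BoundedContinuousFunction

/-- On the unit interval, convergence of moments implies weak convergence. -/
lemma tendsto_of_tendsto_moments {ι : Type*} {𝓕 : Filter ι} {m : ι → ProbabilityMeasure unitInterval}
    {m₀ : ProbabilityMeasure unitInterval}
    (h : ∀ n : ℕ, Tendsto (fun i => ∫ y, (y : ℝ) ^ n ∂(m i : Measure unitInterval)) 𝓕
      (𝓝 (∫ y, (y : ℝ) ^ n ∂(m₀ : Measure unitInterval)))) : Tendsto m 𝓕 (𝓝 m₀) := by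
  set X : unitInterval →ᵇ ℝ :=
    BoundedContinuousFunction.mkOfCompact ⟨fun y => (y : ℝ), continuous_subtype_val⟩ with hX
  -- Polynomials in the coordinate form a point-separating algebra, and their integrals are linear
  -- combinations of moments; compactness supplies tightness.
  set A : StarSubalgebra ℝ (unitInterval →ᵇ ℝ) :=
    { (Polynomial.aeval X).range with
      star_mem' := fun {a} ha => by
        have : star a = a := by ext y; exact star_trivial _
        rw [this]
        exact ha } with hA
  refine ProbabilityMeasure.tendsto_of_tight_of_separatesPoints ℝ IsTightMeasureSet.of_compactSpace
    (A := A) ?_ ?_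
  · intro a b hab
    refine ⟨fun y => (y : ℝ), ⟨BoundedContinuousFunction.toContinuousMapStarₐ ℝ X, ?_, rfl⟩,
      fun hc => hab (Subtype.ext hc)⟩
    exact ⟨X, ⟨Polynomial.X, by simp⟩, rfl⟩
  · rintro g ⟨p, rfl⟩
    have hev : ∀ y, (Polynomial.aeval X p) y =
        ∑ k ∈ Finset.range (p.natDegree + 1), p.coeff k * (y : ℝ) ^ k := fun y => by
      rw [Polynomial.aeval_eq_sum_range]
      simp [hX]
    have hint : ∀ m : ProbabilityMeasure unitInterval,
        ∫ y, (Polynomial.aeval X p) y ∂(m : Measure unitInterval) =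
          ∑ k ∈ Finset.range (p.natDegree + 1),
            p.coeff k * ∫ y, (y : ℝ) ^ k ∂(m : Measure unitInterval) := fun m => by
      simp_rw [hev]
      rw [integral_finsetSum]
      · simp_rw [integral_const_mul]
      · intro k _
        exact (BoundedContinuousFunction.integrable (m : Measure unitInterval) (X ^ k)).const_mul _
    have := tendsto_finsetSum (Finset.range (p.natDegree + 1)) fun k _ =>
      (h k).const_mul (p.coeff k)
    simp_rw [← hint] at this
    exact this

end MomentMethod

/-! ### Laplace transforms, transported to the unit interval by $x\mapsto e^{-x}$ -/

section LaplaceTransform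

/-- The map `x ↦ exp (-x)` from the half-line to the unit interval. -/
noncomputable def expNeg (x : ℝ) : unitInterval :=
  ⟨Real.exp (-max x 0), (Real.exp_pos _).le, Real.exp_le_one_iff.2 (by simp)⟩

lemma coe_expNeg (x : ℝ) : (expNeg x : ℝ) = Real.exp (-max x 0) := rfl

lemma continuous_expNeg : Continuous expNeg :=
  Continuous.subtype_mk (by fun_prop) _

lemma expNeg_rpow {x : ℝ} (hx : 0 ≤ x) (lam : ℝ) :
    (expNeg x : ℝ) ^ lam = Real.exp (-lam * x) := by
  simp only [expNeg, max_eq_left hx]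
  rw [← Real.exp_mul]
  ring_nf

lemma ae_nonneg_of_Iio {m : Measure ℝ} (h : m (Iio 0) = 0) : ∀ᵐ x ∂m, 0 ≤ x := by
  rw [ae_iff]
  simpa [Set.Iio] using h

lemma integral_map_expNeg {m : Measure ℝ} (h : m (Iio 0) = 0) {lam : ℝ} (hlam : 0 ≤ lam) :
    ∫ y, (y : ℝ) ^ lam ∂(m.map expNeg) = ∫ x, Real.exp (-lam * x) ∂m := by
  rw [integral_map continuous_expNeg.aemeasurable]
  · refine integral_congr_ae ?_
    filter_upwards [ae_nonneg_of_Iio h] with x hx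
    exact expNeg_rpow hx lam
  · exact (continuous_subtype_val.rpow_const fun _ => Or.inr hlam).aestronglyMeasurable

/-- The continuity theorem for Laplace transforms, at continuity points of the limit law. -/
lemma tendsto_cdf_of_tendsto_laplace {ι : Type*} {𝓕 : Filter ι} {m : ι → Measure ℝ} {D : Measure ℝ}
    [∀ i, IsProbabilityMeasure (m i)] [IsProbabilityMeasure D]
    (hm : ∀ i, m i (Iio 0) = 0) (hD : D (Iio 0) = 0)
    (h : ∀ lam : ℝ, 0 < lam → Tendsto (fun i => ∫ x, Real.exp (-lam * x) ∂(m i)) 𝓕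
      (𝓝 (∫ x, Real.exp (-lam * x) ∂D))) {x : ℝ} (hx : 0 ≤ x) (hDx : D {x} = 0) :
    Tendsto (fun i => (m i).real (Iic x)) 𝓕 (𝓝 (D.real (Iic x))) := by
  have hp : ∀ n : Measure ℝ, IsProbabilityMeasure n → IsProbabilityMeasure (n.map expNeg) :=
    fun n hn => Measure.isProbabilityMeasure_map continuous_expNeg.aemeasurable
  set M : ι → ProbabilityMeasure unitInterval := fun i => ⟨(m i).map expNeg, hp _ inferInstance⟩
  set M₀ : ProbabilityMeasure unitInterval := ⟨D.map expNeg, hp _ inferInstance⟩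
  have hlim : Tendsto M 𝓕 (𝓝 M₀) := by
    refine tendsto_of_tendsto_moments fun n => ?_
    -- The $n$-th moment of $e^{-X}$ is the Laplace transform at $n$. The case $n=0$, outside the
    -- range of `h`, is total mass one.
    rcases Nat.eq_zero_or_pos n with rfl | hn
    · simpa using tendsto_const_nhds
    · have h1 := h n (Nat.cast_pos.2 hn)
      simp_rw [← integral_map_expNeg (hm _) (Nat.cast_nonneg n),
        ← integral_map_expNeg hD (Nat.cast_nonneg n), Real.rpow_natCast] at h1
      exact h1
  set E : Set unitInterval := Ici (expNeg x)
  have hE : expNeg ⁻¹' E = Iic x := by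
    ext z
    simp only [E, mem_preimage, mem_Ici, mem_Iic]
    rw [← Subtype.coe_le_coe, coe_expNeg, coe_expNeg, Real.exp_le_exp, neg_le_neg_iff,
      max_eq_left hx, max_le_iff, and_iff_left hx]
  have hreal : ∀ n : Measure ℝ, (n.map expNeg).real E = n.real (Iic x) := fun n => by
    rw [Measure.real, Measure.map_apply continuous_expNeg.measurable measurableSet_Ici, hE,
      Measure.real]
  -- The frontier of $[e^{-x},1]$ is at most the point $e^{-x}$. Its preimage is $\{x\}$, except
  -- that at $x=0$ it also contains the negative half-line, which is null.
  have hfr : (M₀ : Measure unitInterval) (frontier E) = 0 := by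
    have h1 : frontier E ⊆ {expNeg x} := by
      intro y hy
      exact (frontier_le_subset_eq continuous_const continuous_id hy).symm
    refine measure_mono_null h1 ?_
    have h2 : (M₀ : Measure unitInterval) {expNeg x} = D (expNeg ⁻¹' {expNeg x}) :=
      Measure.map_apply continuous_expNeg.measurable (measurableSet_singleton _)
    rw [h2]
    refine measure_mono_null (t := {x} ∪ Iio 0) (fun z hz => ?_)
      (measure_union_null hDx hD)
    rw [mem_preimage, mem_singleton_iff, Subtype.ext_iff, coe_expNeg, coe_expNeg, Real.exp_eq_exp,
      neg_inj, max_eq_left hx] at hz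
    rcases lt_or_ge z 0 with h3 | h3
    · exact Or.inr h3
    · rw [max_eq_left h3] at hz
      exact Or.inl hz
  have h4 := ProbabilityMeasure.tendsto_measure_of_null_frontier_of_tendsto' hlim hfr
  have h5 := (ENNReal.tendsto_toReal (measure_ne_top _ _)).comp h4
  rw [← hreal]
  simp_rw [← hreal]
  exact h5

/-- A pointwise limit of Laplace transforms that tends to `1` at `0` is a Laplace transform. -/
lemma exists_measure_of_tendsto_laplace {m : ℕ → Measure ℝ} [∀ i, IsProbabilityMeasure (m i)]
    (hm : ∀ i, m i (Iio 0) = 0) {φ : ℝ → ℝ}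
    (h : ∀ lam : ℝ, 0 < lam → Tendsto (fun i => ∫ x, Real.exp (-lam * x) ∂(m i)) atTop
      (𝓝 (φ lam))) (h0 : Tendsto φ (𝓝[>] 0) (𝓝 1)) :
    ∃ D : Measure ℝ, IsProbabilityMeasure D ∧ D (Iio 0) = 0 ∧
      ∀ lam : ℝ, 0 < lam → ∫ x, Real.exp (-lam * x) ∂D = φ lam := by
  have hp : ∀ n : Measure ℝ, IsProbabilityMeasure n → IsProbabilityMeasure (n.map expNeg) :=
    fun n hn => Measure.isProbabilityMeasure_map continuous_expNeg.aemeasurable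
  set M : ℕ → ProbabilityMeasure unitInterval := fun i => ⟨(m i).map expNeg, hp _ inferInstance⟩
  -- Compactness of the space of laws on the unit interval: a limit along an ultrafilter finer than
  -- `atTop` takes the place of a subsequence.
  set u : Ultrafilter ℕ := Ultrafilter.of atTop
  have hu : (u : Filter ℕ) ≤ atTop := Ultrafilter.of_le _
  set N : ProbabilityMeasure unitInterval := (u.map M).lim
  have hlim : Tendsto M u (𝓝 N) := Ultrafilter.le_nhds_lim (u.map M)
  have hφ : ∀ lam : ℝ, 0 < lam → ∫ y, (y : ℝ) ^ lam ∂(N : Measure unitInterval) = φ lam := by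
    intro lam hlam
    have hc : Continuous fun y : unitInterval => (y : ℝ) ^ lam :=
      continuous_subtype_val.rpow_const fun _ => Or.inr hlam.le
    have h1 := (ProbabilityMeasure.tendsto_iff_forall_integral_tendsto.1 hlim)
      (BoundedContinuousFunction.mkOfCompact ⟨_, hc⟩)
    have h2 := (h lam hlam).mono_left hu
    simp_rw [← integral_map_expNeg (hm _) hlam.le] at h2
    exact tendsto_nhds_unique h1 h2
  have hint : ∀ lam : ℝ, 0 < lam →
      Integrable (fun y : unitInterval => (y : ℝ) ^ lam) (N : Measure unitInterval) :=
    fun lam hlam => (BoundedContinuousFunction.integrable (N : Measure unitInterval)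
      (BoundedContinuousFunction.mkOfCompact ⟨_, continuous_subtype_val.rpow_const
        fun _ => Or.inr hlam.le⟩))
  -- An atom of the limit at $0\in[0,1]$ is mass escaping to infinity on the half-line. It would
  -- force $\varphi(\lambda)\le1-N\{0\}$ for all $\lambda>0$, against $\varphi(0+)=1$.
  have hN : (N : Measure unitInterval) {0} = 0 := by
    have h1 : ∀ lam : ℝ, 0 < lam → φ lam ≤ 1 - (N : Measure unitInterval).real {0} := by
      intro lam hlam
      rw [← probReal_compl_eq_one_sub (measurableSet_singleton _), ← hφ lam hlam,
        ← integral_indicator_one (measurableSet_singleton _).compl]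
      refine integral_mono (hint lam hlam)
        ((integrable_const (1 : ℝ)).indicator (measurableSet_singleton _).compl) fun y => ?_
      by_cases hy : y = 0
      · simp [hy, Real.zero_rpow hlam.ne']
      · rw [indicator_of_mem (by simpa using hy)]
        exact Real.rpow_le_one y.2.1 y.2.2 hlam.le
    have h2 : (1 : ℝ) ≤ 1 - (N : Measure unitInterval).real {0} :=
      le_of_tendsto h0 (eventually_mem_nhdsWithin.mono fun lam hlam => h1 lam hlam)
    have h3 : (N : Measure unitInterval).real {0} = 0 :=
      le_antisymm (by linarith) measureReal_nonneg
    exact (measureReal_eq_zero_iff).1 h3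
  have hmeas : Measurable fun y : unitInterval => -Real.log y :=
    (Real.measurable_log.comp measurable_subtype_coe).neg
  refine ⟨(N : Measure unitInterval).map fun y : unitInterval => -Real.log (y : ℝ),
    Measure.isProbabilityMeasure_map hmeas.aemeasurable, ?_, fun lam hlam => ?_⟩
  · rw [Measure.map_apply hmeas measurableSet_Iio]
    convert measure_empty (μ := (N : Measure unitInterval))
    ext y
    simpa using Real.log_nonpos y.2.1 y.2.2
  · rw [integral_map hmeas.aemeasurable (Continuous.aestronglyMeasurable (by fun_prop)), ← hφ lam hlam]
    refine integral_congr_ae ?_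
    have h1 : ∀ᵐ y ∂(N : Measure unitInterval), y ≠ 0 := by
      rw [ae_iff]
      simpa using hN
    filter_upwards [h1] with y hy
    rw [Real.rpow_def_of_pos (lt_of_le_of_ne y.2.1 fun hc => hy (Subtype.ext hc.symm))]
    ring_nf

/-- There is no mass at the origin if the Laplace transform vanishes at infinity. -/
lemma measure_Iic_zero_of_tendsto_laplace {D : Measure ℝ} [IsProbabilityMeasure D]
    (hD : D (Iio 0) = 0)
    (h : Tendsto (fun lam => ∫ x, Real.exp (-lam * x) ∂D) atTop (𝓝 0)) : D (Iic 0) = 0 := by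
  have h1 : ∀ lam : ℝ, 0 < lam → D.real (Iic 0) ≤ ∫ x, Real.exp (-lam * x) ∂D := by
    intro lam hlam
    rw [← integral_indicator_one measurableSet_Iic]
    refine integral_mono_ae ((integrable_const (1 : ℝ)).indicator measurableSet_Iic) ?_ ?_
    · refine Integrable.of_bound (by fun_prop) 1 ?_
      filter_upwards [ae_nonneg_of_Iio hD] with x hx
      rw [Real.norm_eq_abs, Real.abs_exp, Real.exp_le_one_iff]
      nlinarith
    · refine ae_of_all _ fun x => ?_
      refine indicator_le' (fun x hx => ?_) (fun x _ => (Real.exp_pos _).le) x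
      have hx : x ≤ 0 := hx
      exact Real.one_le_exp (by nlinarith)
  have h2 : D.real (Iic 0) ≤ 0 := ge_of_tendsto h ((eventually_gt_atTop 0).mono h1)
  exact (measureReal_eq_zero_iff).1 (le_antisymm h2 measureReal_nonneg)

end LaplaceTransform

/-! ### Absence of atoms in the limit law -/

/-- A law whose characteristic function vanishes at infinity has no atoms. -/
lemma measure_singleton_of_tendsto_charFun {D : Measure ℝ} [IsProbabilityMeasure D]
    (h : ∀ η : ℝ, 0 < η → ∃ M, ∀ t, M ≤ |t| → ‖charFun D t‖ ≤ η) (x₀ : ℝ) : D {x₀} = 0 := by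
  -- Translating the candidate atom to the origin leaves the modulus of the characteristic function
  -- unchanged.
  set D' := D.map (fun x => x + -x₀) with hD'
  have hprob : IsProbabilityMeasure D' := Measure.isProbabilityMeasure_map (by fun_prop)
  have hn : ∀ t, ‖charFun D' t‖ = ‖charFun D t‖ := fun t => by
    rw [hD', charFun_map_add_const, norm_mul, Complex.norm_exp_ofReal_mul_I, mul_one]
  have hatom : D' {0} = D {x₀} := by
    rw [hD', Measure.map_apply (by fun_prop) (measurableSet_singleton _)]
    congr 1
    ext x
    simp
  -- The mean of the characteristic function over $[-R,R]$ is $\int\operatorname{sinc}(Rx)\,dD'$. It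
  -- tends to $D'\{0\}$ by dominated convergence, and to $0$ by the decay hypothesis.
  have h1 : Tendsto (fun R : ℝ => ∫ x, Real.sinc (R * x) ∂D') atTop (𝓝 (D'.real {0})) := by
    rw [← integral_indicator_one (measurableSet_singleton _)]
    refine tendsto_integral_filter_of_dominated_convergence (fun _ => 1)
      (Eventually.of_forall fun R => ?_) (Eventually.of_forall fun R => ae_of_all _ fun x => ?_)
      (integrable_const _) (ae_of_all _ fun x => ?_)
    · exact (Real.continuous_sinc.comp (by fun_prop)).aestronglyMeasurable
    · exact Real.abs_sinc_le_one _
    · by_cases hx : x = 0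
      · simp [hx]
      · rw [indicator_of_notMem (by simpa using hx)]
        refine squeeze_zero_norm' (a := fun R : ℝ => 1 / (R * |x|)) ?_ ?_
        · filter_upwards [eventually_gt_atTop 0] with R hR
          have hRx : R * x ≠ 0 := mul_ne_zero hR.ne' hx
          rw [Real.sinc_of_ne_zero hRx, norm_div, Real.norm_eq_abs, Real.norm_eq_abs, abs_mul,
            abs_of_pos hR]
          exact div_le_div_of_nonneg_right (Real.abs_sin_le_one _) (by positivity)
        · have := (tendsto_id (α := ℝ) (x := atTop)).atTop_mul_const (abs_pos.2 hx)
          simp only [one_div]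
          exact this.inv_tendsto_atTop
  have h2 : Tendsto (fun R : ℝ => ∫ t in (-1 : ℝ)..1, charFun D' (R * t)) atTop (𝓝 0) := by
    have : (0 : ℂ) = ∫ t in (-1 : ℝ)..1, (0 : ℂ) := by simp
    rw [this]
    refine intervalIntegral.tendsto_integral_filter_of_dominated_convergence (fun _ => 1)
      (Eventually.of_forall fun R => ?_)
      (Eventually.of_forall fun R => ae_of_all _ fun x _ => norm_charFun_le_one _)
      intervalIntegrable_const ?_
    · exact (measurable_charFun.comp (by fun_prop)).aestronglyMeasurable
    · have h0 : ∀ᵐ x : ℝ, x ≠ 0 := by simp [ae_iff]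
      filter_upwards [h0] with x hx _
      rw [tendsto_zero_iff_norm_tendsto_zero, Metric.tendsto_atTop']
      intro η hη
      obtain ⟨M, hM⟩ := h (η / 2) (by positivity)
      refine ⟨max 0 (M / |x|), fun R hR => ?_⟩
      have hx' := abs_pos.2 hx
      have hR0 : 0 < R := (le_max_left _ _).trans_lt hR
      have := hM (R * x) (by
        rw [abs_mul, abs_of_pos hR0, ← div_le_iff₀ hx']
        exact ((le_max_right _ _).trans_lt hR).le)
      simp only [dist_zero_right, norm_norm]
      rw [hn]
      linarith
  have h3 : ∀ᶠ R : ℝ in atTop, ∫ t in (-1 : ℝ)..1, charFun D' (R * t) =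
      ((2 * ∫ x, Real.sinc (R * x) ∂D' : ℝ) : ℂ) := by
    filter_upwards [eventually_gt_atTop 0] with R hR
    rw [intervalIntegral.integral_comp_mul_left (f := charFun D') hR.ne']
    rw [mul_neg, mul_one, integral_charFun_Icc hR, Complex.real_smul]
    have : (R : ℂ) ≠ 0 := Complex.ofReal_ne_zero.2 hR.ne'
    push_cast
    field_simp
  have h4 := tendsto_nhds_unique ((h2.congr' h3))
    ((Complex.continuous_ofReal.tendsto _).comp (h1.const_mul 2))
  have h5 : D'.real {0} = 0 := by
    have := Complex.ofReal_eq_zero.1 h4.symm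
    linarith
  rw [← hatom]
  exact (measureReal_eq_zero_iff).1 h5

/-- The characteristic function as a boundary value of the moment generating function. -/
lemma tendsto_complexMGF_charFun {D : Measure ℝ} [IsProbabilityMeasure D] (hD : D (Iio 0) = 0)
    (t : ℝ) : Tendsto (fun ε : ℝ => complexMGF id D (-ε + t * Complex.I)) (𝓝[>] 0)
      (𝓝 (charFun D t)) := by
  rw [← complexMGF_id_mul_I]
  refine tendsto_integral_filter_of_dominated_convergence (fun _ => 1)
    (Eventually.of_forall fun ε => ?_) ?_ (integrable_const _) (ae_of_all _ fun x => ?_)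
  · exact Continuous.aestronglyMeasurable (by fun_prop)
  · filter_upwards [self_mem_nhdsWithin] with ε hε
    filter_upwards [ae_nonneg_of_Iio hD] with x hx
    have hε : 0 < ε := hε
    rw [Complex.norm_exp]
    simp only [id, Complex.mul_re, Complex.add_re, Complex.neg_re, Complex.ofReal_re,
      Complex.I_re, Complex.ofReal_im, Complex.I_im]
    rw [Real.exp_le_one_iff]
    nlinarith
  · refine tendsto_nhdsWithin_of_tendsto_nhds ?_
    have : Continuous fun ε : ℝ => Complex.exp ((-ε + t * Complex.I) * (id x : ℝ)) := by fun_prop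
    simpa using this.tendsto 0

/-- Extension of a Laplace transform to the half-plane. -/
lemma complexMGF_eq_of_laplace_eq {D : Measure ℝ} [IsProbabilityMeasure D] (hD : D (Iio 0) = 0)
    {Φ : ℂ → ℂ} (hΦ : AnalyticOnNhd ℂ Φ {z | z.re < 0})
    (h : ∀ lam : ℝ, 0 < lam → ((∫ x, Real.exp (-lam * x) ∂D : ℝ) : ℂ) = Φ (-lam)) :
    EqOn (complexMGF id D) Φ {z | z.re < 0} := by
  have hset : ∀ s : ℝ, s < 0 → s ∈ interior (integrableExpSet id D) := by
    have hsub : Iio 0 ⊆ integrableExpSet id D := by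
      intro s hs
      have hs : s < 0 := hs
      refine Integrable.of_bound (by fun_prop) 1 ?_
      filter_upwards [ae_nonneg_of_Iio hD] with x hx
      rw [Real.norm_eq_abs, Real.abs_exp, Real.exp_le_one_iff]
      simp only [id]
      nlinarith
    exact fun s hs => interior_maximal hsub isOpen_Iio hs
  -- Identity theorem: the two functions agree on the negative real axis, hence at points
  -- accumulating at $-1$.
  refine AnalyticOnNhd.eqOn_of_preconnected_of_frequently_eq (z₀ := -1)
    (analyticOnNhd_complexMGF.mono fun z hz => hset _ hz) hΦ
    (convex_halfSpace_re_lt 0).isPreconnected (by simp) ?_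
  have h1 : Tendsto (fun lam : ℝ => (-(lam : ℂ))) (𝓝[≠] 1) (𝓝[≠] (-1)) := by
    refine tendsto_nhdsWithin_iff.2 ⟨?_, ?_⟩
    · have : Continuous fun lam : ℝ => (-(lam : ℂ)) := by fun_prop
      have := this.tendsto 1
      simp only [Complex.ofReal_one] at this
      exact this.mono_left nhdsWithin_le_nhds
    · filter_upwards [self_mem_nhdsWithin] with lam hlam
      simp only [mem_compl_iff, mem_singleton_iff, neg_inj] at hlam ⊢
      exact_mod_cast hlam
  refine h1.frequently (Eventually.frequently ?_)
  filter_upwards [nhdsWithin_le_nhds (lt_mem_nhds (show (0 : ℝ) < 1 by norm_num))] with lam hlam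
  rw [← h lam hlam, ← Complex.ofReal_neg, complexMGF_ofReal]
  rfl

/-- The analytic continuation of `1 - (1 + lam ^ (-γ)) ^ (-β)`, as a function of `-lam`. -/
noncomputable def laplaceExtension (γ β : ℝ) (z : ℂ) : ℂ :=
  1 - (1 + (-z) ^ ((-γ : ℝ) : ℂ)) ^ ((-β : ℝ) : ℂ)

/-- Here $\gamma\le1$ enters: $|\arg w|<\pi/2$ implies that $\gamma|\arg w|$ stays below $\pi/2$. So
$1+w^{-\gamma}$ has positive real part and avoids the branch cut of the outer power. -/
lemma re_cpow_nonneg {γ : ℝ} (hγ : γ ∈ Ioc (0 : ℝ) 1) {w : ℂ} (hw : 0 < w.re) :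
    0 ≤ (w ^ ((-γ : ℝ) : ℂ)).re := by
  have hw0 : w ≠ 0 := fun h => by simp [h] at hw
  have harg := Complex.abs_arg_lt_pi_div_two_iff.2 (Or.inl hw)
  rw [Complex.cpow_def_of_ne_zero hw0, Complex.exp_re]
  refine mul_nonneg (Real.exp_pos _).le (Real.cos_nonneg_of_mem_Icc ?_)
  rw [Complex.im_mul_ofReal, Complex.log_im, mem_Icc, ← abs_le, abs_mul, abs_neg, abs_of_pos hγ.1]
  nlinarith [abs_nonneg w.arg, hγ.1, hγ.2]

lemma analyticOnNhd_laplaceExtension {γ : ℝ} (hγ : γ ∈ Ioc (0 : ℝ) 1) (β : ℝ) :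
    AnalyticOnNhd ℂ (laplaceExtension γ β) {z | z.re < 0} := by
  intro z hz
  have hz : 0 < (-z).re := by simpa using hz
  refine analyticAt_const.sub (AnalyticAt.cpow (analyticAt_const.add
    (AnalyticAt.cpow analyticAt_id.neg analyticAt_const (Or.inl hz))) analyticAt_const ?_)
  refine Or.inl ?_
  have := re_cpow_nonneg hγ hz
  simp only [Complex.add_re, Complex.one_re]
  linarith

lemma laplaceExtension_small {γ : ℝ} (hγ : 0 < γ) (β : ℝ) {η : ℝ} (hη : 0 < η) :
    ∃ M, ∀ z : ℂ, M ≤ ‖z‖ → ‖laplaceExtension γ β z‖ ≤ η := by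
  have h1 : ContinuousAt (fun x : ℂ => 1 - (1 + x) ^ ((-β : ℝ) : ℂ)) 0 := by
    refine continuousAt_const.sub (ContinuousAt.cpow (by fun_prop) continuousAt_const ?_)
    simp
  obtain ⟨δ, hδ, h2⟩ := Metric.continuousAt_iff.1 h1 η hη
  have h3 := (tendsto_rpow_neg_atTop hγ).eventually (gt_mem_nhds hδ)
  obtain ⟨M, hM⟩ := eventually_atTop.1 h3
  refine ⟨M, fun z hz => ?_⟩
  have h4 := @h2 ((-z) ^ ((-γ : ℝ) : ℂ)) (by
    rw [dist_zero_right, Complex.norm_cpow_real, norm_neg]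
    exact hM _ hz)
  simpa [laplaceExtension] using h4.le

/-- The Laplace transform is continued to the half-plane. On vertical lines approaching the
imaginary axis it is small for large imaginary part, uniformly in the real part, and the bound
passes to the characteristic function on the boundary. -/
lemma measure_singleton_of_laplace {γ : ℝ} (hγ : γ ∈ Ioc (0 : ℝ) 1) (α : ℝ) {D : Measure ℝ}
    [IsProbabilityMeasure D] (hD : D (Iio 0) = 0)
    (h : ∀ lam : ℝ, 0 < lam →
      ∫ x, Real.exp (-lam * x) ∂D = 1 - MarkovBranching.laplaceTail α γ lam) (x : ℝ) :
    D {x} = 0 := by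
  have hext := complexMGF_eq_of_laplace_eq hD (analyticOnNhd_laplaceExtension hγ (α / γ))
    fun lam hlam => by
      rw [h lam hlam, ← MarkovBranching.laplaceTail_eq hγ.1 α hlam, laplaceExtension, neg_neg,
        ← Complex.ofReal_cpow hlam.le]
      push_cast
      rw [Complex.ofReal_cpow (by positivity)]
      push_cast
      rfl
  refine measure_singleton_of_tendsto_charFun (fun η hη => ?_) x
  obtain ⟨M, hM⟩ := laplaceExtension_small hγ.1 (α / γ) hη
  refine ⟨M, fun t ht => ?_⟩
  refine le_of_tendsto (tendsto_complexMGF_charFun hD t).norm ?_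
  filter_upwards [self_mem_nhdsWithin] with ε hε
  rw [hext (by simpa using hε)]
  refine hM _ (ht.trans ?_)
  have := Complex.abs_im_le_norm (-(ε : ℂ) + t * Complex.I)
  simpa using this

/-! ### Conditioning a counting variable on being positive -/

section ConditionalLaw

variable {Ω : Type*} [MeasurableSpace Ω] {P : Measure Ω} {N : Ω → ℕ}

lemma nullMeasurableSet_pos (hN : AEMeasurable N P) : NullMeasurableSet {ω | 0 < N ω} P :=
  nullMeasurableSet_lt aemeasurable_const hN

lemma integrable_pow [IsProbabilityMeasure P] (hN : AEMeasurable N P) {s : ℝ}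
    (hs : s ∈ Icc (0 : ℝ) 1) : Integrable (fun ω => s ^ N ω) P :=
  MarkovBranching.integrable_of_mem_Icc
    ((measurable_of_countable fun n : ℕ => s ^ n).comp_aemeasurable hN).aestronglyMeasurable
    fun _ => MarkovBranching.pow_mem_Icc hs _

/-- Since $0^0=1$, the variable $0^N$ is the indicator of $N=0$, so subtracting it restricts the
integral to $N>0$. -/
lemma setIntegral_pow_pos [IsProbabilityMeasure P] (hN : AEMeasurable N P) {s : ℝ}
    (hs : s ∈ Icc (0 : ℝ) 1) :
    ∫ ω in {ω | 0 < N ω}, s ^ N ω ∂P = (∫ ω, s ^ N ω ∂P) - ∫ ω, (0 : ℝ) ^ N ω ∂P := by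
  rw [← integral_sub (integrable_pow hN hs) (integrable_pow hN ⟨le_rfl, zero_le_one⟩),
    ← integral_indicator₀ (nullMeasurableSet_pos hN)]
  refine integral_congr_ae (ae_of_all _ fun ω => ?_)
  rcases Nat.eq_zero_or_pos (N ω) with h | h
  · simp [indicator, h]
  · simp [indicator, h, h.ne']

lemma measureReal_pos_eq [IsProbabilityMeasure P] (hN : AEMeasurable N P) :
    P.real {ω | 0 < N ω} = 1 - ∫ ω, (0 : ℝ) ^ N ω ∂P := by
  have h := setIntegral_pow_pos hN (s := 1) ⟨zero_le_one, le_rfl⟩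
  simpa using h

/-- The generating function of a counting variable conditioned to be positive. -/
lemma integral_pow_cond_pos [IsProbabilityMeasure P] (hN : AEMeasurable N P)
    (h0 : P {ω | 0 < N ω} ≠ 0) {s : ℝ} (hs : s ∈ Icc (0 : ℝ) 1) :
    ∫ ω, s ^ N ω ∂(cond P {ω | 0 < N ω}) =
      1 - (1 - ∫ ω, s ^ N ω ∂P) / (1 - ∫ ω, (0 : ℝ) ^ N ω ∂P) := by
  have h1 : P.real {ω | 0 < N ω} ≠ 0 := fun h => h0 ((measureReal_eq_zero_iff).1 h)
  have h2 := measureReal_pos_eq hN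
  rw [ProbabilityTheory.cond, integral_smul_measure, setIntegral_pow_pos hN hs, ENNReal.toReal_inv,
    smul_eq_mul]
  change (P.real {ω | 0 < N ω})⁻¹ * _ = _
  rw [h2] at h1 ⊢
  field_simp
  ring

/-- The law of `N / w` under the condition `0 < N`. -/
noncomputable def scaledLaw (P : Measure Ω) (N : Ω → ℕ) (w : ℝ) : Measure ℝ :=
  (cond P {ω | 0 < N ω}).map fun ω => (N ω : ℝ) / w

lemma aemeasurable_scaled (hN : AEMeasurable N P) (w : ℝ) :
    AEMeasurable (fun ω => (N ω : ℝ) / w) (cond P {ω | 0 < N ω}) :=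
  ((measurable_of_countable fun n : ℕ => (n : ℝ) / w).comp_aemeasurable hN).mono_ac
    cond_absolutelyContinuous

lemma isProbabilityMeasure_scaledLaw [IsProbabilityMeasure P] (hN : AEMeasurable N P)
    (h0 : P {ω | 0 < N ω} ≠ 0) (w : ℝ) : IsProbabilityMeasure (scaledLaw P N w) := by
  have := cond_isProbabilityMeasure h0
  exact Measure.isProbabilityMeasure_map (aemeasurable_scaled hN w)

lemma scaledLaw_Iio (hN : AEMeasurable N P) {w : ℝ} (hw : 0 < w) :
    scaledLaw P N w (Iio 0) = 0 := by
  rw [scaledLaw, Measure.map_apply_of_aemeasurable (aemeasurable_scaled hN w) measurableSet_Iio]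
  convert measure_empty (μ := cond P {ω | 0 < N ω})
  ext ω
  simp only [mem_preimage, mem_Iio, mem_empty_iff_false, iff_false, not_lt]
  positivity

lemma scaledLaw_real_Iic (hN : AEMeasurable N P) (w x : ℝ) :
    (scaledLaw P N w).real (Iic x) = (cond P {ω | 0 < N ω}).real {ω | (N ω : ℝ) / w ≤ x} := by
  rw [Measure.real, scaledLaw,
    Measure.map_apply_of_aemeasurable (aemeasurable_scaled hN w) measurableSet_Iic]
  rfl

lemma integral_exp_scaledLaw [IsProbabilityMeasure P] (hN : AEMeasurable N P)
    (h0 : P {ω | 0 < N ω} ≠ 0) {w : ℝ} (hw : 0 < w) {lam : ℝ} (hlam : 0 < lam) :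
    ∫ x, Real.exp (-lam * x) ∂(scaledLaw P N w) =
      1 - (1 - ∫ ω, Real.exp (-(lam / w)) ^ N ω ∂P) / (1 - ∫ ω, (0 : ℝ) ^ N ω ∂P) := by
  have hs : Real.exp (-(lam / w)) ∈ Icc (0 : ℝ) 1 :=
    ⟨(Real.exp_pos _).le, Real.exp_le_one_iff.2 (neg_nonpos.2 (by positivity))⟩
  rw [← integral_pow_cond_pos hN h0 hs, scaledLaw, integral_map (aemeasurable_scaled hN w)
    (Continuous.aestronglyMeasurable (by fun_prop))]
  refine integral_congr_ae (ae_of_all _ fun ω => ?_)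
  simp only
  rw [← Real.exp_nat_mul]
  congr 1
  ring

/-- Convergence in law of normalized counting variables conditioned to be positive, from the
convergence of their Laplace transforms. -/
lemma tendsto_cond_cdf [IsProbabilityMeasure P] {ι : Type*} {𝓕 : Filter ι} {N : ι → Ω → ℕ}
    {w : ι → ℝ} (hN : ∀ i, AEMeasurable (N i) P) (h0 : ∀ᶠ i in 𝓕, P {ω | 0 < N i ω} ≠ 0)
    (hw : ∀ᶠ i in 𝓕, 0 < w i) {D : Measure ℝ} [IsProbabilityMeasure D] (hD : D (Iio 0) = 0)
    (h : ∀ lam : ℝ, 0 < lam → Tendsto (fun i =>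
      (1 - ∫ ω, Real.exp (-(lam / w i)) ^ N i ω ∂P) / (1 - ∫ ω, (0 : ℝ) ^ N i ω ∂P)) 𝓕
        (𝓝 (1 - ∫ x, Real.exp (-lam * x) ∂D))) {x : ℝ} (hx : 0 ≤ x) (hDx : D {x} = 0) :
    Tendsto (fun i => (cond P {ω | 0 < N i ω}).real {ω | (N i ω : ℝ) / w i ≤ x}) 𝓕
      (𝓝 (D.real (Iic x))) := by
  classical
  -- A point mass stands in at the indices where conditioning or scaling is meaningless, so that
  -- every member of the family is a probability law on the half-line.
  set m : ι → Measure ℝ := fun i =>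
    if P {ω | 0 < N i ω} ≠ 0 ∧ 0 < w i then scaledLaw P (N i) (w i) else Measure.dirac 0 with hm
  have hm_eq : ∀ᶠ i in 𝓕, m i = scaledLaw P (N i) (w i) := by
    filter_upwards [h0, hw] with i h1 h2
    exact if_pos ⟨h1, h2⟩
  have hprob : ∀ i, IsProbabilityMeasure (m i) := fun i => by
    simp only [hm]
    split_ifs with hi
    · exact isProbabilityMeasure_scaledLaw (hN i) hi.1 _
    · infer_instance
  have hneg : ∀ i, m i (Iio 0) = 0 := fun i => by
    simp only [hm]
    split_ifs with hi
    · exact scaledLaw_Iio (hN i) hi.2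
    · simp
  refine (tendsto_cdf_of_tendsto_laplace hneg hD (fun lam hlam => ?_) hx hDx).congr' ?_
  · have h1 := (h lam hlam).const_sub 1
    rw [sub_sub_cancel] at h1
    refine h1.congr' ?_
    filter_upwards [hm_eq, h0, hw] with i hi h0i hwi
    rw [hi, integral_exp_scaledLaw (hN i) h0i hwi hlam]
  · filter_upwards [hm_eq] with i hi
    rw [hi, scaledLaw_real_Iic (hN i)]

end ConditionalLaw

/-- A mixture of a law on the half-line with the point mass at the origin. -/
lemma exists_mixture {D : Measure ℝ} [IsProbabilityMeasure D] (hD : D (Iio 0) = 0) {a b : ℝ}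
    (ha : 0 ≤ a) (hb : 0 ≤ b) (hab : a + b = 1) :
    ∃ D' : Measure ℝ, IsProbabilityMeasure D' ∧ D' (Iio 0) = 0 ∧
      (∀ x : ℝ, 0 < x → D {x} = 0 → D' {x} = 0) ∧
      (∀ x : ℝ, 0 ≤ x → D'.real (Iic x) = a + b * D.real (Iic x)) ∧
      ∀ lam : ℝ, 0 < lam →
        ∫ x, Real.exp (-lam * x) ∂D' = a + b * ∫ x, Real.exp (-lam * x) ∂D := by
  refine ⟨ENNReal.ofReal a • Measure.dirac 0 + ENNReal.ofReal b • D, ⟨?_⟩, ?_, ?_, ?_, ?_⟩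
  · simp [← ENNReal.ofReal_add ha hb, hab]
  · simp [hD]
  · intro x hx h
    simp [h, hx.ne]
  · intro x hx
    have h1 := Measure.smul_finite (Measure.dirac (0 : ℝ)) (ENNReal.ofReal_ne_top (r := a))
    have h2 := Measure.smul_finite D (ENNReal.ofReal_ne_top (r := b))
    rw [measureReal_add_apply, measureReal_ennreal_smul_apply, measureReal_ennreal_smul_apply,
      ENNReal.toReal_ofReal ha, ENNReal.toReal_ofReal hb]
    simp [Measure.real, hx]
  · intro lam hlam
    have h1 : Integrable (fun x => Real.exp (-lam * x)) D := by
      refine Integrable.of_bound (by fun_prop) 1 ?_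
      filter_upwards [ae_nonneg_of_Iio hD] with x hx
      rw [Real.norm_eq_abs, Real.abs_exp, Real.exp_le_one_iff]
      nlinarith
    rw [integral_add_measure ((integrable_dirac (by simp)).smul_measure ENNReal.ofReal_ne_top)
      (h1.smul_measure ENNReal.ofReal_ne_top), integral_smul_measure, integral_smul_measure,
      ENNReal.toReal_ofReal ha, ENNReal.toReal_ofReal hb]
    simp

/-! ### The limit law and the conditional limit theorems -/

namespace MarkovBranching

lemma laplaceTail_zero {α γ : ℝ} (hα : 0 < α) (hγ : 0 < γ) :
    Tendsto (laplaceTail α γ) (𝓝[>] 0) (𝓝 0) := by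
  have h : ContinuousAt (laplaceTail α γ) 0 := by
    refine ContinuousAt.div (Real.continuousAt_rpow_const _ _ (Or.inr hα.le))
      (ContinuousAt.rpow_const (continuousAt_const.add
        (Real.continuousAt_rpow_const _ _ (Or.inr hγ.le))) (Or.inl ?_)) ?_
    · simp [Real.zero_rpow hγ.ne']
    · simp [Real.zero_rpow hγ.ne']
  have h0 : laplaceTail α γ 0 = 0 := by simp [laplaceTail, Real.zero_rpow hα.ne']
  have := h.tendsto
  rw [h0] at this
  exact this.mono_left nhdsWithin_le_nhds

lemma laplaceTail_atTop {γ : ℝ} (α : ℝ) (hγ : 0 < γ) :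
    Tendsto (laplaceTail α γ) atTop (𝓝 1) := by
  have h1 : Tendsto (fun lam : ℝ => (1 + lam ^ (-γ)) ^ (-(α / γ))) atTop
      (𝓝 ((1 + 0) ^ (-(α / γ)))) :=
    ((tendsto_rpow_neg_atTop hγ).const_add 1).rpow_const (Or.inl (by norm_num))
  rw [add_zero, Real.one_rpow] at h1
  refine h1.congr' ?_
  filter_upwards [eventually_gt_atTop 0] with lam hlam
  exact laplaceTail_eq hγ α hlam

variable {Ω : Type*} [MeasurableSpace Ω] {P : Measure Ω}
  {μ γ α θ : ℝ} {p im : PMF ℕ} {L l r LR : ℝ → ℝ} {ν : ℝ≥0 → Ω → ℕ} {I : ℕ → Ω → ℕ}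
  {T : ℕ → ℕ → Ω → TreeData}

lemma IsMBPNPI.integral_pow_group [IsProbabilityMeasure P] (hY : IsMBPNPI μ p im r ν I T P)
    (hμ : 0 < μ) {s : ℝ} (hs : s ∈ Icc (0 : ℝ) 1) (τ : ℝ) :
    ∫ ω, s ^ groupSize τ (I 1 ω) (fun j => T 1 j ω) ∂P = 1 - q μ p im τ s := by
  have h := hY.integral_groups hμ hs (fun _ => τ) 1
  simpa [q] using h

lemma IsMBPNPI.measurable_group (hY : IsMBPNPI μ p im r ν I T P) (τ : ℝ) :
    Measurable fun ω => groupSize τ (I 1 ω) (fun j => T 1 j ω) :=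
  measurable_groupSize measurable_const (hY.measurable_I 1)
    (measurable_pi_lambda _ fun j => hY.measurable_T 1 j)

/-- The limit law of the normalized size of a group of immigrants, given its survival. -/
lemma IntegrableRegime.exists_limitLaw [IsProbabilityMeasure P]
    (H : IntegrableRegime μ p im γ α θ L l r LR) (hα : 0 < α) (hγ1 : γ ≤ 1)
    (hY : IsMBPNPI μ p im r ν I T P) :
    ∃ D : Measure ℝ, IsProbabilityMeasure D ∧ D (Iio 0) = 0 ∧ D (Iic 0) = 0 ∧
      (∀ x, D {x} = 0) ∧
      ∀ lam : ℝ, 0 < lam → ∫ x, Real.exp (-lam * x) ∂D = 1 - laplaceTail α γ lam := by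
  -- The size at age $n$ of the group with index $1$. Given survival, its scaled Laplace transform
  -- is $1-q(n;\sigma)/q(n;0)$ with $\sigma=e^{-\lambda/W(\mu n)}$, and integer ages suffice to
  -- identify the limit.
  set N : ℕ → Ω → ℕ := fun n ω => groupSize n (I 1 ω) (fun j => T 1 j ω)
  set w : ℕ → ℝ := fun n => W p (μ * n)
  have hw : ∀ n, 0 < w n := fun n =>
    zero_lt_one.trans_le (one_le_W H.subcritical (mul_nonneg H.hμ.le (Nat.cast_nonneg n)))
  have hN : ∀ n, AEMeasurable (N n) P := fun n => (hY.measurable_group n).aemeasurable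
  have hpow : ∀ n : ℕ, ∀ s ∈ Icc (0 : ℝ) 1, 1 - ∫ ω, s ^ N n ω ∂P = q μ p im n s := fun n s hs => by
    rw [hY.integral_pow_group H.hμ hs]
    ring
  have hpos : ∀ n, P {ω | 0 < N n ω} ≠ 0 := fun n hn => by
    have h1 := measureReal_pos_eq (hN n)
    rw [hpow n 0 zero_mem_Icc, Measure.real, hn] at h1
    exact (H.q_pos (Nat.cast_nonneg n)).ne h1
  have hprob : ∀ n, IsProbabilityMeasure (scaledLaw P (N n) (w n)) := fun n =>
    isProbabilityMeasure_scaledLaw (hN n) (hpos n) _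
  have hlim : ∀ lam : ℝ, 0 < lam → Tendsto (fun n => ∫ x, Real.exp (-lam * x)
      ∂(scaledLaw P (N n) (w n))) atTop (𝓝 (1 - laplaceTail α γ lam)) := by
    intro lam hlam
    have h1 := (tendsto_q_ratio_laplace H.hμ H.hγ H.hL H.hf H.hl H.hg hlam 0).comp
      tendsto_natCast_atTop_atTop
    refine (h1.const_sub 1).congr fun n => ?_
    have h2 := laplaceArg_mem H.hμ H.subcritical hlam (Nat.cast_nonneg n)
    have h3 := hpow n _ ⟨h2.1, h2.2.le⟩
    rw [laplaceArg] at h3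
    rw [integral_exp_scaledLaw (hN n) (hpos n) (hw n) hlam, hpow n 0 zero_mem_Icc, h3]
    simp [laplaceArg]
  have h0 := (laplaceTail_zero hα H.hγ).const_sub 1
  rw [sub_zero] at h0
  obtain ⟨D, hD, hD0, hLT⟩ := exists_measure_of_tendsto_laplace
    (fun n => scaledLaw_Iio (hN n) (hw n)) hlim h0
  refine ⟨D, hD, hD0, measure_Iic_zero_of_tendsto_laplace hD0 ?_,
    measure_singleton_of_laplace ⟨H.hγ, hγ1⟩ α hD0 hLT, hLT⟩
  have h1 := (laplaceTail_atTop α H.hγ).const_sub 1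
  rw [sub_self] at h1
  refine h1.congr' ?_
  filter_upwards [eventually_gt_atTop 0] with lam hlam
  exact (hLT lam hlam).symm

lemma IsMBPNPI.aemeasurable_Y (hY : IsMBPNPI μ p im r ν I T P) (t : ℝ≥0) :
    AEMeasurable (Y ν I T t) P :=
  ⟨_, (measurable_pathY t).comp hY.measurable_ingredients, hY.Y_ae_eq t⟩

lemma IntegrableRegime.eventually_pos [IsProbabilityMeasure P]
    (H : IntegrableRegime μ p im γ α θ L l r LR) (hY : IsMBPNPI μ p im r ν I T P) :
    ∀ᶠ t : ℝ≥0 in atTop, P {ω | 0 < Y ν I T t ω} ≠ 0 := by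
  filter_upwards [(NNReal.tendsto_coe_atTop.2 tendsto_id).eventually H.cumulant_zero_pos,
    eventually_gt_atTop 0] with t ht ht0 hc
  have h1 := measureReal_pos_eq (hY.aemeasurable_Y t)
  rw [hY.integral_pow_Y H.hμ H.subcritical H.hr_nonneg H.hR zero_mem_Icc ht0, Measure.real,
    hc] at h1
  have h2 : Real.exp (-cumulant r μ p im t 0) < 1 := Real.exp_lt_one_iff.2 (neg_lt_zero.2 ht)
  simp only [ENNReal.toReal_zero] at h1
  linarith

lemma IntegrableRegime.tendsto_ratio [IsProbabilityMeasure P]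
    (H : IntegrableRegime μ p im γ α θ L l r LR) (hY : IsMBPNPI μ p im r ν I T P) {σ : ℝ → ℝ}
    (hσ : ∀ᶠ t in atTop, σ t ∈ Icc (0 : ℝ) 1) {c : ℝ}
    (hc : Tendsto (fun t => cumulant r μ p im t (σ t) / cumulant r μ p im t 0) atTop (𝓝 c)) :
    Tendsto (fun t : ℝ≥0 => (1 - ∫ ω, σ t ^ Y ν I T t ω ∂P) /
      (1 - ∫ ω, (0 : ℝ) ^ Y ν I T t ω ∂P)) atTop (𝓝 c) := by
  have hcoe : Tendsto (fun t : ℝ≥0 => (t : ℝ)) atTop atTop := NNReal.tendsto_coe_atTop.2 tendsto_id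
  refine ((H.tendsto_ratio_of_cumulant hc).comp hcoe).congr' ?_
  filter_upwards [hcoe.eventually hσ, eventually_gt_atTop 0] with t ht ht0
  rw [hY.integral_pow_Y H.hμ H.subcritical H.hr_nonneg H.hR zero_mem_Icc ht0,
    hY.integral_pow_Y H.hμ H.subcritical H.hr_nonneg H.hR ht ht0]
  rfl

lemma IntegrableRegime.tendsto_cond_pow [IsProbabilityMeasure P]
    (H : IntegrableRegime μ p im γ α θ L l r LR) (hY : IsMBPNPI μ p im r ν I T P) {s : ℝ}
    (hs : s ∈ Icc (0 : ℝ) 1) {c : ℝ}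
    (hc : Tendsto (fun t => cumulant r μ p im t s / cumulant r μ p im t 0) atTop (𝓝 c)) :
    Tendsto (fun t : ℝ≥0 => ∫ ω, s ^ Y ν I T t ω ∂(cond P {ω | 0 < Y ν I T t ω})) atTop
      (𝓝 (1 - c)) := by
  refine ((H.tendsto_ratio hY (Eventually.of_forall fun _ => hs) hc).const_sub 1).congr' ?_
  filter_upwards [H.eventually_pos hY] with t ht
  exact (integral_pow_cond_pos (hY.aemeasurable_Y t) ht hs).symm

/-- Convergence in law of the normalized process given survival, when `r / q` converges. -/
lemma IntegrableRegime.tendsto_cond_cdf_Y [IsProbabilityMeasure P]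
    (H : IntegrableRegime μ p im γ α θ L l r LR) (hY : IsMBPNPI μ p im r ν I T P) {d : ℝ}
    (hd : 0 ≤ d) (hrq : Tendsto (fun t => r t / q μ p im t 0) atTop (𝓝 d))
    {D : Measure ℝ} [IsProbabilityMeasure D] (hD : D (Iio 0) = 0)
    (hLT : ∀ lam : ℝ, 0 < lam → ∫ x, Real.exp (-lam * x) ∂D =
      1 - (∫ u in Ioi 0, r u) * laplaceTail α γ lam / ((∫ u in Ioi 0, r u) + d * Q μ p im))
    {x : ℝ} (hx : 0 ≤ x) (hDx : D {x} = 0) :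
    Tendsto (fun t : ℝ≥0 => (cond P {ω | 0 < Y ν I T t ω}).real
      {ω | (Y ν I T t ω : ℝ) / W p (μ * t) ≤ x}) atTop (𝓝 (D.real (Iic x))) := by
  refine tendsto_cond_cdf (fun t => hY.aemeasurable_Y t) (H.eventually_pos hY)
    (Eventually.of_forall fun t => zero_lt_one.trans_le
      (one_le_W H.subcritical (mul_nonneg H.hμ.le t.2))) hD (fun lam hlam => ?_) hx hDx
  have hσ : ∀ᶠ t in atTop, laplaceArg μ p lam t ∈ Icc (0 : ℝ) 1 := by
    filter_upwards [eventually_ge_atTop 0] with t ht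
    exact Ico_subset_Icc_self (laplaceArg_mem H.hμ H.subcritical hlam ht)
  have h1 := H.tendsto_cumulant_ratio_of_tendsto hd hrq hσ ⟨zero_le_one, le_rfl⟩
    (tendsto_laplaceArg H.hμ H.subcritical lam)
    (tendsto_q_ratio_laplace H.hμ H.hγ H.hL H.hf H.hl H.hg hlam)
  -- Recent immigrants carry the weight $d\,\Delta(1)=0$: their families vanish on the scale $W(\mu
  -- t)$.
  rw [Δ_one H.hμ, mul_zero, add_zero] at h1
  rw [hLT lam hlam, sub_sub_cancel]
  exact H.tendsto_ratio hY hσ h1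

end MarkovBranching

open MarkovBranching in
theorem theorem5p1
    -- the branching mechanism: exponential life lengths, offspring distribution `p`
    (μ : ℝ) (hμ : 0 < μ) (p : PMF ℕ)
    (γ : ℝ) (hγ : γ ∈ Ioc (0 : ℝ) 1) (L : ℝ → ℝ) (hL : SlowlyVarying L)
    (hf : ∀ s ∈ Ico (0 : ℝ) 1, pgf p s = s + (1 - s) ^ (γ + 1) * L (1 / (1 - s)))
    -- the distribution `im` of the number of immigrants
    (im : PMF ℕ) (α : ℝ) (hα : α ∈ Ioc (0 : ℝ) 1) (l : ℝ → ℝ) (hl : SlowlyVarying l)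
    (hg : ∀ s ∈ Ico (0 : ℝ) 1, pgf im s = 1 - (1 - s) ^ α * l (1 / (1 - s)))
    -- the intensity of the immigration times
    (r : ℝ → ℝ) (hr_nonneg : ∀ t, 0 < t → 0 ≤ r t)
    (θ : ℝ) (LR : ℝ → ℝ) (hLR : SlowlyVarying LR)
    (hr : ∀ t, 0 < t → r t = t ^ (-θ) * LR t)
    (hθ : 1 ≤ θ) (hR : IntegrableOn r (Ioi 0))
    (hαγ : 1 ≤ α / γ) (hQ : IntegrableOn (fun t => q μ p im t 0) (Ioi 0))
    -- the process
    {Ω : Type*} [MeasurableSpace Ω] (P : Measure Ω) [IsProbabilityMeasure P]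
    (ν : ℝ≥0 → Ω → ℕ) (I : ℕ → Ω → ℕ) (T : ℕ → ℕ → Ω → TreeData)
    (hY : IsMBPNPI μ p im r ν I T P) :
    -- `Δ` is well defined, and `Δ(s) → 0` as `s ↑ 1`
    (∀ s ∈ Icc (0 : ℝ) 1, IntegrableOn (fun t => q μ p im t s) (Ioi 0)) ∧
    Tendsto (Δ μ p im) (𝓝[<] 1) (𝓝 0) ∧
    -- conditioning on `Y(t) > 0` makes sense
    (∀ᶠ t : ℝ≥0 in atTop, P {ω | 0 < Y ν I T t ω} ≠ 0) ∧
    -- (i)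
    ((fun t => q μ p im t 0) =o[atTop] r →
      ∀ s ∈ Icc (0 : ℝ) 1,
        Tendsto (fun t : ℝ≥0 => ∫ ω, s ^ Y ν I T t ω ∂(cond P {ω | 0 < Y ν I T t ω})) atTop
          (𝓝 (1 - Δ μ p im s / Q μ p im))) ∧
    -- the distribution `D(α,γ)`
    ∃ D : Measure ℝ, IsProbabilityMeasure D ∧ D (Iic 0) = 0 ∧
      (∀ lam : ℝ, 0 < lam →
        ∫ x, Real.exp (-lam * x) ∂D = 1 - lam ^ α / (1 + lam ^ γ) ^ (α / γ)) ∧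
      -- (ii)
      (r =o[atTop] (fun t => q μ p im t 0) →
        ∀ x : ℝ, 0 ≤ x →
          Tendsto (fun t : ℝ≥0 => (cond P {ω | 0 < Y ν I T t ω}).real
              {ω | (Y ν I T t ω : ℝ) / W p (μ * t) ≤ x}) atTop
            (𝓝 (D.real (Iic x)))) ∧
      -- (iii)
      (∀ d : ℝ, 0 < d → Tendsto (fun t => r t / q μ p im t 0) atTop (𝓝 d) →
        (∀ s ∈ Ico (0 : ℝ) 1,
          Tendsto (fun t : ℝ≥0 => ∫ ω, s ^ Y ν I T t ω ∂(cond P {ω | 0 < Y ν I T t ω})) atTop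
            (𝓝 (d * Q μ p im / (d * Q μ p im + ∫ t in Ioi (0 : ℝ), r t) *
              (1 - Δ μ p im s / Q μ p im)))) ∧
        (∀ x : ℝ, 0 < x →
          Tendsto (fun t : ℝ≥0 => (cond P {ω | 0 < Y ν I T t ω}).real
              {ω | (Y ν I T t ω : ℝ) / W p (μ * t) ≤ x}) atTop
            (𝓝 ((d * Q μ p im + (∫ t in Ioi (0 : ℝ), r t) * D.real (Iic x)) /
              (d * Q μ p im + ∫ t in Ioi (0 : ℝ), r t))))) := by
  have H : IntegrableRegime μ p im γ α θ L l r LR :=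
    { hμ := hμ, hγ := hγ.1, hL := hL, hf := hf, hl := hl, hg := hg, hr_nonneg := hr_nonneg,
      hLR := hLR, hr := hr, hθ := zero_le_one.trans hθ, hR := hR, hQ := hQ }
  have hQ0 := H.Q_pos
  have hR0 := H.integral_r_pos
  obtain ⟨D, hD, hD0, hDIic, hDx, hLT⟩ := H.exists_limitLaw hα.1 hγ.2 hY
  refine ⟨fun s hs => integrableOn_q hμ hs hQ, tendsto_Δ hμ hQ, H.eventually_pos hY,
    fun ho s hs => H.tendsto_cond_pow hY hs (H.tendsto_cumulant_ratio_of_isLittleO ho hs),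
    D, hD, hDIic, hLT, fun ho x hx => ?_, fun d hd hrq => ⟨fun s hs => ?_, fun x hx => ?_⟩⟩
  -- Case (ii) is $d=0$, where the factor $R$ cancels.
  · refine H.tendsto_cond_cdf_Y hY le_rfl ho.tendsto_div_nhds_zero hD0 (fun lam hlam => ?_) hx
      (hDx x)
    rw [hLT lam hlam, zero_mul, add_zero, mul_div_cancel_left₀ _ hR0.ne']
  · have hs' := Ico_subset_Icc_self hs
    have h1 := H.tendsto_cumulant_ratio_of_tendsto hd.le hrq (Eventually.of_forall fun _ => hs')
      hs' tendsto_const_nhds (tendsto_q_ratio_const hμ hγ.1 hL hf hl hg hs)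
    have h2 := H.tendsto_cond_pow hY hs' h1
    convert h2 using 2
    field_simp
    ring
  · set R := ∫ t in Ioi (0 : ℝ), r t
    have hpos : 0 < d * Q μ p im + R := by positivity
    -- The limit law in (iii) mixes the point mass at $0$, for recent immigrants, with $D$, for old
    -- ones. The atom at $0$ is why $x>0$ is required.
    obtain ⟨D', hD', hD'0, hD'x, hD'Iic, hD'LT⟩ := exists_mixture hD0
      (a := d * Q μ p im / (d * Q μ p im + R)) (b := R / (d * Q μ p im + R)) (by positivity)
      (by positivity) (by field_simp)
    have h1 := H.tendsto_cond_cdf_Y hY hd.le hrq hD'0 (fun lam hlam => by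
      rw [hD'LT lam hlam, hLT lam hlam, add_comm R]
      field_simp
      ring) hx.le (hD'x x hx (hDx x))
    rw [hD'Iic x hx.le] at h1
    convert h1 using 2
    field_simp
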